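/- **Setting.** Let $\mathbb T=[-\pi,\pi]$ with periodic boundary conditions, $\langle u\rangle=\frac1{2\pi}\int_{\mathbb T}u\,dx$, $\hat u(k)=\frac1{2\pi}\int_{\mathbb T}u(x)e^{-ikx}dx$. For $s\ge 0$ let $\dot A^s$ be the space of integrable functions of zero mean with $\|u\|_{\dot A^s}=\sum_{k\in\mathbb Z}|k|^s|\hat u(k)|<\infty$, $\dot A=\dot A^0$, and let $\dot H^1$ be the space of square integrable functions of zero mean with $\sum_k|k|^2|\hat u(k)|^2<\infty$. For a Banach space $X$ let $\mathcal M(0,T;X)$ be the space of $X$-valued Radon measures on $[0,T]$ (a function $u$ being identified with the measure $u\,dt$). Let $\rho_\pm,\mu_\pm>0$ be the densities and viscosities of the upper ($+$) and the lower ($-$) fluid and set $b=\rho_+$, $b_\mu=\frac{\mu_-}{\mu_+}b$, $b_\rho=\frac{\rho_-}{\rho_+}b$. Given $f_0,g_0:\mathbb T\to\mathbb R$ put $\bar f_0=f_0-\langle f_0\rangle$, $\bar g_0=g_0-\langle g_0\rangle$, and consider the gravity driven thin film Muskat system (no surface tension) $$\partial_t\bar f=\partial_x\big[(\bar f+\langle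 f_0\rangle)(b_\rho\partial_x\bar f+b\,\partial_x\bar g)\big],\qquad \partial_t\bar g=\partial_x\big[(\bar g+\langle g_0\rangle)(b_\mu\partial_x\bar f+b_\mu\partial_x\bar g)\big]$$ with $(\bar f,\bar g)|_{t=0}=(\bar f_0,\bar g_0)$. A *weak solution* on $[0,T)$ is a pair of zero mean functions $\bar f,\bar g\in L^1(0,T;W^{1,1}(\mathbb T))$ whose products $\bar f(b_\rho\partial_x\bar f+b\,\partial_x\bar g)$ and $\bar g(b_\mu\partial_x\bar f+b_\mu\partial_x\bar g)$ are integrable on $(0,T)\times\mathbb T$, and such that for all $\phi,\psi\in C^1_c([0,T)\times\mathbb T)$ $$-\int_{\mathbb T}\bar f_0\,\phi(0)\,dx-\int_0^T\!\!\int_{\mathbb T}\bar f\,\partial_t\phi\,dx\,dt=-\int_0^T\!\!\int_{\mathbb T}(\bar f+\langle f_0\rangle)(b_\rho\partial_x\bar f+b\,\partial_x\bar g)\,\partial_x\phi\,dx\,dt,$$ $$-\int_{\mathbb T}\bar g_0\,\psi(0)\,dx-\int_0^T\!\!\int_{\mathbb T}\bar g\,\partial_t\psi\,dx\,dt=-\int_0^T\!\!\int_{\mathbb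 T}(\bar g+\langle g_0\rangle)(b_\mu\partial_x\bar f+b_\mu\partial_x\bar g)\,\partial_x\psi\,dx\,dt.$$ Let $\mathcal E_0=\|\bar f_0\|_{\dot A}+\|\bar g_0\|_{\dot A}$ and $$\sigma_{1,b}=\langle f_0\rangle b_\rho-\langle g_0\rangle b_\mu-\mathcal E_0(2b_\rho+2b+4b_\mu),\qquad \sigma_{2,b}=\langle g_0\rangle b_\mu-\langle f_0\rangle b-\mathcal E_0(2b_\rho+2b+4b_\mu).$$ **Theorem 2.** Let $\bar f_0,\bar g_0\in\dot A(\mathbb T)$ with $\mathcal E_0<\min\{\langle f_0\rangle,\langle g_0\rangle\}$ and $\min\{\sigma_{1,b},\sigma_{2,b}\}>0$. Then: a) (Existence) There is a global weak solution $(\bar f,\bar g)$, i.e. a pair of functions of $t>0$ that is a weak solution on $[0,T)$ for every $T>0$, such that for every $T>0$ and every $\alpha\in[0,\frac12)$ both $\bar f$ and $\bar g$ belong to $$L^\infty([0,T]\times\mathbb T)\cap L^2(0,T;W^{1,\infty}(\mathbb T))\cap L^1(0,T;C^{1+\alpha}(\mathbb T))\cap\mathcal M(0,T;W^{2,\infty}(\mathbb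 T))\cap L^2(0,T;\dot H^1(\mathbb T)).$$ b) (Exponential decay) With $\delta_b=\min\{\sigma_{1,b},\sigma_{2,b}\}>0$, this solution satisfies $\|\bar f(T)\|_{L^\infty}+\|\bar g(T)\|_{L^\infty}\le\mathcal E_0\,e^{-\delta_bT}$ for all $T>0$. c) (Uniqueness) For every $T>0$, any two weak solutions on $[0,T)$ with this initial datum that are bounded on $[0,T]\times\mathbb T$ (as the solution in a) is) and belong to $(L^1(0,T;\dot A^2(\mathbb T)))^2$ coincide almost everywhere on $(0,T)\times\mathbb T$. -/

import Mathlib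

open MeasureTheory Set Filter Topology
open scoped ENNReal NNReal

noncomputable section

namespace ThinFilm

instance factTwoPiPos : Fact ((0 : ℝ) < 2 * Real.pi) := ⟨Real.two_pi_pos⟩

/-- The torus, i.e. `[-π, π]` with its end points identified. Its `volume` is Lebesgue measure,
of total mass `2π`. -/
abbrev Torus : Type := AddCircle (2 * Real.pi)

/-! ### Calculus on the torus -/

/-- The classical derivative of a function on the torus. -/
def dx (φ : Torus → ℝ) : Torus → ℝ :=
  fun x => deriv (fun y : ℝ => φ (x + (y : Torus))) 0

/-- A function on the torus is of class `C^n` if its `2π`-periodic lift to the line is. -/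
def IsCn (n : WithTop ℕ∞) (φ : Torus → ℝ) : Prop :=
  ContDiff ℝ n (fun y : ℝ => φ (y : Torus))

/-- `v` is the `n`-th weak (distributional) derivative of `u` on the torus. -/
def HasWeakDeriv (n : ℕ) (u v : Torus → ℝ) : Prop :=
  Integrable u volume ∧ Integrable v volume ∧
    ∀ φ : Torus → ℝ, IsCn ((⊤ : ℕ∞) : WithTop ℕ∞) φ → ∫ x, u x * (dx^[n] φ) x = (-1) ^ n * ∫ x, v x * φ x

/-- The mean `⟨u⟩ = (2π)⁻¹ ∫ u`. -/
def mean (u : Torus → ℝ) : ℝ := (2 * Real.pi)⁻¹ * ∫ x, u x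

/-- The zero-mean part `u - ⟨u⟩`. -/
def fluct (u : Torus → ℝ) : Torus → ℝ := fun x => u x - mean u

/-- The Fourier coefficient `û(k) = (2π)⁻¹ ∫ u(x) e^{-ikx} dx`. -/
def fourierHat (u : Torus → ℝ) (k : ℤ) : ℂ := fourierCoeff (fun x => (u x : ℂ)) k

/-! ### Function spaces on the torus

A space `X` of functions on the torus is given by its norm with values in `[0, ∞]`; the functions
of `X` are those of finite norm. -/

/-- The homogeneous Wiener norm `∑ |k|^s |û(k)|` of `Ȧ^s`, infinite for functions that are not
integrable or not of zero mean. -/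
def wienerNorm (s : ℝ) (u : Torus → ℝ) : ℝ≥0∞ :=
  ⨅ (_ : Integrable u volume ∧ ∫ x, u x = 0),
    ∑' k : ℤ, ENNReal.ofReal (|(k : ℝ)| ^ s) * ‖fourierHat u k‖ₑ

/-- The homogeneous Sobolev norm `(∑ |k|^{2s} |û(k)|²)^{1/2}` of `Ḣ^s`, infinite for functions that
are not square integrable or not of zero mean. -/
def hDotNorm (s : ℝ) (u : Torus → ℝ) : ℝ≥0∞ :=
  ⨅ (_ : MemLp u 2 volume ∧ ∫ x, u x = 0),
    (∑' k : ℤ, ENNReal.ofReal (|(k : ℝ)| ^ (2 * s)) * ‖fourierHat u k‖ₑ ^ 2) ^ (1 / 2 : ℝ)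

/-- The norm `‖u‖_{L^p} + ‖∂ₓⁿu‖_{L^p}` of `W^{n,p}`, infinite if there is no `n`-th weak
derivative (which is unique up to a null set when it exists). -/
def sobolevNorm (n : ℕ) (p : ℝ≥0∞) (u : Torus → ℝ) : ℝ≥0∞ :=
  ⨅ (v : Torus → ℝ) (_ : HasWeakDeriv n u v), eLpNorm u p volume + eLpNorm v p volume

/-- The norm of `C^{1+α}`: the supremum norms of `u` and `u'` plus the `α`-Hölder seminorm of
`u'`. For `α = 0` this is an equivalent norm of `C^1`. -/
def c1HolderNorm (α : ℝ≥0) (u : Torus → ℝ) : ℝ≥0∞ :=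
  ⨅ (_ : IsCn 1 u), (⨆ x, ‖u x‖ₑ) + (⨆ x, ‖dx u x‖ₑ) + eHolderNorm α (dx u)

/-! ### Spaces of functions of time with values in a function space -/

/-- The Bochner space `L^p(0,T;X)`, `X` being given by its norm `N`: `t ↦ u t` is the almost
everywhere limit, in the norm of `X`, of simple functions with values in `X`, and the `p`-th power
of its norm is integrable. -/
def MemBochner (p : ℝ) (T : ℝ) (N : (Torus → ℝ) → ℝ≥0∞) (u : ℝ → Torus → ℝ) : Prop :=
  (∃ s : ℕ → SimpleFunc ℝ (Torus → ℝ), (∀ n t, N (s n t) < ∞) ∧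
    ∀ᵐ t ∂(volume.restrict (Ioo 0 T)), Tendsto (fun n => N (u t - s n t)) atTop (𝓝 0)) ∧
  ∫⁻ t in Ioo 0 T, N (u t) ^ p < ∞

/-- The space-time slab `(0,T) × 𝕋` with Lebesgue measure. -/
def slab (T : ℝ) : Measure (ℝ × Torus) :=
  (volume.restrict (Ioo 0 T)).prod volume

/-- The function `x ↦ ∫_B u(t,x) dt`. -/
def timeIntegral (u : ℝ → Torus → ℝ) (B : Set ℝ) : Torus → ℝ := fun x => ∫ t in B, u t x

/-- The space `𝓜(0,T;X)` of Radon measures with values in the function space `X` of norm `N`, for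
an element that is (the measure with density) a function `u`: the set function `B ↦ ∫_B u(t) dt`
on the Borel subsets of `[0,T]` takes values in `X`, is countably additive in the norm of `X`, and
has finite total variation. -/
def MemRadon (T : ℝ) (N : (Torus → ℝ) → ℝ≥0∞) (u : ℝ → Torus → ℝ) : Prop :=
  Integrable (fun p : ℝ × Torus => u p.1 p.2) (slab T) ∧
  (∀ B : Set ℝ, MeasurableSet B → B ⊆ Icc 0 T → N (timeIntegral u B) < ∞) ∧
  (∀ B : ℕ → Set ℝ, (∀ i, MeasurableSet (B i) ∧ B i ⊆ Icc 0 T) →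
    Pairwise (fun i j => Disjoint (B i) (B j)) →
    Tendsto (fun n => N (timeIntegral u (⋃ i, B i) - ∑ i ∈ Finset.range n, timeIntegral u (B i)))
      atTop (𝓝 0)) ∧
  ∃ C : ℝ≥0, ∀ (n : ℕ) (B : Fin n → Set ℝ), (∀ i, MeasurableSet (B i) ∧ B i ⊆ Icc 0 T) →
    Pairwise (fun i j => Disjoint (B i) (B j)) → ∑ i, N (timeIntegral u (B i)) ≤ C

/-! ### The gravity driven thin film Muskat system -/

/-- The physical parameters: densities and viscosities of the lower (`m`) and the upper (`p`)
fluid. -/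
structure Fluids where
  ρm : ℝ
  ρp : ℝ
  μm : ℝ
  μp : ℝ
  ρm_pos : 0 < ρm
  ρp_pos : 0 < ρp
  μm_pos : 0 < μm
  μp_pos : 0 < μp

/-- `b = ρ₊`. -/
def Fluids.b (P : Fluids) : ℝ := P.ρp

/-- `b_μ = (μ₋/μ₊) b`. -/
def Fluids.bμ (P : Fluids) : ℝ := P.μm / P.μp * P.b

/-- `b_ρ = (ρ₋/ρ₊) b`. -/
def Fluids.bρ (P : Fluids) : ℝ := P.ρm / P.ρp * P.b

/-- Test functions of class `C^1_c([0,T) × 𝕋)`, given as restrictions of functions that are `C^1`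
on `ℝ × 𝕋`. -/
def IsTest (T : ℝ) (φ : ℝ → Torus → ℝ) : Prop :=
  ContDiff ℝ 1 (fun p : ℝ × ℝ => φ p.1 (p.2 : Torus)) ∧ ∃ τ < T, ∀ t, τ ≤ t → ∀ x, φ t x = 0

/-- `v` is the weak derivative in space of `u` on `(0,T) × 𝕋`. -/
def IsSpaceDeriv (T : ℝ) (u v : ℝ → Torus → ℝ) : Prop :=
  Integrable (fun p : ℝ × Torus => u p.1 p.2) (slab T) ∧
  Integrable (fun p : ℝ × Torus => v p.1 p.2) (slab T) ∧
  ∀ᵐ t ∂(volume.restrict (Ioo 0 T)), HasWeakDeriv 1 (u t) (v t)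

/-- The weak form on `[0,T)` of `∂ₜu = ∂ₓ((u + c) q)`, `u(0) = u₀`. -/
def WeakEq (T c : ℝ) (u₀ : Torus → ℝ) (u q : ℝ → Torus → ℝ) : Prop :=
  Integrable (fun p : ℝ × Torus => u p.1 p.2 * q p.1 p.2) (slab T) ∧
  ∀ φ : ℝ → Torus → ℝ, IsTest T φ →
    -(∫ x, u₀ x * φ 0 x) - ∫ p, u p.1 p.2 * deriv (fun s => φ s p.2) p.1 ∂(slab T) =
      -(c * ∫ p, q p.1 p.2 * dx (φ p.1) p.2 ∂(slab T))
        - ∫ p, u p.1 p.2 * q p.1 p.2 * dx (φ p.1) p.2 ∂(slab T)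

/-- `(f, g)` is a weak solution on `[0,T)` of
`∂ₜf = ∂ₓ((f + ⟨f₀⟩)(b_ρ ∂ₓf + b ∂ₓg))`, `∂ₜg = ∂ₓ((g + ⟨g₀⟩)(b_μ ∂ₓf + b_μ ∂ₓg))`
with the initial values `f₀ - ⟨f₀⟩` and `g₀ - ⟨g₀⟩`: a pair of zero mean functions in
`L^1(0,T;W^{1,1})` that satisfies the equations in weak form. -/
def IsWeakSolution (P : Fluids) (f₀ g₀ : Torus → ℝ) (T : ℝ) (f g : ℝ → Torus → ℝ) : Prop :=
  MemBochner 1 T (sobolevNorm 1 1) f ∧ MemBochner 1 T (sobolevNorm 1 1) g ∧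
  (∀ᵐ t ∂(volume.restrict (Ioo 0 T)), ∫ x, f t x = 0) ∧
  (∀ᵐ t ∂(volume.restrict (Ioo 0 T)), ∫ x, g t x = 0) ∧
  ∃ fx gx : ℝ → Torus → ℝ, IsSpaceDeriv T f fx ∧ IsSpaceDeriv T g gx ∧
    WeakEq T (mean f₀) (fluct f₀) f (fun t x => P.bρ * fx t x + P.b * gx t x) ∧
    WeakEq T (mean g₀) (fluct g₀) g (fun t x => P.bμ * fx t x + P.bμ * gx t x)

/-- `L^∞([0,T] × 𝕋)`. -/
def IsBounded (T : ℝ) (u : ℝ → Torus → ℝ) : Prop :=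
  MemLp (fun p : ℝ × Torus => u p.1 p.2) ∞ (slab T)

/-- `L^∞([0,T]×𝕋) ∩ L^2(0,T;W^{1,∞}) ∩ L^1(0,T;C^{1+α}) ∩ 𝓜(0,T;W^{2,∞}) ∩ L^2(0,T;Ḣ^1)` for all
`α ∈ [0,1/2)`. -/
def IsRegular (T : ℝ) (u : ℝ → Torus → ℝ) : Prop :=
  IsBounded T u ∧
  MemBochner 2 T (sobolevNorm 1 ∞) u ∧
  (∀ α : ℝ≥0, α < 1 / 2 → MemBochner 1 T (c1HolderNorm α) u) ∧
  MemRadon T (sobolevNorm 2 ∞) u ∧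
  MemBochner 2 T (hDotNorm 1) u

/-- The size `𝓔₀(f₀ - ⟨f₀⟩, g₀ - ⟨g₀⟩)` of the initial datum. -/
def initialSize (f₀ g₀ : Torus → ℝ) : ℝ :=
  (wienerNorm 0 (fluct f₀)).toReal + (wienerNorm 0 (fluct g₀)).toReal

/-- `σ_{1,b}`. -/
def σ₁ (P : Fluids) (f₀ g₀ : Torus → ℝ) : ℝ :=
  mean f₀ * P.bρ - mean g₀ * P.bμ - initialSize f₀ g₀ * (2 * P.bρ + 2 * P.b + 4 * P.bμ)

/-- `σ_{2,b}`. -/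
def σ₂ (P : Fluids) (f₀ g₀ : Torus → ℝ) : ℝ :=
  mean g₀ * P.bμ - mean f₀ * P.b - initialSize f₀ g₀ * (2 * P.bρ + 2 * P.b + 4 * P.bμ)

/-- The decay rate `δ_b = min {σ_{1,b}, σ_{2,b}}`. -/
def decayRate (P : Fluids) (f₀ g₀ : Torus → ℝ) : ℝ := min (σ₁ P f₀ g₀) (σ₂ P f₀ g₀)

end ThinFilm

end

/-!
The system is `∂ₜuᵢ = ∂ₓ((uᵢ + mᵢ) ∑ⱼ Bᵢⱼ ∂ₓuⱼ)` for two zero mean components; whatever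
does not depend on the particular coefficients is done for any finite number of components.

**Existence.** In Fourier coefficients the `k`-th mode of `uᵢ` is damped at the rate `mᵢ Bᵢᵢ k²` and
driven by the cross diffusion and by the quadratic term. Replacing every coefficient, on both sides
of the Duhamel formula, by its absolute value gives a majorant system with values in `[0, ∞]`, whose
Picard iterates `maj` increase. Each mode satisfies an exact energy identity (`duhamelMaj_energy`,
`duhamelMaj_weighted_energy`). Summed over all modes, and with the bilinear estimate
`two_mul_tsum_convolution_le`, these identities bound the Wiener norm of an iterate plus the time
integral of `∑ k² |û(k)|` by the Wiener norm `e₀` of the data, since the diagonal diffusion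
dominates with a margin `δ` (`StableData`); weighting with `e^{δt}` gives the decay of the Wiener
norm (`StableData.iterate_bound`). The increments of the Picard iterates `pic` of the system itself
are dominated by the increments of the majorants (`StableData.pic_increment`), so that these
iterates converge mode by mode under an integrable majorant, with no contraction argument. The limit
`modes` solves the system on the Fourier side (`StableData.modeSolution`). Its Fourier series
`synth` has all the regularity asserted, because every norm in question is at most a multiple of
`∑ k² |û(k)|`, or of `∑ |k| |û(k)|`, which is square integrable in time by interpolation
(`WienerPath.isRegular`); integrating by parts in `t` and in `x` shows that it is a weak solution
(`ModeSolution.weakEq`).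

**Uniqueness.** Any bounded weak solution is compared with the solution constructed above, whose sup
norm never exceeds `e₀`. At such states the diffusion matrix `(uᵢ + mᵢ) Bᵢⱼ` defines a nonnegative
quadratic form (`isParabolic`). Testing the weak formulation with `χ(t) Re(z e^{ikx})` shows that
the Fourier coefficients of a weak solution solve the system mode by mode
(`WeakEq.ae_fourierHat_eq`, `IsWeakSolution.exists_boundedSolution`). For the difference `w` of the
two solutions this gives the `L²` energy identity (`BoundedSolution.energy_identity`): the fluxes
are square integrable because `‖∂ₓu‖²` in `L²` is at most `‖u‖_∞ ∑ k² |û(k)|`. Apart from the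
quadratic form, which has a sign, its right-hand side is `-2 ∑ᵢ ∫ wᵢ ∂ₓwᵢ qᵢ` with
`qᵢ = ∑ⱼ Bᵢⱼ ∂ₓuⱼ` taken from the other solution, and an integration by parts bounds it by
`‖∂ₓq‖_∞ ‖w‖²`, with a factor integrable in time (`energy_inequality`). Gronwall's inequality gives
`w = 0` (`BoundedSolution.ae_eq`).
-/

noncomputable section

set_option linter.unusedSectionVars false

namespace ThinFilm

/-! ### The scalar Duhamel formula for nonnegative functions -/

/-- The solution `e^{-ct} y₀ + ∫₀ᵗ e^{-c(t-s)} r(s) ds` of `y' = -c y + r`, `y(0) = y₀`, for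
nonnegative data, with values in `[0, ∞]`. -/
def duhamelMaj (c : ℝ) (y₀ : ℝ≥0∞) (r : ℝ → ℝ≥0∞) (t : ℝ) : ℝ≥0∞ :=
  ENNReal.ofReal (Real.exp (-(c * t))) * y₀ +
    ∫⁻ s in Ioc 0 t, ENNReal.ofReal (Real.exp (-(c * (t - s)))) * r s

theorem measurable_setLIntegral_Ioc {k : ℝ × ℝ → ℝ≥0∞} (hk : Measurable k) :
    Measurable fun t : ℝ => ∫⁻ s in Ioc 0 t, k (t, s) := by
  have h : MeasurableSet {p : ℝ × ℝ | p.2 ∈ Ioc 0 p.1} :=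
    (measurableSet_lt measurable_const measurable_snd).inter
      (measurableSet_le measurable_snd measurable_fst)
  have h2 : (fun t : ℝ => ∫⁻ s in Ioc 0 t, k (t, s)) =
      fun t => ∫⁻ s, {p : ℝ × ℝ | p.2 ∈ Ioc 0 p.1}.indicator k (t, s) := by
    funext t
    rw [← lintegral_indicator measurableSet_Ioc]
    rfl
  rw [h2]
  exact (hk.indicator h).lintegral_prod_right'

theorem measurable_duhamelMaj (c : ℝ) (y₀ : ℝ≥0∞) {r : ℝ → ℝ≥0∞} (hr : Measurable r) :
    Measurable (duhamelMaj c y₀ r) := by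
  unfold duhamelMaj
  refine Measurable.add (by fun_prop) ?_
  exact measurable_setLIntegral_Ioc
    (k := fun p => ENNReal.ofReal (Real.exp (-(c * (p.1 - p.2)))) * r p.2) (by fun_prop)

/-- Tonelli's theorem on the triangle `0 < s ≤ t ≤ T`. -/
theorem lintegral_triangle_swap {k : ℝ × ℝ → ℝ≥0∞} (hk : Measurable k) (T : ℝ) :
    ∫⁻ t in Ioc 0 T, ∫⁻ s in Ioc 0 t, k (t, s) = ∫⁻ s in Ioc 0 T, ∫⁻ t in Ioc s T, k (t, s) := by
  have h : MeasurableSet {p : ℝ × ℝ | 0 < p.2 ∧ p.2 ≤ p.1 ∧ p.1 ≤ T} :=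
    (measurableSet_lt measurable_const measurable_snd).inter
      ((measurableSet_le measurable_snd measurable_fst).inter
        (measurableSet_le measurable_fst measurable_const))
  set S := {p : ℝ × ℝ | 0 < p.2 ∧ p.2 ≤ p.1 ∧ p.1 ≤ T} with hS
  have h1 : ∫⁻ t in Ioc 0 T, ∫⁻ s in Ioc 0 t, k (t, s) = ∫⁻ t, ∫⁻ s, S.indicator k (t, s) := by
    rw [← lintegral_indicator measurableSet_Ioc]
    congr 1; funext t
    by_cases ht : t ∈ Ioc 0 T
    · rw [indicator_of_mem ht, ← lintegral_indicator measurableSet_Ioc]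
      congr 1; funext s
      by_cases hs : s ∈ Ioc 0 t
      · rw [indicator_of_mem hs, indicator_of_mem]; exact ⟨hs.1, hs.2, ht.2⟩
      · rw [indicator_of_notMem hs, indicator_of_notMem]; exact fun h => hs ⟨h.1, h.2.1⟩
    · rw [indicator_of_notMem ht]
      have : ∀ s, S.indicator k (t, s) = 0 := fun s =>
        indicator_of_notMem (fun h => ht ⟨h.1.trans_le h.2.1, h.2.2⟩) _
      simp [this]
  have h2 : ∫⁻ s in Ioc 0 T, ∫⁻ t in Ioc s T, k (t, s) = ∫⁻ s, ∫⁻ t, S.indicator k (t, s) := by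
    rw [← lintegral_indicator measurableSet_Ioc]
    congr 1; funext s
    by_cases hs : s ∈ Ioc 0 T
    · rw [indicator_of_mem hs, setLIntegral_congr (Ioc_ae_eq_Icc (μ := volume)),
        ← lintegral_indicator measurableSet_Icc]
      congr 1; funext t
      by_cases ht : t ∈ Icc s T
      · rw [indicator_of_mem ht, indicator_of_mem]; exact ⟨hs.1, ht.1, ht.2⟩
      · rw [indicator_of_notMem ht, indicator_of_notMem]; exact fun h => ht ⟨h.2.1, h.2.2⟩
    · rw [indicator_of_notMem hs]
      have : ∀ t, S.indicator k (t, s) = 0 := fun t =>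
        indicator_of_notMem (fun h => hs ⟨h.1, h.2.1.trans h.2.2⟩) _
      simp [this]
  rw [h1, h2]
  exact lintegral_lintegral_swap (f := fun t s => S.indicator k (t, s))
    ((hk.indicator h).aemeasurable)

/-- Of a unit mass at time `s` that decays at the rate `c`, the part left at time `T` and the part
lost during `(s, T)` add up to one. -/
theorem exp_add_setLIntegral_exp {c : ℝ} (hc : 0 ≤ c) {s T : ℝ} (h : s ≤ T) :
    ENNReal.ofReal (Real.exp (-(c * (T - s)))) +
      ∫⁻ t in Ioc s T, ENNReal.ofReal (c * Real.exp (-(c * (t - s)))) = 1 := by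
  have hd : ∀ t ∈ uIcc s T, HasDerivAt (fun t => -Real.exp (-(c * (t - s))))
      (c * Real.exp (-(c * (t - s)))) t := by
    intro t _
    have := ((((hasDerivAt_id t).sub_const s).const_mul c).neg).exp.neg
    exact this.congr_deriv (by simp only [id, Pi.neg_apply]; ring)
  have hi := intervalIntegral.integral_eq_sub_of_hasDerivAt hd
    (Continuous.intervalIntegrable (by fun_prop) _ _)
  rw [intervalIntegral.integral_of_le h] at hi
  rw [← ofReal_integral_eq_lintegral_ofReal
    ((Continuous.integrableOn_Icc (by fun_prop)).mono_set Ioc_subset_Icc_self)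
    (ae_of_all _ fun t => by positivity), hi, ← ENNReal.ofReal_add (by positivity)]
  · simp
  · have : Real.exp (-(c * (T - s))) ≤ 1 :=
      Real.exp_le_one_iff.2 (by nlinarith [mul_nonneg hc (sub_nonneg.2 h)])
    simpa using this

/-- Integrating `y' + c y = r` over `(0, T)`. -/
theorem duhamelMaj_energy {c : ℝ} (hc : 0 ≤ c) (y₀ : ℝ≥0∞) {r : ℝ → ℝ≥0∞} (hr : Measurable r)
    {T : ℝ} (hT : 0 ≤ T) :
    duhamelMaj c y₀ r T + ENNReal.ofReal c * ∫⁻ t in Ioc 0 T, duhamelMaj c y₀ r t =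
      y₀ + ∫⁻ s in Ioc 0 T, r s := by
  have hm : Measurable fun p : ℝ × ℝ => ENNReal.ofReal (Real.exp (-(c * (p.1 - p.2)))) * r p.2 := by
    fun_prop
  unfold duhamelMaj
  rw [lintegral_add_left (by fun_prop), lintegral_mul_const _ (by fun_prop),
    lintegral_triangle_swap hm, mul_add, ← mul_assoc, ← lintegral_const_mul _ (by fun_prop),
    ← lintegral_const_mul' _ _ ENNReal.ofReal_ne_top, add_add_add_comm, ← add_mul]
  congr 1
  · have := exp_add_setLIntegral_exp hc hT
    simp only [sub_zero, ENNReal.ofReal_mul hc] at this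
    rw [this, one_mul]
  · rw [← lintegral_add_left (by fun_prop)]
    refine setLIntegral_congr_fun measurableSet_Ioc fun s hs => ?_
    have := exp_add_setLIntegral_exp hc hs.2
    simp only [ENNReal.ofReal_mul hc] at this
    rw [lintegral_const_mul _ (by fun_prop)] at this
    simp only
    rw [lintegral_mul_const _ (by fun_prop), ← mul_assoc, ← add_mul, this, one_mul]

/-- Multiplying the solution of `y' = -c y + r` by `e^{γt}` lowers the damping rate to `c - γ`. -/
theorem exp_mul_duhamelMaj (c γ : ℝ) (y₀ : ℝ≥0∞) (r : ℝ → ℝ≥0∞) (t : ℝ) :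
    ENNReal.ofReal (Real.exp (γ * t)) * duhamelMaj c y₀ r t =
      duhamelMaj (c - γ) y₀ (fun s => ENNReal.ofReal (Real.exp (γ * s)) * r s) t := by
  unfold duhamelMaj
  rw [mul_add, ← mul_assoc, ← ENNReal.ofReal_mul (by positivity), ← Real.exp_add,
    ← lintegral_const_mul' _ _ ENNReal.ofReal_ne_top]
  congr 1
  · congr 3; ring
  · congr 1; funext s
    rw [← mul_assoc, ← mul_assoc, ← ENNReal.ofReal_mul (by positivity),
      ← ENNReal.ofReal_mul (by positivity), ← Real.exp_add, ← Real.exp_add]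
    congr 3; ring

/-- Integrating `(e^{γt} y)' + c e^{γt} y = e^{γt} r + γ e^{γt} y` over `(0, T)`. The last term
stays on the right because there is no subtraction in `[0, ∞]`. -/
theorem duhamelMaj_weighted_energy {c γ : ℝ} (hγ : 0 ≤ γ) (hc : γ ≤ c) (y₀ : ℝ≥0∞)
    {r : ℝ → ℝ≥0∞} (hr : Measurable r) {T : ℝ} (hT : 0 ≤ T) :
    ENNReal.ofReal (Real.exp (γ * T)) * duhamelMaj c y₀ r T +
        ENNReal.ofReal c *
          ∫⁻ t in Ioc 0 T, ENNReal.ofReal (Real.exp (γ * t)) * duhamelMaj c y₀ r t =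
      y₀ + (∫⁻ s in Ioc 0 T, ENNReal.ofReal (Real.exp (γ * s)) * r s) +
        ENNReal.ofReal γ *
          ∫⁻ t in Ioc 0 T, ENNReal.ofReal (Real.exp (γ * t)) * duhamelMaj c y₀ r t := by
  simp only [exp_mul_duhamelMaj]
  rw [← duhamelMaj_energy (sub_nonneg.2 hc) y₀ (by fun_prop) hT, add_assoc, ← add_mul,
    ← ENNReal.ofReal_add (sub_nonneg.2 hc) hγ, sub_add_cancel]

theorem duhamelMaj_mono (c : ℝ) (y₀ : ℝ≥0∞) {r r' : ℝ → ℝ≥0∞} (h : ∀ s, r s ≤ r' s) (t : ℝ) :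
    duhamelMaj c y₀ r t ≤ duhamelMaj c y₀ r' t := by
  unfold duhamelMaj
  gcongr
  exact h _

/-! ### The bilinear estimate -/

/-- `|k| |l| ≤ (|k-l|² + 3|l|²)/2`, summed against a convolution. -/
theorem two_mul_tsum_convolution_le (a b : ℤ → ℝ≥0∞) :
    2 * ∑' k : ℤ, (k.natAbs : ℝ≥0∞) * ∑' l : ℤ, a (k - l) * (l.natAbs * b l) ≤
      3 * (∑' k, a k) * (∑' k : ℤ, (k.natAbs : ℝ≥0∞) ^ 2 * b k) +
        (∑' k : ℤ, (k.natAbs : ℝ≥0∞) ^ 2 * a k) * ∑' k, b k := by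
  have key : ∀ k l : ℤ, 2 * ((k.natAbs : ℝ≥0∞) * (a (k - l) * (l.natAbs * b l))) ≤
      3 * a (k - l) * ((l.natAbs : ℝ≥0∞) ^ 2 * b l) +
        (((k - l).natAbs : ℝ≥0∞) ^ 2 * a (k - l)) * b l := by
    intro k l
    have h1 : 2 * k.natAbs * l.natAbs ≤ 3 * l.natAbs ^ 2 + (k - l).natAbs ^ 2 := by
      have h : k.natAbs ≤ (k - l).natAbs + l.natAbs := by omega
      nlinarith [sq_nonneg ((l.natAbs : ℤ) - (k - l).natAbs), Nat.mul_le_mul_right l.natAbs h,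
        Nat.zero_le l.natAbs, two_mul_le_add_sq (l.natAbs) ((k-l).natAbs)]
    have h2 : (2 * k.natAbs * l.natAbs : ℝ≥0∞) ≤ 3 * l.natAbs ^ 2 + (k - l).natAbs ^ 2 := by
      exact_mod_cast h1
    calc 2 * ((k.natAbs : ℝ≥0∞) * (a (k - l) * (l.natAbs * b l)))
        = (2 * k.natAbs * l.natAbs : ℝ≥0∞) * (a (k - l) * b l) := by ring
      _ ≤ (3 * l.natAbs ^ 2 + (k - l).natAbs ^ 2) * (a (k - l) * b l) := by gcongr
      _ = _ := by ring
  have conv : ∀ p q : ℤ → ℝ≥0∞, ∑' k : ℤ, ∑' l : ℤ, p (k - l) * q l = (∑' k, p k) * ∑' l, q l := by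
    intro p q
    rw [ENNReal.tsum_comm, ← ENNReal.tsum_mul_left]
    congr 1; funext l
    rw [ENNReal.tsum_mul_right]
    exact congrArg (· * q l) ((Equiv.subRight l).tsum_eq p)
  calc 2 * ∑' k : ℤ, (k.natAbs : ℝ≥0∞) * ∑' l : ℤ, a (k - l) * (l.natAbs * b l)
      = ∑' k : ℤ, ∑' l : ℤ, 2 * ((k.natAbs : ℝ≥0∞) * (a (k - l) * (l.natAbs * b l))) := by
        simp only [ENNReal.tsum_mul_left]
    _ ≤ ∑' k : ℤ, ∑' l : ℤ, (3 * a (k - l) * ((l.natAbs : ℝ≥0∞) ^ 2 * b l) +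
        (((k - l).natAbs : ℝ≥0∞) ^ 2 * a (k - l)) * b l) := by
        gcongr with k l; exact key k l
    _ = _ := by
        simp only [ENNReal.tsum_add]
        rw [conv (fun k => 3 * a k) (fun l => (l.natAbs : ℝ≥0∞) ^ 2 * b l),
          conv (fun k => (k.natAbs : ℝ≥0∞) ^ 2 * a k) b, ENNReal.tsum_mul_left]

/-! ### The majorant system -/

section Majorant

variable {ι : Type*} [Fintype ι]

/-- The Wiener norm `∑ᵢ ∑ₖ a_{i,k}` of a nonnegative family of Fourier coefficients. -/
def mass (a : ι → ℤ → ℝ≥0∞) : ℝ≥0∞ := ∑ i, ∑' k, a i k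

/-- The norm `∑ₖ |k|² a_k` of a nonnegative sequence of Fourier coefficients. -/
def dissip (a : ℤ → ℝ≥0∞) : ℝ≥0∞ := ∑' k : ℤ, (k.natAbs : ℝ≥0∞) ^ 2 * a k

/-- The `k`-th coefficient of `uᵢ ∑ⱼ Bᵢⱼ ∂ₓuⱼ` with all phases removed. -/
def majFlux (B : ι → ι → ℝ≥0) (a : ι → ℤ → ℝ≥0∞) (i : ι) (k : ℤ) : ℝ≥0∞ :=
  ∑ j, (B i j : ℝ≥0∞) * ∑' l : ℤ, a i (k - l) * (l.natAbs * a j l)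

theorem tsum_le_dissip {a : ℤ → ℝ≥0∞} (h : a 0 = 0) : ∑' k, a k ≤ dissip a := by
  refine ENNReal.tsum_le_tsum fun k => ?_
  rcases eq_or_ne k 0 with rfl | hk
  · simp [h]
  · have : (1 : ℝ≥0∞) ≤ (k.natAbs : ℝ≥0∞) ^ 2 :=
      one_le_pow₀ (by exact_mod_cast Int.natAbs_pos.2 hk)
    calc a k = 1 * a k := (one_mul _).symm
      _ ≤ _ := by gcongr

/-- The two parts `3 ‖uᵢ‖ ‖uⱼ‖₂` and `‖uᵢ‖₂ ‖uⱼ‖` of the bilinear estimate, with `‖·‖₂` the norm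
`dissip`, add up to `4 ‖u‖ ‖u‖₂` after summation over `i` and `j`. -/
theorem tsum_majFlux_le {β : ℝ≥0} (hB : ∀ i j, B i j ≤ β) (a : ι → ℤ → ℝ≥0∞) :
    ∑ i, ∑' k : ℤ, (k.natAbs : ℝ≥0∞) * majFlux B a i k ≤
      2 * β * mass a * ∑ j, dissip (a j) := by
  have h1 : 2 * ∑ i, ∑' k : ℤ, (k.natAbs : ℝ≥0∞) * majFlux B a i k ≤
      2 * (2 * β * mass a * ∑ j, dissip (a j)) := by
    calc 2 * ∑ i, ∑' k : ℤ, (k.natAbs : ℝ≥0∞) * majFlux B a i k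
        = ∑ i, ∑ j, (B i j : ℝ≥0∞) *
          (2 * ∑' k : ℤ, (k.natAbs : ℝ≥0∞) * ∑' l : ℤ, a i (k - l) * (l.natAbs * a j l)) := by
          rw [Finset.mul_sum]
          refine Finset.sum_congr rfl fun i _ => ?_
          simp only [majFlux, Finset.mul_sum]
          rw [Summable.tsum_finsetSum fun _ _ => ENNReal.summable, Finset.mul_sum]
          refine Finset.sum_congr rfl fun j _ => ?_
          rw [mul_left_comm, ← ENNReal.tsum_mul_left, ← ENNReal.tsum_mul_left]
          rw [← ENNReal.tsum_mul_left]
          congr 1; funext k; ring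
      _ ≤ ∑ i, ∑ j, (β : ℝ≥0∞) * (3 * (∑' k, a i k) * dissip (a j) +
            dissip (a i) * ∑' k, a j k) := by
          refine Finset.sum_le_sum fun i _ => Finset.sum_le_sum fun j _ => ?_
          exact mul_le_mul' (by exact_mod_cast hB i j) (two_mul_tsum_convolution_le (a i) (a j))
      _ = _ := by
          simp only [mul_add, Finset.sum_add_distrib, mass, Finset.sum_mul, Finset.mul_sum]
          rw [Finset.sum_comm (f := fun i j => (β : ℝ≥0∞) * (dissip (a i) * ∑' k, a j k)),
            ← Finset.sum_add_distrib]
          conv_rhs => rw [Finset.sum_comm]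
          refine Finset.sum_congr rfl fun i _ => ?_
          rw [← Finset.sum_add_distrib]
          refine Finset.sum_congr rfl fun j _ => ?_
          ring
  exact (ENNReal.mul_le_mul_iff_right (by norm_num) (by norm_num)).1 h1

variable [DecidableEq ι]

/-- A bound for the `k`-th coefficient of the right-hand side of the `i`-th equation without its
diagonal linear part `mᵢ Bᵢᵢ ∂ₓ²uᵢ`. -/
def majRhs (m : ι → ℝ≥0) (B : ι → ι → ℝ≥0) (a : ι → ℤ → ℝ≥0∞) (i : ι) (k : ℤ) : ℝ≥0∞ :=
  (∑ j ∈ Finset.univ.erase i, (m i : ℝ≥0∞) * B i j * ((k.natAbs : ℝ≥0∞) ^ 2 * a j k)) +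
    k.natAbs * majFlux B a i k

/-- The damping rate `mᵢ Bᵢᵢ k²` of the `k`-th mode in the `i`-th equation. -/
def damping (m : ι → ℝ≥0) (B : ι → ι → ℝ≥0) (i : ι) (k : ℤ) : ℝ := m i * B i i * (k : ℝ) ^ 2

/-- The Picard iterates of the majorant system. -/
def maj (m : ι → ℝ≥0) (B : ι → ι → ℝ≥0) (U₀ : ι → ℤ → ℝ≥0∞) : ℕ → ι → ℤ → ℝ → ℝ≥0∞
  | 0 => fun _ _ _ => 0
  | n + 1 => fun i k => duhamelMaj (damping m B i k) (U₀ i k)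
      (fun s => majRhs m B (fun j l => maj m B U₀ n j l s) i k)

variable {m : ι → ℝ≥0} {B : ι → ι → ℝ≥0} {U₀ : ι → ℤ → ℝ≥0∞}

theorem majRhs_mono {a a' : ι → ℤ → ℝ≥0∞} (h : ∀ i k, a i k ≤ a' i k) (i : ι) (k : ℤ) :
    majRhs m B a i k ≤ majRhs m B a' i k := by
  unfold majRhs majFlux
  gcongr <;> exact h _ _

theorem measurable_majRhs {a : ℝ → ι → ℤ → ℝ≥0∞} (h : ∀ i k, Measurable fun t => a t i k)
    (i : ι) (k : ℤ) : Measurable fun t => majRhs m B (a t) i k := by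
  unfold majRhs majFlux
  refine Measurable.add (Finset.measurable_fun_sum _ fun j _ => ((h j k).const_mul _).const_mul _)
    (Measurable.const_mul (Finset.measurable_fun_sum _ fun j _ => Measurable.const_mul ?_ _) _)
  exact Measurable.tsum fun l => (h i _).mul ((h j l).const_mul _)

theorem measurable_maj (n : ℕ) (i : ι) (k : ℤ) : Measurable (maj m B U₀ n i k) := by
  induction n generalizing i k with
  | zero => exact measurable_const
  | succ n ih =>
    exact measurable_duhamelMaj _ _
      (measurable_majRhs (a := fun t j l => maj m B U₀ n j l t) ih i k)

theorem maj_le_succ (n : ℕ) (i : ι) (k : ℤ) (t : ℝ) :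
    maj m B U₀ n i k t ≤ maj m B U₀ (n + 1) i k t := by
  induction n generalizing i k t with
  | zero => exact zero_le
  | succ n ih => exact duhamelMaj_mono _ _ (fun s => majRhs_mono (fun j l => ih j l s) i k) t

theorem maj_monotone (i : ι) (k : ℤ) (t : ℝ) : Monotone fun n => maj m B U₀ n i k t :=
  monotone_nat_of_le_succ fun n => maj_le_succ n i k t

theorem majRhs_zero_mode (a : ι → ℤ → ℝ≥0∞) (i : ι) : majRhs m B a i 0 = 0 := by
  simp [majRhs]

theorem maj_zero_mode (hU : ∀ i, U₀ i 0 = 0) (n : ℕ) (i : ι) (t : ℝ) : maj m B U₀ n i 0 t = 0 := by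
  cases n with
  | zero => rfl
  | succ n => simp [maj, duhamelMaj, majRhs_zero_mode, hU]

/-- The coefficient of `∑ₖ k² |û_j(k)|` in the bound for the right-hand side. -/
def offDiag (m : ι → ℝ≥0) (B : ι → ι → ℝ≥0) (j : ι) : ℝ≥0 := ∑ i ∈ Finset.univ.erase j, m i * B i j

/-- Summed over all modes, the cross diffusion and the nonlinear terms are controlled by `dissip`
with exactly the coefficients that the margin in `StableData` leaves room for. -/
theorem tsum_majRhs_le {β e₀ : ℝ≥0} (hB : ∀ i j, B i j ≤ β) {a : ι → ℤ → ℝ≥0∞}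
    (h : mass a ≤ e₀) :
    ∑ i, ∑' k : ℤ, majRhs m B a i k ≤
      ∑ j, ((2 * β * e₀ + offDiag m B j : ℝ≥0) : ℝ≥0∞) * dissip (a j) := by
  simp only [majRhs, ENNReal.tsum_add, Finset.sum_add_distrib]
  have h1 : ∑ i, ∑' k : ℤ, ∑ j ∈ Finset.univ.erase i,
      (m i : ℝ≥0∞) * B i j * ((k.natAbs : ℝ≥0∞) ^ 2 * a j k) =
      ∑ j, (offDiag m B j : ℝ≥0∞) * dissip (a j) := by
    have : ∀ i, ∑' k : ℤ, ∑ j ∈ Finset.univ.erase i,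
        (m i : ℝ≥0∞) * B i j * ((k.natAbs : ℝ≥0∞) ^ 2 * a j k) =
        ∑ j, if j = i then 0 else (m i : ℝ≥0∞) * B i j * dissip (a j) := by
      intro i
      rw [Summable.tsum_finsetSum fun _ _ => ENNReal.summable, Finset.sum_ite,
        Finset.sum_const_zero, zero_add, Finset.filter_not, Finset.filter_eq']
      simp [ENNReal.tsum_mul_left, dissip, Finset.sdiff_singleton_eq_erase]
    simp only [this]
    rw [Finset.sum_comm]
    refine Finset.sum_congr rfl fun j _ => ?_
    rw [Finset.sum_ite, Finset.sum_const_zero, zero_add, Finset.filter_not, Finset.filter_eq]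
    simp [offDiag, Finset.sum_mul, Finset.sdiff_singleton_eq_erase]
  rw [h1]
  calc _ ≤ ∑ j, (offDiag m B j : ℝ≥0∞) * dissip (a j) + 2 * β * e₀ * ∑ j, dissip (a j) := by
        gcongr
        exact (tsum_majFlux_le hB a).trans (by gcongr)
    _ = _ := by
        rw [Finset.mul_sum, ← Finset.sum_add_distrib]
        refine Finset.sum_congr rfl fun j _ => ?_
        push_cast; ring

end Majorant

section Majorant

variable {ι : Type*} [Fintype ι] [DecidableEq ι]

/-- Smallness of the data relative to the parabolic part: the diagonal diffusion in the `j`-th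
component dominates, with margin `δ`, the cross diffusion that feeds on it and the nonlinear terms,
for data of Wiener norm at most `e₀`. -/
structure StableData (m : ι → ℝ≥0) (B : ι → ι → ℝ≥0) (U₀ : ι → ℤ → ℝ≥0∞) (β e₀ δ : ℝ≥0) :
    Prop where
  coeff_le : ∀ i j, B i j ≤ β
  margin_pos : 0 < δ
  margin : ∀ j, δ + (2 * β * e₀ + offDiag m B j) ≤ m j * B j j
  zero_mode : ∀ i, U₀ i 0 = 0
  mass_le : mass U₀ ≤ e₀

variable {m : ι → ℝ≥0} {B : ι → ι → ℝ≥0} {U₀ : ι → ℤ → ℝ≥0∞} {β e₀ δ : ℝ≥0}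

theorem ofReal_damping (i : ι) (k : ℤ) :
    ENNReal.ofReal (damping m B i k) = ((m i * B i i : ℝ≥0) : ℝ≥0∞) * (k.natAbs : ℝ≥0∞) ^ 2 := by
  have : damping m B i k = ((m i * B i i * (k.natAbs : ℝ≥0) ^ 2 : ℝ≥0) : ℝ) := by
    push_cast
    rw [damping, Nat.cast_natAbs, Int.cast_abs, sq_abs]
  rw [this, ENNReal.ofReal_coe_nnreal]
  push_cast; rfl

theorem damping_nonneg (i : ι) (k : ℤ) : 0 ≤ damping m B i k := by
  unfold damping; positivity

theorem StableData.margin_le_diag (h : StableData m B U₀ β e₀ δ) (j : ι) : δ ≤ m j * B j j :=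
  le_self_add.trans (h.margin j)

/-- The nonzero modes are all damped at least at the rate of the margin, as `k² ≥ 1`. -/
theorem StableData.le_damping (h : StableData m B U₀ β e₀ δ) (i : ι) {k : ℤ} (hk : k ≠ 0) :
    (δ : ℝ) ≤ damping m B i k := by
  have h1 : (δ : ℝ) ≤ m i * B i i := by exact_mod_cast h.margin_le_diag i
  have h2 : (1 : ℝ) ≤ (k : ℝ) ^ 2 := by
    rw [one_le_sq_iff_one_le_abs]; exact_mod_cast Int.one_le_abs hk
  unfold damping
  nlinarith [mul_nonneg (m i).coe_nonneg (B i i).coe_nonneg]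

/-- The time integral of `e^{γt} ∑ₖ k² a_k(t)` for the `j`-th component of the `n`-th iterate. -/
def majDiss (m : ι → ℝ≥0) (B : ι → ι → ℝ≥0) (U₀ : ι → ℤ → ℝ≥0∞) (γ T : ℝ) (n : ℕ) (j : ι) : ℝ≥0∞ :=
  ∫⁻ t in Ioc 0 T, ENNReal.ofReal (Real.exp (γ * t)) * dissip (fun k => maj m B U₀ n j k t)

theorem measurable_dissip {a : ℝ → ℤ → ℝ≥0∞} (h : ∀ k, Measurable fun t => a t k) :
    Measurable fun t => dissip (a t) :=
  Measurable.tsum fun k => (h k).const_mul _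

/-- The weighted energy identity for one mode of an iterate. It is an inequality only because the
zero mode, which is not damped, has been included. -/
theorem StableData.mode_energy (h : StableData m B U₀ β e₀ δ) {γ : ℝ} (hγ : 0 ≤ γ) (hγδ : γ ≤ δ)
    (n : ℕ) {T : ℝ} (hT : 0 ≤ T) (i : ι) (k : ℤ) :
    ENNReal.ofReal (Real.exp (γ * T)) * maj m B U₀ (n + 1) i k T +
        ENNReal.ofReal (damping m B i k) *
          ∫⁻ t in Ioc 0 T, ENNReal.ofReal (Real.exp (γ * t)) * maj m B U₀ (n + 1) i k t ≤
      U₀ i k + (∫⁻ t in Ioc 0 T, ENNReal.ofReal (Real.exp (γ * t)) *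
          majRhs m B (fun j l => maj m B U₀ n j l t) i k) +
        ENNReal.ofReal γ *
          ∫⁻ t in Ioc 0 T, ENNReal.ofReal (Real.exp (γ * t)) * maj m B U₀ (n + 1) i k t := by
  rcases eq_or_ne k 0 with rfl | hk
  · simp [maj_zero_mode h.zero_mode]
  · exact (duhamelMaj_weighted_energy hγ (hγδ.trans (h.le_damping i hk)) _
      (measurable_majRhs (a := fun t j l => maj m B U₀ n j l t)
        (fun j l => measurable_maj n j l) i k) hT).le

theorem sum_tsum_lintegral {f : ι → ℤ → ℝ → ℝ≥0∞} (hf : ∀ i k, Measurable (f i k)) (T : ℝ) :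
    ∑ i, ∑' k, ∫⁻ t in Ioc 0 T, f i k t = ∫⁻ t in Ioc 0 T, ∑ i, ∑' k, f i k t := by
  rw [lintegral_finsetSum _ fun i _ => Measurable.tsum (hf i)]
  refine Finset.sum_congr rfl fun i _ => ?_
  rw [lintegral_tsum fun k => (hf i k).aemeasurable]

theorem majDiss_eq_tsum (γ T : ℝ) (n : ℕ) (j : ι) :
    majDiss m B U₀ γ T n j = ∑' k : ℤ, (k.natAbs : ℝ≥0∞) ^ 2 *
      ∫⁻ t in Ioc 0 T, ENNReal.ofReal (Real.exp (γ * t)) * maj m B U₀ n j k t := by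
  have hm : ∀ k : ℤ, Measurable fun t => ENNReal.ofReal (Real.exp (γ * t)) * maj m B U₀ n j k t :=
    fun k => Measurable.mul (by fun_prop) (measurable_maj n j k)
  simp only [← lintegral_const_mul _ (hm _)]
  rw [← lintegral_tsum fun k => ((hm k).const_mul _).aemeasurable]
  unfold majDiss dissip
  congr 1; funext t
  rw [← ENNReal.tsum_mul_left]
  congr 1; funext k; ring

/-- The energy inequality relating two consecutive iterates. -/
theorem StableData.iterate_energy (h : StableData m B U₀ β e₀ δ) {γ : ℝ} (hγ : 0 ≤ γ)
    (hγδ : γ ≤ δ) (n : ℕ) (hn : ∀ t, 0 ≤ t → mass (fun i k => maj m B U₀ n i k t) ≤ e₀)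
    {T : ℝ} (hT : 0 ≤ T) :
    ENNReal.ofReal (Real.exp (γ * T)) * mass (fun i k => maj m B U₀ (n + 1) i k T) +
        ∑ j, ((m j * B j j : ℝ≥0) : ℝ≥0∞) * majDiss m B U₀ γ T (n + 1) j ≤
      e₀ + ∑ j, ((2 * β * e₀ + offDiag m B j : ℝ≥0) : ℝ≥0∞) * majDiss m B U₀ γ T n j +
        ENNReal.ofReal γ * ∑ j, majDiss m B U₀ γ T (n + 1) j := by
  have hsum := Finset.sum_le_sum fun i (_ : i ∈ Finset.univ) =>
    ENNReal.tsum_le_tsum fun k => h.mode_energy hγ hγδ n hT i k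
  simp only [ENNReal.tsum_add, Finset.sum_add_distrib, ENNReal.tsum_mul_left,
    ofReal_damping, mul_assoc, ← majDiss_eq_tsum] at hsum
  simp only [ENNReal.coe_mul (m _), mul_assoc (m _ : ℝ≥0∞)] at hsum ⊢
  simp only [← Finset.mul_sum] at hsum
  refine hsum.trans (add_le_add (add_le_add h.mass_le ?_)
    (mul_le_mul_right (Finset.sum_le_sum fun i _ => ?_) _))
  · rw [sum_tsum_lintegral (f := fun i k t => ENNReal.ofReal (Real.exp (γ * t)) *
        majRhs m B (fun j l => maj m B U₀ n j l t) i k) fun i k => Measurable.mul (by fun_prop)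
      (measurable_majRhs (a := fun t j l => maj m B U₀ n j l t)
        (fun j l => measurable_maj n j l) i k)]
    calc _ ≤ ∫⁻ t in Ioc 0 T, ∑ j, ((2 * β * e₀ + offDiag m B j : ℝ≥0) : ℝ≥0∞) *
          (ENNReal.ofReal (Real.exp (γ * t)) * dissip (fun k => maj m B U₀ n j k t)) := by
          refine setLIntegral_mono' measurableSet_Ioc fun t ht => ?_
          simp only [ENNReal.tsum_mul_left, ← Finset.mul_sum]
          refine (mul_le_mul_right (tsum_majRhs_le h.coeff_le (hn t ht.1.le)) _).trans ?_
          rw [Finset.mul_sum]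
          exact (Finset.sum_congr rfl fun j _ => by ring).le
      _ = _ := by
          rw [lintegral_finsetSum]
          · refine Finset.sum_congr rfl fun j _ => ?_
            rw [lintegral_const_mul, majDiss]
            exact Measurable.mul (by fun_prop) (measurable_dissip fun k => measurable_maj n j k)
          · exact fun j _ => (Measurable.mul (by fun_prop)
              (measurable_dissip fun k => measurable_maj n j k)).const_mul _
  · rw [majDiss_eq_tsum]
    refine tsum_le_dissip ?_
    simp [maj_zero_mode h.zero_mode]

theorem majDiss_le_succ (γ T : ℝ) (n : ℕ) (j : ι) :
    majDiss m B U₀ γ T n j ≤ majDiss m B U₀ γ T (n + 1) j := by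
  unfold majDiss dissip
  gcongr with t k
  exact maj_le_succ n j _ _

/-- By induction, the weighted Wiener norm and `δ` times the weighted dissipation of every iterate
are bounded by the data. The case `γ = 0` gives the bound by `e₀` needed for the next step and the
finiteness of the dissipation, which is what allows cancellation in `[0, ∞]`. -/
theorem StableData.iterate_bound (h : StableData m B U₀ β e₀ δ) (n : ℕ) :
    (∀ T, 0 ≤ T → ∀ j, majDiss m B U₀ 0 T n j ≠ ∞) ∧
    ∀ γ : ℝ, 0 ≤ γ → γ ≤ δ → ∀ T, 0 ≤ T →
      ENNReal.ofReal (Real.exp (γ * T)) * mass (fun i k => maj m B U₀ n i k T) +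
        δ * ∑ j, majDiss m B U₀ γ T n j ≤ e₀ + ENNReal.ofReal γ * ∑ j, majDiss m B U₀ γ T n j := by
  induction n with
  | zero => simp [majDiss, maj, mass, dissip]
  | succ n ih =>
    have hmass : ∀ t, 0 ≤ t → mass (fun i k => maj m B U₀ n i k t) ≤ e₀ := by
      intro t ht
      have := ih.2 0 le_rfl δ.coe_nonneg t ht
      simp only [zero_mul, Real.exp_zero, ENNReal.ofReal_one, one_mul, ENNReal.ofReal_zero,
        add_zero] at this
      exact le_self_add.trans this
    -- The dissipation of the new iterate is bounded by that of the old one, which is finite.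
    have hfin : ∀ T, 0 ≤ T → ∀ j, majDiss m B U₀ 0 T (n + 1) j ≠ ∞ := by
      intro T hT j hj
      have h1 := h.iterate_energy le_rfl δ.coe_nonneg n hmass hT
      have h2 : ∑ j, ((2 * β * e₀ + offDiag m B j : ℝ≥0) : ℝ≥0∞) * majDiss m B U₀ 0 T n j < ∞ :=
        ENNReal.sum_lt_top.2 fun j _ =>
          ENNReal.mul_lt_top ENNReal.coe_lt_top (ih.1 T hT j).lt_top
      simp only [ENNReal.ofReal_zero, zero_mul, add_zero] at h1
      have h3 := (le_add_self.trans h1).trans_lt (ENNReal.add_lt_top.2 ⟨ENNReal.coe_lt_top, h2⟩)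
      have h4 := ENNReal.sum_lt_top.1 h3 j (Finset.mem_univ j)
      rw [hj, ENNReal.mul_top] at h4
      · exact absurd h4 (lt_irrefl _)
      · exact_mod_cast (h.margin_pos.trans_le (h.margin_le_diag j)).ne'
    refine ⟨hfin, fun γ hγ hγδ T hT => ?_⟩
    -- On `(0, T)` the weight is at most `e^{γT}`.
    have hfin' : ∀ j, majDiss m B U₀ γ T (n + 1) j ≠ ∞ := by
      intro j
      refine ne_top_of_le_ne_top
        (ENNReal.mul_ne_top (ENNReal.ofReal_ne_top (r := Real.exp (γ * T))) (hfin T hT j)) ?_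
      unfold majDiss
      rw [← lintegral_const_mul' _ _ ENNReal.ofReal_ne_top]
      refine setLIntegral_mono' measurableSet_Ioc fun t ht => ?_
      simp only [zero_mul, Real.exp_zero, ENNReal.ofReal_one, one_mul]
      gcongr
      exact ht.2
    have h1 := h.iterate_energy hγ hγδ n hmass hT
    have hc : ∑ j, ((2 * β * e₀ + offDiag m B j : ℝ≥0) : ℝ≥0∞) * majDiss m B U₀ γ T (n + 1) j ≠ ∞ :=
      (ENNReal.sum_lt_top.2 fun j _ =>
          ENNReal.mul_lt_top ENNReal.coe_lt_top (hfin' j).lt_top).ne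
    -- The dissipation of the old iterate is at most that of the new one, so that `m_j B_jj` may be
    -- compared with the coefficients of `tsum_majRhs_le` at the same iterate.
    refine (ENNReal.add_le_add_iff_right hc).1 ?_
    calc _ = ENNReal.ofReal (Real.exp (γ * T)) * mass (fun i k => maj m B U₀ (n + 1) i k T) +
          ∑ j, ((δ + (2 * β * e₀ + offDiag m B j) : ℝ≥0) : ℝ≥0∞) *
            majDiss m B U₀ γ T (n + 1) j := by
          rw [add_assoc, Finset.mul_sum, ← Finset.sum_add_distrib]
          congr 1
          refine Finset.sum_congr rfl fun j _ => ?_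
          rw [ENNReal.coe_add δ, add_mul]
      _ ≤ ENNReal.ofReal (Real.exp (γ * T)) * mass (fun i k => maj m B U₀ (n + 1) i k T) +
          ∑ j, ((m j * B j j : ℝ≥0) : ℝ≥0∞) * majDiss m B U₀ γ T (n + 1) j := by
          gcongr with j _
          exact h.margin j
      _ ≤ _ := h1
      _ ≤ e₀ + ∑ j, ((2 * β * e₀ + offDiag m B j : ℝ≥0) : ℝ≥0∞) * majDiss m B U₀ γ T (n + 1) j +
        ENNReal.ofReal γ * ∑ j, majDiss m B U₀ γ T (n + 1) j := by
          gcongr with j _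
          exact majDiss_le_succ _ _ _ _
      _ = _ := by ring

/-! ### The limit of the majorants -/

/-- The minimal solution of the majorant system, the increasing limit of its Picard iterates. -/
def majLim (m : ι → ℝ≥0) (B : ι → ι → ℝ≥0) (U₀ : ι → ℤ → ℝ≥0∞) (i : ι) (k : ℤ) (t : ℝ) : ℝ≥0∞ :=
  ⨆ n, maj m B U₀ n i k t

theorem measurable_majLim (i : ι) (k : ℤ) : Measurable (majLim m B U₀ i k) :=
  Measurable.iSup fun n => measurable_maj n i k

theorem maj_le_majLim (n : ℕ) (i : ι) (k : ℤ) (t : ℝ) :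
    maj m B U₀ n i k t ≤ majLim m B U₀ i k t := le_iSup (fun n => maj m B U₀ n i k t) n

theorem ennreal_tsum_iSup {f : ℕ → ℤ → ℝ≥0∞} (h : ∀ k, Monotone fun n => f n k) :
    ∑' k, ⨆ n, f n k = ⨆ n, ∑' k, f n k := by
  simp only [← lintegral_count]
  exact lintegral_iSup (fun n => measurable_of_countable _) fun a b hab k => h k hab

theorem mass_majLim (t : ℝ) : mass (fun i k => majLim m B U₀ i k t) =
    ⨆ n, mass (fun i k => maj m B U₀ n i k t) := by
  unfold mass majLim
  rw [← ENNReal.finsetSum_iSup_of_monotone]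
  · refine Finset.sum_congr rfl fun i _ => ?_
    exact ennreal_tsum_iSup fun k => maj_monotone i k t
  · intro i a b hab
    exact ENNReal.tsum_le_tsum fun k => maj_monotone i k t hab

/-- The Wiener norm of the majorant decays at the rate `δ`. -/
theorem StableData.mass_majLim_le (h : StableData m B U₀ β e₀ δ) {t : ℝ} (ht : 0 ≤ t) :
    ENNReal.ofReal (Real.exp (δ * t)) * mass (fun i k => majLim m B U₀ i k t) ≤ e₀ := by
  rw [mass_majLim, ENNReal.mul_iSup]
  refine iSup_le fun n => ?_
  have h1 := (h.iterate_bound n).2 δ δ.coe_nonneg le_rfl t ht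
  rw [ENNReal.ofReal_coe_nnreal] at h1
  refine (ENNReal.add_le_add_iff_right (ENNReal.mul_ne_top ENNReal.coe_ne_top
    (a := (δ : ℝ≥0∞)) (b := ∑ j, majDiss m B U₀ δ t n j) ?_)).1 h1
  refine (ENNReal.sum_lt_top.2 fun j _ => ?_).ne
  refine lt_of_le_of_lt ?_ (ENNReal.mul_lt_top (ENNReal.ofReal_lt_top (r := Real.exp (δ * t)))
    ((h.iterate_bound n).1 t ht j).lt_top)
  unfold majDiss
  rw [← lintegral_const_mul' _ _ ENNReal.ofReal_ne_top]
  refine setLIntegral_mono' measurableSet_Ioc fun s hs => ?_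
  simp only [zero_mul, Real.exp_zero, ENNReal.ofReal_one, one_mul]
  gcongr
  exact hs.2

/-- The majorant is in `L^1(Ȧ²)`. -/
theorem StableData.lintegral_dissip_majLim_le (h : StableData m B U₀ β e₀ δ) {T : ℝ}
    (hT : 0 ≤ T) :
    δ * ∫⁻ t in Ioc 0 T, ∑ j, dissip (fun k => majLim m B U₀ j k t) ≤ e₀ := by
  have h1 : ∀ t, ∑ j, dissip (fun k => majLim m B U₀ j k t) =
      ⨆ n, ∑ j, dissip (fun k => maj m B U₀ n j k t) := by
    intro t
    rw [← ENNReal.finsetSum_iSup_of_monotone]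
    · refine Finset.sum_congr rfl fun i _ => ?_
      unfold dissip majLim
      simp only [ENNReal.mul_iSup]
      exact ennreal_tsum_iSup fun k a b hab => mul_le_mul_right (maj_monotone i k t hab) _
    · intro i a b hab
      exact ENNReal.tsum_le_tsum fun k => mul_le_mul_right (maj_monotone i k t hab) _
  simp only [h1]
  rw [lintegral_iSup, ENNReal.mul_iSup]
  · refine iSup_le fun n => ?_
    rw [lintegral_finsetSum _ fun j _ => measurable_dissip fun k => measurable_maj n j k]
    have h2 := (h.iterate_bound n).2 0 le_rfl δ.coe_nonneg T hT
    simp only [ENNReal.ofReal_zero, zero_mul, add_zero] at h2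
    refine le_trans (le_of_eq ?_) (le_add_self.trans h2)
    simp [majDiss]
  · exact fun n => Finset.measurable_fun_sum _ fun j _ =>
      measurable_dissip fun k => measurable_maj n j k
  · intro a b hab t
    exact Finset.sum_le_sum fun j _ => ENNReal.tsum_le_tsum fun k =>
      mul_le_mul_right (maj_monotone j k t hab) _

end Majorant

/-! ### Primitives of integrable functions and the complex Duhamel formula -/

/-- The square `(0, T]²` is the union of the two triangles `s ≤ t` and `t < s`. -/
theorem mul_setIntegral_Ioc {𝕜 : Type*} [RCLike 𝕜] {h η : ℝ → 𝕜} {T : ℝ}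
    (hh : IntegrableOn h (Ioc 0 T)) (hη : IntegrableOn η (Ioc 0 T)) :
    (∫ t in Ioc 0 T, h t) * ∫ t in Ioc 0 T, η t =
      (∫ t in Ioc 0 T, h t * ∫ s in Ioc 0 t, η s) +
        ∫ t in Ioc 0 T, (∫ s in Ioc 0 t, h s) * η t := by
  set μ := (volume : Measure ℝ).restrict (Ioc 0 T) with hμ
  have hF : Integrable (fun p : ℝ × ℝ => h p.1 * η p.2) (μ.prod μ) := hh.mul_prod hη
  have hS : MeasurableSet {p : ℝ × ℝ | p.2 ≤ p.1} := measurableSet_le measurable_snd measurable_fst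
  have hmem : ∀ᵐ t ∂μ, t ∈ Ioc 0 T := ae_restrict_mem measurableSet_Ioc
  have hsub : ∀ {g : ℝ → 𝕜} {t : ℝ}, t ∈ Ioc 0 T → ∫ s in Iic t, g s ∂μ = ∫ s in Ioc 0 t, g s := by
    intro g t ht
    rw [hμ, Measure.restrict_restrict measurableSet_Iic]
    congr 2
    ext s
    simp only [mem_inter_iff, mem_Iic, mem_Ioc]
    exact ⟨fun h => ⟨h.2.1, h.1⟩, fun h => ⟨h.2, h.1, h.2.trans ht.2⟩⟩
  rw [← integral_prod_mul (μ := μ) (ν := μ) h η, ← integral_add_compl hS hF,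
    ← integral_indicator hS, ← integral_indicator hS.compl,
    integral_prod _ (hF.indicator hS), integral_prod_symm _ (hF.indicator hS.compl)]
  congr 1
  · refine integral_congr_ae ?_
    filter_upwards [hmem] with t ht
    rw [← hsub ht, ← integral_const_mul, ← integral_indicator measurableSet_Iic]
    congr 1
  · refine integral_congr_ae ?_
    filter_upwards [hmem] with t ht
    rw [← hsub ht, ← integral_mul_const]
    have : ∫ s in Iic t, h s * η t ∂μ = ∫ s in Iio t, h s * η t ∂μ :=
      setIntegral_congr_set Iio_ae_eq_Iic.symm
    rw [this, ← integral_indicator measurableSet_Iio]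
    congr 1
    funext s
    simp only [indicator, mem_compl_iff, mem_ofPred_eq, not_le, mem_Iio]

/-- The product rule for two primitives of integrable functions. -/
theorem primitive_mul_primitive {𝕜 : Type*} [RCLike 𝕜] {v χ h η : ℝ → 𝕜} {v₀ χ₀ : 𝕜} {T : ℝ}
    (hT : 0 ≤ T) (hh : IntegrableOn h (Ioc 0 T)) (hη : IntegrableOn η (Ioc 0 T))
    (hv : ∀ t ∈ Icc 0 T, v t = v₀ + ∫ s in Ioc 0 t, h s)
    (hχ : ∀ t ∈ Icc 0 T, χ t = χ₀ + ∫ s in Ioc 0 t, η s)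
    (hi₁ : IntegrableOn (fun t => h t * χ t) (Ioc 0 T))
    (hi₂ : IntegrableOn (fun t => v t * η t) (Ioc 0 T)) :
    v T * χ T = v₀ * χ₀ + ((∫ t in Ioc 0 T, h t * χ t) + ∫ t in Ioc 0 T, v t * η t) := by
  have e1 : ∫ t in Ioc 0 T, h t * ∫ s in Ioc 0 t, η s =
      (∫ t in Ioc 0 T, h t * χ t) - (∫ t in Ioc 0 T, h t) * χ₀ := by
    rw [← integral_mul_const, ← integral_sub hi₁ (hh.mul_const _)]
    refine setIntegral_congr_fun measurableSet_Ioc fun t ht => ?_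
    simp only [hχ t ⟨ht.1.le, ht.2⟩]; ring
  have e2 : ∫ t in Ioc 0 T, (∫ s in Ioc 0 t, h s) * η t =
      (∫ t in Ioc 0 T, v t * η t) - v₀ * ∫ t in Ioc 0 T, η t := by
    rw [← integral_const_mul, ← integral_sub hi₂ (hη.const_mul _)]
    refine setIntegral_congr_fun measurableSet_Ioc fun t ht => ?_
    simp only [hv t ⟨ht.1.le, ht.2⟩]; ring
  have e3 := mul_setIntegral_Ioc hh hη
  rw [e1, e2] at e3
  rw [hv T ⟨hT, le_rfl⟩, hχ T ⟨hT, le_rfl⟩]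
  linear_combination e3

/-- The solution `e^{-ct} y₀ + ∫₀ᵗ e^{-c(t-s)} r(s) ds` of `y' = -c y + r`, `y(0) = y₀`. -/
def duhamel (c : ℝ) (y₀ : ℂ) (r : ℝ → ℂ) (t : ℝ) : ℂ :=
  Complex.exp (-(c * t)) * y₀ + ∫ s in Ioc 0 t, Complex.exp (-(c * (t - s))) * r s

theorem measurable_duhamel (c : ℝ) (y₀ : ℂ) {r : ℝ → ℂ} (hr : Measurable r) :
    Measurable (duhamel c y₀ r) := by
  unfold duhamel
  refine Measurable.add (by fun_prop) ?_
  have h : MeasurableSet {p : ℝ × ℝ | p.2 ∈ Ioc 0 p.1} :=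
    (measurableSet_lt measurable_const measurable_snd).inter
      (measurableSet_le measurable_snd measurable_fst)
  have h2 : (fun t : ℝ => ∫ s in Ioc 0 t, Complex.exp (-(c * (t - s))) * r s) =
      fun t => ∫ s, {p : ℝ × ℝ | p.2 ∈ Ioc 0 p.1}.indicator
        (fun p => Complex.exp (-(c * (p.1 - p.2))) * r p.2) (t, s) := by
    funext t
    rw [← integral_indicator measurableSet_Ioc]
    rfl
  rw [h2]
  refine (StronglyMeasurable.integral_prod_right' ?_).measurable
  exact ((show Measurable (fun p : ℝ × ℝ => Complex.exp (-(c * (p.1 - p.2))) * r p.2) by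
    fun_prop).indicator h).stronglyMeasurable

theorem enorm_cexp_neg (c t : ℝ) :
    ‖Complex.exp (-(c * t))‖ₑ = ENNReal.ofReal (Real.exp (-(c * t))) := by
  rw [← ofReal_norm, Complex.norm_exp]
  simp

theorem enorm_duhamel_integrand (c t s : ℝ) (z : ℂ) :
    ‖Complex.exp (-(c * (t - s))) * z‖ₑ = ENNReal.ofReal (Real.exp (-(c * (t - s)))) * ‖z‖ₑ := by
  rw [enorm_mul]
  congr 1
  have := enorm_cexp_neg c (t - s)
  push_cast at this
  exact this

/-- The majorant principle: bounds for the datum and the forcing give bounds for the solution. -/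
theorem enorm_duhamel_le {c : ℝ} {y₀ : ℂ} {r : ℝ → ℂ} {b₀ : ℝ≥0∞} {b : ℝ → ℝ≥0∞} (h₀ : ‖y₀‖ₑ ≤ b₀)
    (h : ∀ s, ‖r s‖ₑ ≤ b s) (t : ℝ) : ‖duhamel c y₀ r t‖ₑ ≤ duhamelMaj c b₀ b t := by
  unfold duhamel duhamelMaj
  refine (enorm_add_le _ _).trans (add_le_add ?_ ?_)
  · rw [enorm_mul, enorm_cexp_neg]; gcongr
  · refine (enorm_integral_le_lintegral_enorm _).trans ?_
    gcongr with s
    rw [enorm_duhamel_integrand]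
    gcongr
    exact h s

theorem integrableOn_duhamel_integrand {c : ℝ} {b₀ : ℝ≥0∞} {r : ℝ → ℂ} (hr : Measurable r)
    {b : ℝ → ℝ≥0∞} {t : ℝ} (h : ∀ s, ‖r s‖ₑ ≤ b s) (hfin : duhamelMaj c b₀ b t ≠ ∞) :
    IntegrableOn (fun s : ℝ => Complex.exp (-(c * (t - s))) * r s) (Ioc 0 t) := by
  refine ⟨Measurable.aestronglyMeasurable (by fun_prop), ?_⟩
  refine lt_of_le_of_lt ?_
    (lt_of_le_of_lt (le_add_self (b := ENNReal.ofReal (Real.exp (-(c * t))) * b₀)) hfin.lt_top)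
  gcongr with s
  rw [enorm_duhamel_integrand]
  gcongr
  exact h s

/-- The Duhamel formula implies `y' = -c y + r` in integrated form, for a merely integrable forcing
`r`. -/
theorem duhamel_integrated {c : ℝ} {y₀ : ℂ} {y r : ℝ → ℂ} {T : ℝ} (hT : 0 ≤ T)
    (hy : ∀ t ∈ Icc 0 T, y t = duhamel c y₀ r t) (hr : IntegrableOn r (Ioc 0 T))
    (hyi : IntegrableOn y (Ioc 0 T)) :
    y T = y₀ + ∫ t in Ioc 0 T, (-(c * y t) + r t) := by
  have hexp : ∀ t : ℝ, Complex.exp (-(c * t)) = 1 + ∫ s in Ioc 0 t, -(c * Complex.exp (-(c * s))) ∨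
      t < 0 := by
    intro t
    rcases lt_or_ge t 0 with ht | ht
    · exact Or.inr ht
    left
    have hd : ∀ s ∈ uIcc 0 t, HasDerivAt (fun s : ℝ => Complex.exp (-(c * s)))
        (-(c * Complex.exp (-(c * s)))) s := by
      intro s _
      have h1 : HasDerivAt (fun s : ℝ => (s : ℂ)) 1 s := Complex.ofRealCLM.hasDerivAt
      exact ((h1.const_mul (c : ℂ)).neg.cexp).congr_deriv (by simp; ring)
    have hi := intervalIntegral.integral_eq_sub_of_hasDerivAt hd
      (Continuous.intervalIntegrable (by fun_prop) _ _)
    rw [intervalIntegral.integral_of_le ht] at hi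
    rw [hi]; simp
  have hre : IntegrableOn (fun t : ℝ => Complex.exp (c * t) * r t) (Ioc 0 T) := by
    have : ContinuousOn (fun t : ℝ => Complex.exp (c * t)) (Icc 0 T) := by fun_prop
    exact (((integrableOn_Icc_iff_integrableOn_Ioc (by simp)).2 hr).continuousOn_mul this
      isCompact_Icc).mono_set Ioc_subset_Icc_self
  have hye : IntegrableOn (fun t : ℝ => Complex.exp (c * t) * y t) (Ioc 0 T) := by
    have : ContinuousOn (fun t : ℝ => Complex.exp (c * t)) (Icc 0 T) := by fun_prop
    exact (((integrableOn_Icc_iff_integrableOn_Ioc (by simp)).2 hyi).continuousOn_mul this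
      isCompact_Icc).mono_set Ioc_subset_Icc_self
  have hcancel : ∀ t : ℝ, Complex.exp (c * t) * Complex.exp (-(c * t)) = 1 := fun t => by
    rw [← Complex.exp_add]; simp
  have key := primitive_mul_primitive (v := fun t => Complex.exp (c * t) * y t)
    (χ := fun t => Complex.exp (-(c * t))) (h := fun t => Complex.exp (c * t) * r t)
    (η := fun t => -(c * Complex.exp (-(c * t)))) (v₀ := y₀) (χ₀ := 1) hT hre
    ((Continuous.integrableOn_Icc (by fun_prop)).mono_set Ioc_subset_Icc_self) ?_ ?_ ?_ ?_
  · have e : ∀ t : ℝ, Complex.exp (c * t) * y t * Complex.exp (-(c * t)) = y t := fun t => by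
      linear_combination y t * hcancel t
    have e1 : ∀ t : ℝ, Complex.exp (c * t) * r t * Complex.exp (-(c * t)) = r t := fun t => by
      linear_combination r t * hcancel t
    have e2 : ∀ t : ℝ, Complex.exp (c * t) * y t * -(c * Complex.exp (-(c * t))) = -(c * y t) :=
      fun t => by linear_combination (-c * y t) * hcancel t
    simp only [e, e1, e2, mul_one] at key
    rw [key, add_comm (∫ t in Ioc 0 T, r t), integral_add ?_ hr]
    exact (hyi.const_mul (c : ℂ)).neg
  · intro t ht
    rw [hy t ht, duhamel, mul_add, ← mul_assoc, hcancel, one_mul, ← integral_const_mul]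
    congr 2; funext s
    rw [← mul_assoc, ← Complex.exp_add]
    congr 2; ring
  · intro t ht
    exact (hexp t).resolve_right (not_lt.2 ht.1)
  · refine hr.congr_fun (fun t _ => ?_) measurableSet_Ioc
    linear_combination (-r t) * hcancel t
  · refine IntegrableOn.congr_fun (f := fun t => (-c : ℂ) * y t)
      (hyi.const_mul (-c : ℂ)) (fun t _ => ?_) measurableSet_Ioc
    linear_combination (c * y t) * hcancel t

section Modes

variable {ι : Type*} [Fintype ι] [DecidableEq ι]

/-! ### The Fourier side of the system -/

/-- The `k`-th Fourier coefficient of `uᵢ ∑ⱼ Bᵢⱼ ∂ₓuⱼ`. -/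
def flux (B : ι → ι → ℝ≥0) (u : ι → ℤ → ℂ) (i : ι) (k : ℤ) : ℂ :=
  ∑ j, ((B i j : ℝ) : ℂ) * ∑' l : ℤ, u i (k - l) * (Complex.I * l * u j l)

/-- The `k`-th Fourier coefficient of the right-hand side of the `i`-th equation without its
diagonal linear part `mᵢ Bᵢᵢ ∂ₓ²uᵢ`. -/
def rhs (m : ι → ℝ≥0) (B : ι → ι → ℝ≥0) (u : ι → ℤ → ℂ) (i : ι) (k : ℤ) : ℂ :=
  -(∑ j ∈ Finset.univ.erase i, ((m i * B i j : ℝ) : ℂ) * ((k : ℂ) ^ 2 * u j k)) +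
    Complex.I * k * flux B u i k

variable {m : ι → ℝ≥0} {B : ι → ι → ℝ≥0}

theorem enorm_intCast (k : ℤ) : ‖(k : ℂ)‖ₑ = (k.natAbs : ℝ≥0∞) := by
  rw [← ofReal_norm, Complex.norm_intCast, ← Int.cast_abs, ← Nat.cast_natAbs,
    ENNReal.ofReal_natCast]

theorem enorm_coe_nnreal (r : ℝ≥0) : ‖((r : ℝ) : ℂ)‖ₑ = r := by
  rw [← ofReal_norm, Complex.norm_real, Real.norm_of_nonneg r.coe_nonneg]
  exact ENNReal.ofReal_coe_nnreal

theorem enorm_flux_term (u v : ℂ) (l : ℤ) :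
    ‖u * (Complex.I * l * v)‖ₑ = ‖u‖ₑ * (l.natAbs * ‖v‖ₑ) := by
  rw [enorm_mul, enorm_mul, enorm_mul, enorm_intCast]
  have : ‖Complex.I‖ₑ = 1 := by rw [← ofReal_norm]; simp
  rw [this, one_mul]

theorem enorm_flux_le {u : ι → ℤ → ℂ} {a : ι → ℤ → ℝ≥0∞} (h : ∀ i k, ‖u i k‖ₑ ≤ a i k) (i : ι)
    (k : ℤ) : ‖flux B u i k‖ₑ ≤ majFlux B a i k := by
  unfold flux majFlux
  refine (enorm_sum_le _ _).trans (Finset.sum_le_sum fun j _ => ?_)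
  rw [enorm_mul, enorm_coe_nnreal]
  gcongr
  refine enorm_tsum_le_tsum_enorm.trans (ENNReal.tsum_le_tsum fun l => ?_)
  rw [enorm_flux_term]
  gcongr <;> exact h _ _

theorem enorm_rhs_linear (m B : ℝ≥0) (k : ℤ) (z : ℂ) :
    ‖((m * B : ℝ) : ℂ) * ((k : ℂ) ^ 2 * z)‖ₑ = m * B * ((k.natAbs : ℝ≥0∞) ^ 2 * ‖z‖ₑ) := by
  rw [enorm_mul, enorm_mul, enorm_pow, enorm_intCast, ← NNReal.coe_mul, enorm_coe_nnreal,
    ENNReal.coe_mul]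

theorem enorm_I_mul_intCast (k : ℤ) (z : ℂ) : ‖Complex.I * k * z‖ₑ = k.natAbs * ‖z‖ₑ := by
  have := enorm_flux_term 1 z k
  simpa using this

theorem enorm_rhs_le {u : ι → ℤ → ℂ} {a : ι → ℤ → ℝ≥0∞} (h : ∀ i k, ‖u i k‖ₑ ≤ a i k) (i : ι)
    (k : ℤ) : ‖rhs m B u i k‖ₑ ≤ majRhs m B a i k := by
  unfold rhs majRhs
  refine (enorm_add_le _ _).trans (add_le_add ?_ ?_)
  · rw [enorm_neg]
    refine (enorm_sum_le _ _).trans (Finset.sum_le_sum fun j _ => ?_)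
    rw [enorm_rhs_linear]
    gcongr
    exact h _ _
  · rw [enorm_I_mul_intCast]
    gcongr
    exact enorm_flux_le h i k

theorem measurable_flux {u : ℝ → ι → ℤ → ℂ} (h : ∀ i k, Measurable fun t => u t i k)
    (i : ι) (k : ℤ) : Measurable fun t => flux B (u t) i k := by
  unfold flux
  refine Finset.measurable_fun_sum _ fun j _ => Measurable.const_mul ?_ _
  exact Measurable.tsum fun l => (h i _).mul ((h j l).const_mul _)

theorem measurable_rhs {u : ℝ → ι → ℤ → ℂ} (h : ∀ i k, Measurable fun t => u t i k)
    (i : ι) (k : ℤ) : Measurable fun t => rhs m B (u t) i k := by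
  unfold rhs
  exact Measurable.add (Finset.measurable_fun_sum _ fun j _ =>
    ((h j k).const_mul _).const_mul _).neg ((measurable_flux h i k).const_mul _)

theorem le_mass (a : ι → ℤ → ℝ≥0∞) (i : ι) (k : ℤ) : a i k ≤ mass a :=
  (ENNReal.le_tsum k).trans (Finset.single_le_sum (f := fun i => ∑' k, a i k)
    (fun _ _ => zero_le) (Finset.mem_univ i))

theorem tsum_flux_ne_top {a : ι → ℤ → ℝ≥0∞} (h1 : mass a ≠ ∞) (h2 : ∀ j, dissip (a j) ≠ ∞)
    (i j : ι) (k : ℤ) : ∑' l : ℤ, a i (k - l) * (l.natAbs * a j l) ≠ ∞ := by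
  refine ne_top_of_le_ne_top (ENNReal.mul_ne_top h1 (h2 j)) ?_
  unfold dissip
  rw [← ENNReal.tsum_mul_left]
  refine ENNReal.tsum_le_tsum fun l => ?_
  gcongr
  · exact le_mass a _ _
  · exact_mod_cast Nat.le_self_pow two_ne_zero _

/-- A product of terms with controlled increments has a controlled increment. -/
theorem enorm_mul_sub_mul_add_le {x x' y y' : ℂ} {a a' b b' : ℝ≥0∞} (hx : ‖x‖ₑ ≤ a)
    (hy : ‖y'‖ₑ ≤ b') (hxx : ‖x' - x‖ₑ + a ≤ a') (hyy : ‖y' - y‖ₑ + b ≤ b') :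
    ‖x' * y' - x * y‖ₑ + a * b ≤ a' * b' := by
  calc ‖x' * y' - x * y‖ₑ + a * b = ‖(x' - x) * y' + x * (y' - y)‖ₑ + a * b := by ring_nf
    _ ≤ ‖x' - x‖ₑ * b' + a * ‖y' - y‖ₑ + a * b := by
      gcongr
      refine (enorm_add_le _ _).trans ?_
      rw [enorm_mul, enorm_mul]
      gcongr
    _ = ‖x' - x‖ₑ * b' + a * (‖y' - y‖ₑ + b) := by ring
    _ ≤ ‖x' - x‖ₑ * b' + a * b' := by gcongr
    _ = (‖x' - x‖ₑ + a) * b' := by ring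
    _ ≤ a' * b' := by gcongr

/-- If the increments of the coefficients are dominated by the increments of the majorants, so are
the increments of the flux. The increment of the majorant is written on the left to avoid
subtraction in `[0, ∞]`. -/
theorem enorm_flux_sub_le {u u' : ι → ℤ → ℂ} {a a' : ι → ℤ → ℝ≥0∞} (h : ∀ i k, ‖u i k‖ₑ ≤ a i k)
    (h' : ∀ i k, ‖u' i k‖ₑ ≤ a' i k) (hd : ∀ i k, ‖u' i k - u i k‖ₑ + a i k ≤ a' i k)
    (h1 : mass a' ≠ ∞) (h2 : ∀ j, dissip (a' j) ≠ ∞) (i : ι) (k : ℤ) :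
    ‖flux B u' i k - flux B u i k‖ₑ + majFlux B a i k ≤ majFlux B a' i k := by
  unfold flux majFlux
  rw [← Finset.sum_sub_distrib]
  refine (add_le_add_left (enorm_sum_le _ _) _).trans ?_
  rw [← Finset.sum_add_distrib]
  refine Finset.sum_le_sum fun j _ => ?_
  rw [← mul_sub, enorm_mul, enorm_coe_nnreal, ← mul_add]
  gcongr
  have ha : ∀ i k, a i k ≤ a' i k := fun i k => le_add_self.trans (hd i k)
  have s' : Summable fun l : ℤ => u' i (k - l) * (Complex.I * l * u' j l) := by
    refine Summable.of_enorm (ne_top_of_le_ne_top (tsum_flux_ne_top h1 h2 i j k) ?_)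
    refine ENNReal.tsum_le_tsum fun l => ?_
    rw [enorm_flux_term]
    gcongr <;> exact h' _ _
  have s : Summable fun l : ℤ => u i (k - l) * (Complex.I * l * u j l) := by
    refine Summable.of_enorm (ne_top_of_le_ne_top (tsum_flux_ne_top h1 h2 i j k) ?_)
    refine ENNReal.tsum_le_tsum fun l => ?_
    rw [enorm_flux_term]
    gcongr <;> exact (h _ _).trans (ha _ _)
  rw [← s'.tsum_sub s]
  refine (add_le_add_left enorm_tsum_le_tsum_enorm _).trans ?_
  rw [← ENNReal.tsum_add]
  refine ENNReal.tsum_le_tsum fun l => ?_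
  refine enorm_mul_sub_mul_add_le (h _ _) ?_ (hd _ _) ?_
  · rw [enorm_I_mul_intCast]; gcongr; exact h' _ _
  · rw [← mul_sub, enorm_I_mul_intCast, ← mul_add]; gcongr; exact hd _ _

/-- The analogue of `enorm_flux_sub_le` for the right-hand side of the system. -/
theorem enorm_rhs_sub_le {u u' : ι → ℤ → ℂ} {a a' : ι → ℤ → ℝ≥0∞} (h : ∀ i k, ‖u i k‖ₑ ≤ a i k)
    (h' : ∀ i k, ‖u' i k‖ₑ ≤ a' i k) (hd : ∀ i k, ‖u' i k - u i k‖ₑ + a i k ≤ a' i k)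
    (h1 : mass a' ≠ ∞) (h2 : ∀ j, dissip (a' j) ≠ ∞) (i : ι) (k : ℤ) :
    ‖rhs m B u' i k - rhs m B u i k‖ₑ + majRhs m B a i k ≤ majRhs m B a' i k := by
  unfold rhs majRhs
  rw [add_sub_add_comm, neg_sub_neg, ← neg_sub, ← Finset.sum_sub_distrib, ← mul_sub]
  refine (add_le_add_left (enorm_add_le _ _) _).trans ?_
  rw [enorm_neg, enorm_I_mul_intCast, add_add_add_comm, ← mul_add]
  refine add_le_add ?_ (mul_le_mul_right (enorm_flux_sub_le h h' hd h1 h2 i k) _)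
  refine (add_le_add_left (enorm_sum_le _ _) _).trans ?_
  rw [← Finset.sum_add_distrib]
  refine Finset.sum_le_sum fun j _ => ?_
  rw [← mul_sub, ← mul_sub, enorm_rhs_linear, ← mul_add, ← mul_add]
  gcongr
  exact hd _ _

theorem tendsto_flux {u : ℕ → ι → ℤ → ℂ} {u' : ι → ℤ → ℂ} {a : ι → ℤ → ℝ≥0∞}
    (h : ∀ n i k, ‖u n i k‖ₑ ≤ a i k) (h1 : mass a ≠ ∞) (h2 : ∀ j, dissip (a j) ≠ ∞)
    (hu : ∀ i k, Tendsto (fun n => u n i k) atTop (𝓝 (u' i k))) (i : ι) (k : ℤ) :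
    Tendsto (fun n => flux B (u n) i k) atTop (𝓝 (flux B u' i k)) := by
  unfold flux
  refine tendsto_finsetSum _ fun j _ => Tendsto.const_mul _ ?_
  refine tendsto_tsum_of_dominated_convergence
    (ENNReal.summable_toReal (tsum_flux_ne_top h1 h2 i j k)) (fun l => ?_)
    (Eventually.of_forall fun n l => ?_)
  · exact (hu i _).mul ((hu j l).const_mul _)
  · rw [← toReal_enorm, enorm_flux_term]
    refine ENNReal.toReal_mono (ENNReal.ne_top_of_tsum_ne_top (tsum_flux_ne_top h1 h2 i j k) l) ?_
    gcongr <;> exact h _ _ _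

theorem tendsto_rhs {u : ℕ → ι → ℤ → ℂ} {u' : ι → ℤ → ℂ} {a : ι → ℤ → ℝ≥0∞}
    (h : ∀ n i k, ‖u n i k‖ₑ ≤ a i k) (h1 : mass a ≠ ∞) (h2 : ∀ j, dissip (a j) ≠ ∞)
    (hu : ∀ i k, Tendsto (fun n => u n i k) atTop (𝓝 (u' i k))) (i : ι) (k : ℤ) :
    Tendsto (fun n => rhs m B (u n) i k) atTop (𝓝 (rhs m B u' i k)) := by
  unfold rhs
  exact Tendsto.add (tendsto_finsetSum _ fun j _ =>
    ((hu j k).const_mul _).const_mul _).neg ((tendsto_flux h h1 h2 hu i k).const_mul _)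

open ComplexConjugate in
theorem flux_conj {u : ι → ℤ → ℂ} (h : ∀ i k, u i (-k) = conj (u i k)) (i : ι) (k : ℤ) :
    flux B u i (-k) = conj (flux B u i k) := by
  unfold flux
  simp only [map_sum, map_mul, Complex.conj_ofReal, Complex.conj_tsum, Complex.conj_I]
  refine Finset.sum_congr rfl fun j _ => ?_
  congr 1
  rw [← (Equiv.neg ℤ).tsum_eq]
  refine tsum_congr fun l => ?_
  rw [Equiv.neg_apply, h j l, ← h i (k - l)]
  simp only [map_intCast, Int.cast_neg]
  rw [show -k - -l = -(k - l) by ring]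
  ring

open ComplexConjugate in
theorem rhs_conj {u : ι → ℤ → ℂ} (h : ∀ i k, u i (-k) = conj (u i k)) (i : ι) (k : ℤ) :
    rhs m B u i (-k) = conj (rhs m B u i k) := by
  unfold rhs
  rw [flux_conj h]
  simp only [map_add, map_neg, map_sum, map_mul, map_pow, Complex.conj_ofReal, Complex.conj_I,
    map_intCast, h, Int.cast_neg, neg_sq]
  ring

/-! ### Picard iterates of the system -/

/-- The Picard iterates of the system on the Fourier side. -/
def pic (m : ι → ℝ≥0) (B : ι → ι → ℝ≥0) (V : ι → ℤ → ℂ) : ℕ → ι → ℤ → ℝ → ℂ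
  | 0 => fun _ _ _ => 0
  | n + 1 => fun i k => duhamel (damping m B i k) (V i k)
      (fun s => rhs m B (fun j l => pic m B V n j l s) i k)

variable {V : ι → ℤ → ℂ} {U₀ : ι → ℤ → ℝ≥0∞} {β e₀ δ : ℝ≥0}

theorem measurable_pic (n : ℕ) (i : ι) (k : ℤ) : Measurable (pic m B V n i k) := by
  induction n generalizing i k with
  | zero => exact measurable_const
  | succ n ih =>
    exact measurable_duhamel _ _ (measurable_rhs (u := fun t j l => pic m B V n j l t) ih i k)

theorem enorm_pic_le (hV : ∀ i k, ‖V i k‖ₑ ≤ U₀ i k) (n : ℕ) (i : ι) (k : ℤ) (t : ℝ) :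
    ‖pic m B V n i k t‖ₑ ≤ maj m B U₀ n i k t := by
  induction n generalizing i k t with
  | zero => simp [pic]
  | succ n ih => exact enorm_duhamel_le (hV i k) (fun s => enorm_rhs_le (fun j l => ih j l s) i k) t

theorem StableData.mass_majLim_le' (h : StableData m B U₀ β e₀ δ) {t : ℝ} (ht : 0 ≤ t) :
    mass (fun i k => majLim m B U₀ i k t) ≤ e₀ := by
  refine le_trans ?_ (h.mass_majLim_le ht)
  refine le_mul_of_one_le_left' ?_
  rw [ENNReal.one_le_ofReal]
  exact Real.one_le_exp (by positivity)

theorem StableData.majLim_ne_top (h : StableData m B U₀ β e₀ δ) {t : ℝ} (ht : 0 ≤ t) (i : ι)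
    (k : ℤ) : majLim m B U₀ i k t ≠ ∞ :=
  ne_top_of_le_ne_top ENNReal.coe_ne_top
    ((le_mass (fun i k => majLim m B U₀ i k t) i k).trans (h.mass_majLim_le' ht))

theorem StableData.lintegral_dissip_ne_top (h : StableData m B U₀ β e₀ δ) {T : ℝ} (hT : 0 ≤ T) :
    ∫⁻ t in Ioc 0 T, ∑ j, dissip (fun k => majLim m B U₀ j k t) ≠ ∞ := by
  intro h1
  have h2 := h.lintegral_dissip_majLim_le hT
  rw [h1, ENNReal.mul_top (by exact_mod_cast h.margin_pos.ne')] at h2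
  exact ENNReal.coe_ne_top (top_le_iff.1 h2)

theorem measurable_sum_dissip_majLim :
    Measurable fun t => ∑ j, dissip (fun k => majLim m B U₀ j k t) :=
  Finset.measurable_fun_sum _ fun j _ => measurable_dissip fun k => measurable_majLim j k

theorem StableData.ae_dissip_ne_top (h : StableData m B U₀ β e₀ δ) {T : ℝ} (hT : 0 ≤ T) :
    ∀ᵐ t ∂(volume.restrict (Ioc 0 T)), ∀ j, dissip (fun k => majLim m B U₀ j k t) ≠ ∞ := by
  filter_upwards [ae_lt_top measurable_sum_dissip_majLim (h.lintegral_dissip_ne_top hT)] with t ht j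
  exact (ENNReal.sum_lt_top.1 ht j (Finset.mem_univ j)).ne

/-- The right-hand side of the majorant system is integrable in time, summed over all modes. -/
theorem StableData.lintegral_majRhs_ne_top (h : StableData m B U₀ β e₀ δ) {T : ℝ} (hT : 0 ≤ T) :
    ∫⁻ t in Ioc 0 T, ∑ i, ∑' k, majRhs m B (fun j l => majLim m B U₀ j l t) i k ≠ ∞ := by
  set K : ℝ≥0 := ∑ j, (2 * β * e₀ + offDiag m B j)
  refine ne_top_of_le_ne_top (ENNReal.mul_ne_top (ENNReal.coe_ne_top (r := K))
    (h.lintegral_dissip_ne_top hT)) ?_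
  rw [← lintegral_const_mul _ measurable_sum_dissip_majLim]
  refine setLIntegral_mono' measurableSet_Ioc fun t ht => ?_
  refine (tsum_majRhs_le h.coeff_le (h.mass_majLim_le' ht.1.le)).trans ?_
  rw [Finset.mul_sum]
  gcongr with j _
  exact Finset.single_le_sum (f := fun j => 2 * β * e₀ + offDiag m B j) (fun _ _ => zero_le)
    (Finset.mem_univ j)

/-- The increments of the Picard iterates are dominated by those of the majorants. They are
therefore summable, which replaces a contraction argument. -/
theorem StableData.pic_increment (h : StableData m B U₀ β e₀ δ) (hV : ∀ i k, ‖V i k‖ₑ ≤ U₀ i k)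
    (n : ℕ) (i : ι) (k : ℤ) {t : ℝ} (ht : 0 ≤ t) :
    ‖pic m B V (n + 1) i k t - pic m B V n i k t‖ₑ + maj m B U₀ n i k t ≤
      maj m B U₀ (n + 1) i k t := by
  induction n generalizing i k t with
  | zero => simpa [pic, maj] using enorm_pic_le hV 1 i k t
  | succ n ih =>
    -- The finite majorant makes the integrals in the Duhamel formula converge.
    have hint : ∀ n, IntegrableOn (fun s : ℝ => Complex.exp (-(damping m B i k * (t - s))) *
        rhs m B (fun j l => pic m B V n j l s) i k) (Ioc 0 t) := fun n =>
      integrableOn_duhamel_integrand (b₀ := U₀ i k)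
        (measurable_rhs (u := fun t j l => pic m B V n j l t) (measurable_pic n) i k)
        (fun s => enorm_rhs_le (fun j l => enorm_pic_le hV n j l s) i k)
        (ne_top_of_le_ne_top (h.majLim_ne_top ht i k) (maj_le_majLim (n + 1) i k t))
    change ‖duhamel _ _ _ _ - duhamel _ _ _ _‖ₑ + duhamelMaj _ _ _ _ ≤ duhamelMaj _ _ _ _
    unfold duhamel duhamelMaj
    rw [add_sub_add_left_eq_sub, ← integral_sub (hint (n + 1)) (hint n), add_left_comm]
    gcongr
    refine (add_le_add_left (enorm_integral_le_lintegral_enorm _) _).trans ?_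
    have hmeas := measurable_majRhs (m := m) (B := B) (a := fun t j l => maj m B U₀ n j l t)
      (fun j l => measurable_maj n j l) i k
    simp only
    rw [← lintegral_add_right _ (by fun_prop)]
    refine lintegral_mono_ae ?_
    filter_upwards [h.ae_dissip_ne_top ht, ae_restrict_mem measurableSet_Ioc] with s hs hst
    rw [← mul_sub, enorm_duhamel_integrand, ← mul_add]
    gcongr
    refine enorm_rhs_sub_le (fun j l => enorm_pic_le hV n j l s)
      (fun j l => enorm_pic_le hV (n + 1) j l s) (fun j l => ih j l hst.1.le) ?_ (fun j => ?_) i k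
    · refine ne_top_of_le_ne_top ENNReal.coe_ne_top (le_trans ?_ (h.mass_majLim_le' hst.1.le))
      unfold mass
      gcongr
      exact maj_le_majLim _ _ _ _
    · refine ne_top_of_le_ne_top (hs j) ?_
      unfold dissip
      gcongr
      exact maj_le_majLim _ _ _ _

theorem StableData.exists_tendsto_pic (h : StableData m B U₀ β e₀ δ)
    (hV : ∀ i k, ‖V i k‖ₑ ≤ U₀ i k) (i : ι) (k : ℤ) {t : ℝ} (ht : 0 ≤ t) :
    ∃ z, Tendsto (fun n => pic m B V n i k t) atTop (𝓝 z) := by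
  refine cauchySeq_tendsto_of_complete (cauchySeq_of_edist_le_of_tsum_ne_top
    (fun n => ‖pic m B V (n + 1) i k t - pic m B V n i k t‖ₑ) (fun n => ?_) ?_)
  · rw [edist_comm, edist_eq_enorm_sub]
  · refine ne_top_of_le_ne_top (h.majLim_ne_top ht i k)
      (ENNReal.tsum_le_of_sum_range_le fun n => le_trans ?_ (maj_le_majLim n i k t))
    induction n with
    | zero => simp
    | succ n ih =>
      rw [Finset.sum_range_succ, add_comm]
      exact (by gcongr : _ ≤ _).trans (h.pic_increment hV n i k ht)

/-- The limit of the Picard iterates, extended to negative times by its initial value. -/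
def modes (m : ι → ℝ≥0) (B : ι → ι → ℝ≥0) (V : ι → ℤ → ℂ) (i : ι) (k : ℤ) (t : ℝ) : ℂ :=
  limUnder atTop fun n => pic m B V n i k (max t 0)

theorem StableData.tendsto_modes (h : StableData m B U₀ β e₀ δ) (hV : ∀ i k, ‖V i k‖ₑ ≤ U₀ i k)
    (i : ι) (k : ℤ) (t : ℝ) :
    Tendsto (fun n => pic m B V n i k (max t 0)) atTop (𝓝 (modes m B V i k t)) :=
  tendsto_nhds_limUnder (h.exists_tendsto_pic hV i k (le_max_right t 0))

theorem StableData.measurable_modes (h : StableData m B U₀ β e₀ δ)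
    (hV : ∀ i k, ‖V i k‖ₑ ≤ U₀ i k) (i : ι) (k : ℤ) : Measurable (modes m B V i k) :=
  measurable_of_tendsto_metrizable
    (fun n => (measurable_pic n i k).comp (measurable_id.max measurable_const))
    (tendsto_pi_nhds.2 fun t => h.tendsto_modes hV i k t)

theorem StableData.enorm_modes_le (h : StableData m B U₀ β e₀ δ)
    (hV : ∀ i k, ‖V i k‖ₑ ≤ U₀ i k) (i : ι) (k : ℤ) (t : ℝ) :
    ‖modes m B V i k t‖ₑ ≤ majLim m B U₀ i k (max t 0) :=
  le_of_tendsto' (h.tendsto_modes hV i k t).enorm fun n =>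
    (enorm_pic_le hV n i k _).trans (maj_le_majLim n i k _)

/-- The Duhamel formula passes to the limit by dominated convergence, the majorant being integrable.
-/
theorem StableData.modes_duhamel (h : StableData m B U₀ β e₀ δ) (hV : ∀ i k, ‖V i k‖ₑ ≤ U₀ i k)
    (i : ι) (k : ℤ) {t : ℝ} (ht : 0 ≤ t) :
    modes m B V i k t = duhamel (damping m B i k) (V i k)
      (fun s => rhs m B (fun j l => modes m B V j l s) i k) t := by
  have h1 := (h.tendsto_modes hV i k t).comp (tendsto_add_atTop_nat 1)
  rw [max_eq_left ht] at h1
  refine tendsto_nhds_unique h1 ?_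
  change Tendsto (fun n => duhamel _ _ _ _) _ _
  unfold duhamel
  refine Tendsto.const_add _ ?_
  have hfin : ∫⁻ s in Ioc 0 t, majRhs m B (fun j l => majLim m B U₀ j l s) i k ≠ ∞ := by
    refine ne_top_of_le_ne_top (h.lintegral_majRhs_ne_top ht) (lintegral_mono fun s => ?_)
    exact le_mass (fun i k => majRhs m B (fun j l => majLim m B U₀ j l s) i k) i k
  have hmeas := measurable_majRhs (m := m) (B := B) (a := fun t j l => majLim m B U₀ j l t)
        (fun j l => measurable_majLim j l) i k
  refine tendsto_integral_of_dominated_convergence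
    (fun s => (majRhs m B (fun j l => majLim m B U₀ j l s) i k).toReal) (fun n => ?_)
    (integrable_toReal_of_lintegral_ne_top hmeas.aemeasurable hfin) (fun n => ?_) ?_
  · exact (Measurable.mul (by fun_prop) (measurable_rhs (u := fun t j l => pic m B V n j l t)
      (measurable_pic n) i k)).aestronglyMeasurable
  · filter_upwards [ae_lt_top hmeas hfin, ae_restrict_mem measurableSet_Ioc] with s hs hst
    rw [← toReal_enorm, enorm_duhamel_integrand]
    refine ENNReal.toReal_mono hs.ne ?_
    refine mul_le_of_le_one_of_le ?_ ?_
    · rw [ENNReal.ofReal_le_one, Real.exp_le_one_iff, neg_nonpos]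
      exact mul_nonneg (damping_nonneg i k) (sub_nonneg.2 hst.2)
    · exact enorm_rhs_le (fun j l => (enorm_pic_le hV n j l s).trans (maj_le_majLim n j l s)) i k
  · filter_upwards [h.ae_dissip_ne_top ht, ae_restrict_mem measurableSet_Ioc] with s hs hst
    refine Tendsto.const_mul _ (tendsto_rhs
      (fun n j l => (enorm_pic_le hV n j l s).trans (maj_le_majLim n j l s))
      (ne_top_of_le_ne_top ENNReal.coe_ne_top (h.mass_majLim_le' hst.1.le)) hs (fun j l => ?_) i k)
    have := h.tendsto_modes hV j l s
    rwa [max_eq_left hst.1.le] at this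

/-! ### Properties of the solution on the Fourier side -/

open ComplexConjugate in
theorem pic_conj (hV : ∀ i k, V i (-k) = conj (V i k)) (n : ℕ) (i : ι) (k : ℤ) (t : ℝ) :
    pic m B V n i (-k) t = conj (pic m B V n i k t) := by
  induction n generalizing i k t with
  | zero => simp [pic]
  | succ n ih =>
    have hd : damping m B i (-k) = damping m B i k := by simp [damping]
    have hr : ∀ s, rhs m B (fun j l => pic m B V n j l s) i (-k) =
        conj (rhs m B (fun j l => pic m B V n j l s) i k) := fun s =>
      rhs_conj (fun i k => ih i k s) i k
    simp only [pic, duhamel, hd, hr, hV, map_add, map_mul,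
      ← integral_conj, ← Complex.exp_conj, map_neg, map_sub, Complex.conj_ofReal]

open ComplexConjugate in
theorem StableData.modes_conj (h : StableData m B U₀ β e₀ δ) (hV : ∀ i k, ‖V i k‖ₑ ≤ U₀ i k)
    (hVc : ∀ i k, V i (-k) = conj (V i k)) (i : ι) (k : ℤ) (t : ℝ) :
    modes m B V i (-k) t = conj (modes m B V i k t) := by
  refine tendsto_nhds_unique (h.tendsto_modes hV i (-k) t) ?_
  simp only [pic_conj hVc]
  exact (Complex.continuous_conj.tendsto _).comp (h.tendsto_modes hV i k t)

theorem StableData.mass_modes_le (h : StableData m B U₀ β e₀ δ) (hV : ∀ i k, ‖V i k‖ₑ ≤ U₀ i k)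
    (t : ℝ) : mass (fun i k => ‖modes m B V i k t‖ₑ) ≤ e₀ := by
  refine le_trans ?_ (h.mass_majLim_le' (le_max_right t 0))
  unfold mass
  gcongr
  exact h.enorm_modes_le hV _ _ _

theorem StableData.exp_mul_mass_modes_le (h : StableData m B U₀ β e₀ δ)
    (hV : ∀ i k, ‖V i k‖ₑ ≤ U₀ i k) {t : ℝ} (ht : 0 ≤ t) :
    ENNReal.ofReal (Real.exp (δ * t)) * mass (fun i k => ‖modes m B V i k t‖ₑ) ≤ e₀ := by
  refine le_trans ?_ (h.mass_majLim_le ht)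
  unfold mass
  gcongr
  refine (h.enorm_modes_le hV _ _ _).trans_eq ?_
  rw [max_eq_left ht]

theorem StableData.lintegral_dissip_modes_ne_top (h : StableData m B U₀ β e₀ δ)
    (hV : ∀ i k, ‖V i k‖ₑ ≤ U₀ i k) (T : ℝ) (j : ι) :
    ∫⁻ t in Ioc 0 T, dissip (fun k => ‖modes m B V j k t‖ₑ) ≠ ∞ := by
  rcases lt_or_ge T 0 with hT | hT
  · simp [Ioc_eq_empty (not_lt.2 hT.le)]
  refine ne_top_of_le_ne_top (h.lintegral_dissip_ne_top hT) ?_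
  refine setLIntegral_mono' measurableSet_Ioc fun t ht => ?_
  refine le_trans ?_ (Finset.single_le_sum (f := fun j => dissip (fun k => majLim m B U₀ j k t))
    (fun _ _ => zero_le) (Finset.mem_univ j))
  unfold dissip
  gcongr
  refine (h.enorm_modes_le hV _ _ _).trans_eq ?_
  rw [max_eq_left ht.1.le]

theorem StableData.modes_zero (h : StableData m B U₀ β e₀ δ) (hV : ∀ i k, ‖V i k‖ₑ ≤ U₀ i k)
    (i : ι) (t : ℝ) : modes m B V i 0 t = 0 := by
  have h1 := h.enorm_modes_le hV i 0 t
  simpa [majLim, maj_zero_mode h.zero_mode] using h1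

theorem StableData.lintegral_rhs_modes_ne_top (h : StableData m B U₀ β e₀ δ)
    (hV : ∀ i k, ‖V i k‖ₑ ≤ U₀ i k) {T : ℝ} (hT : 0 ≤ T) :
    ∫⁻ t in Ioc 0 T, ∑ i, ∑' k, ‖rhs m B (fun j l => modes m B V j l t) i k‖ₑ ≠ ∞ := by
  refine ne_top_of_le_ne_top (h.lintegral_majRhs_ne_top hT) ?_
  refine setLIntegral_mono' measurableSet_Ioc fun t ht => ?_
  gcongr with i _ k
  refine enorm_rhs_le (fun j l => ?_) i k
  refine (h.enorm_modes_le hV _ _ _).trans_eq ?_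
  rw [max_eq_left ht.1.le]

/-- The equation of each mode in integrated form. -/
theorem StableData.modes_integrated (h : StableData m B U₀ β e₀ δ)
    (hV : ∀ i k, ‖V i k‖ₑ ≤ U₀ i k) (i : ι) (k : ℤ) {T : ℝ} (hT : 0 ≤ T) :
    modes m B V i k T = V i k + ∫ t in Ioc 0 T,
      (-(damping m B i k * modes m B V i k t) + rhs m B (fun j l => modes m B V j l t) i k) := by
  refine duhamel_integrated hT (fun t ht => h.modes_duhamel hV i k ht.1) ?_ ?_
  · refine ⟨(measurable_rhs (u := fun t j l => modes m B V j l t)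
      (fun i k => h.measurable_modes hV i k) i k).aestronglyMeasurable, ?_⟩
    refine lt_of_le_of_lt (lintegral_mono fun t => ?_) (h.lintegral_rhs_modes_ne_top hV hT).lt_top
    exact le_mass (fun i k => ‖rhs m B (fun j l => modes m B V j l t) i k‖ₑ) i k
  · refine ⟨(h.measurable_modes hV i k).aestronglyMeasurable, ?_⟩
    refine lt_of_le_of_lt (lintegral_mono (g := fun _ => (e₀ : ℝ≥0∞)) fun t =>
      (le_mass (fun i k => ‖modes m B V i k t‖ₑ) i k).trans (h.mass_modes_le hV t)) ?_
    simp [ENNReal.mul_lt_top]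

end Modes

/-! ### Classical derivatives and integration by parts on the torus -/

/-- `u'` is the classical derivative of `u` on the torus, in terms of the periodic lifts. -/
def HasDx (u u' : Torus → ℝ) : Prop :=
  ∀ a : ℝ, HasDerivAt (fun y : ℝ => u (y : Torus)) (u' (a : Torus)) a

theorem HasDx.dx_eq {u u' : Torus → ℝ} (h : HasDx u u') : dx u = u' := by
  funext x
  induction x using QuotientAddGroup.induction_on with
  | H a =>
    have h1 : HasDerivAt (fun y : ℝ => u ((a + y : ℝ) : Torus)) (u' (a : Torus)) 0 := by
      have h2 : HasDerivAt (fun y : ℝ => u (y : Torus)) (u' (a : Torus)) (a + 0) := by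
        simpa using h a
      exact h2.comp_const_add a 0
    exact h1.deriv

theorem continuous_of_lift {X : Type*} [TopologicalSpace X] {u : Torus → X}
    (h : Continuous fun y : ℝ => u (y : Torus)) : Continuous u :=
  (QuotientAddGroup.isQuotientMap_mk _).continuous_iff.2 h

theorem continuous_coe_torus : Continuous fun y : ℝ => (y : Torus) :=
  AddCircle.continuous_mk' _

theorem HasDx.continuous {u u' : Torus → ℝ} (h : HasDx u u') : Continuous u :=
  continuous_of_lift (continuous_iff_continuousAt.2 fun a => (h a).continuousAt)

theorem HasDx.isCn_one {u u' : Torus → ℝ} (h : HasDx u u') (hc : Continuous u') : IsCn 1 u := by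
  refine contDiff_one_iff_deriv.2 ⟨fun a => (h a).differentiableAt, ?_⟩
  rw [show deriv (fun y : ℝ => u (y : Torus)) = fun a : ℝ => u' (a : Torus) from
    funext fun a => (h a).deriv]
  exact hc.comp continuous_coe_torus

theorem hasDx_of_differentiable {φ : Torus → ℝ} (h : Differentiable ℝ fun y : ℝ => φ (y : Torus)) :
    HasDx φ (dx φ) := by
  have h1 : HasDx φ (fun x => dx φ x) := by
    intro a
    have h2 : HasDerivAt (fun y : ℝ => φ (y : Torus)) _ (a + 0) := (h (a + 0)).hasDerivAt
    have h3 := (h2.comp_const_add a 0).deriv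
    have h4 : dx φ (a : Torus) = deriv (fun y : ℝ => φ (y : Torus)) (a + 0) := h3
    simp only [h4, add_zero]
    exact (h a).hasDerivAt
  exact h1

theorem IsCn.hasDx {φ : Torus → ℝ} (h : IsCn 1 φ) : HasDx φ (dx φ) :=
  hasDx_of_differentiable (h.differentiable (by norm_num))

theorem IsCn.continuous_dx {φ : Torus → ℝ} (h : IsCn 1 φ) : Continuous (dx φ) := by
  refine continuous_of_lift ?_
  rw [show (fun y : ℝ => dx φ (y : Torus)) = deriv (fun y : ℝ => φ (y : Torus)) from
    funext fun a => (h.hasDx a).deriv.symm]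
  exact (contDiff_one_iff_deriv.1 h).2

theorem IsCn.of_infty {φ : Torus → ℝ} (h : IsCn ((⊤ : ℕ∞) : WithTop ℕ∞) φ) : IsCn 1 φ :=
  ContDiff.of_le h (by exact_mod_cast le_top)

theorem IsCn.dx_infty {φ : Torus → ℝ} (h : IsCn ((⊤ : ℕ∞) : WithTop ℕ∞) φ) :
    IsCn ((⊤ : ℕ∞) : WithTop ℕ∞) (dx φ) := by
  unfold IsCn
  rw [show (fun y : ℝ => dx φ (y : Torus)) = deriv (fun y : ℝ => φ (y : Torus)) from
    funext fun a => (h.of_infty.hasDx a).deriv.symm]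
  exact (contDiff_infty_iff_deriv.1 h).2

theorem integrable_of_continuous {u : Torus → ℝ} (h : Continuous u) : Integrable u volume :=
  h.integrable_of_hasCompactSupport (HasCompactSupport.of_compactSpace u)

/-- Integration by parts on the torus. -/
theorem HasDx.integral_mul {u u' v v' : Torus → ℝ} (hu : HasDx u u') (hv : HasDx v v')
    (hu' : Continuous u') (hv' : Continuous v') :
    ∫ x, u x * v' x = -∫ x, u' x * v x := by
  have h := intervalIntegral.integral_mul_deriv_eq_deriv_mul (a := 0) (b := 0 + 2 * Real.pi)
    (fun x _ => hu x) (fun x _ => hv x)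
    ((hu'.comp continuous_coe_torus).intervalIntegrable _ _)
    ((hv'.comp continuous_coe_torus).intervalIntegrable _ _)
  rw [← AddCircle.intervalIntegral_preimage (2 * Real.pi) 0 (fun x : Torus => u x * v' x),
    ← AddCircle.intervalIntegral_preimage (2 * Real.pi) 0 (fun x : Torus => u' x * v x), h]
  have : ((0 + 2 * Real.pi : ℝ) : Torus) = ((0 : ℝ) : Torus) := by
    rw [zero_add, AddCircle.coe_period]; rfl
  simp only [this]
  ring

theorem HasDx.mul {u u' v v' : Torus → ℝ} (hu : HasDx u u') (hv : HasDx v v') :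
    HasDx (fun x => u x * v x) (fun x => u' x * v x + u x * v' x) :=
  fun a => (hu a).mul (hv a)

theorem HasDx.hasWeakDeriv_one {u u' : Torus → ℝ} (hu : HasDx u u') (hu' : Continuous u') :
    HasWeakDeriv 1 u u' := by
  refine ⟨integrable_of_continuous hu.continuous, integrable_of_continuous hu', fun φ hφ => ?_⟩
  simpa using hu.integral_mul hφ.of_infty.hasDx hu' hφ.of_infty.continuous_dx

theorem HasDx.hasWeakDeriv_two {u u' u'' : Torus → ℝ} (hu : HasDx u u') (hu' : HasDx u' u'')
    (hu'' : Continuous u'') : HasWeakDeriv 2 u u'' := by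
  refine ⟨integrable_of_continuous hu.continuous, integrable_of_continuous hu'', fun φ hφ => ?_⟩
  have h1 := hu.integral_mul hφ.dx_infty.of_infty.hasDx hu'.continuous
    hφ.dx_infty.of_infty.continuous_dx
  have h2 := hu'.integral_mul hφ.of_infty.hasDx hu'' hφ.of_infty.continuous_dx
  simp only [Function.iterate_succ, Function.iterate_zero, Function.comp_apply, id]
  rw [h1, h2]; ring

/-! ### Absolutely convergent Fourier series -/

theorem fourier_coe (k : ℤ) (y : ℝ) :
    fourier k (y : Torus) = Complex.exp (Complex.I * (k * y : ℝ)) := by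
  rw [fourier_coe_apply]
  congr 1
  have : (Real.pi : ℂ) ≠ 0 := by exact_mod_cast Real.pi_ne_zero
  push_cast
  field_simp

theorem norm_fourier_apply (k : ℤ) (x : Torus) : ‖fourier k x‖ = 1 := by
  rw [fourier_apply]; exact Circle.norm_coe _

theorem enorm_fourier_apply (k : ℤ) (x : Torus) : ‖fourier k x‖ₑ = 1 := by
  rw [← ofReal_norm, norm_fourier_apply]; simp

/-- The Fourier series `∑ₖ cₖ e^{ikx}`. -/
def fourierSeries (c : ℤ → ℂ) (x : Torus) : ℂ := ∑' k, c k * fourier k x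

/-- The real part of the Fourier series with coefficients `c`. -/
def synth (c : ℤ → ℂ) (x : Torus) : ℝ := (fourierSeries c x).re

/-- The Fourier coefficients of the derivative. -/
def dCoeff (c : ℤ → ℂ) (k : ℤ) : ℂ := Complex.I * k * c k

/-- The Wiener norm `∑ₖ |cₖ|`. -/
def wNorm (c : ℤ → ℂ) : ℝ≥0∞ := ∑' k, ‖c k‖ₑ

theorem summable_norm_of_wNorm {c : ℤ → ℂ} (h : wNorm c ≠ ∞) : Summable fun k => ‖c k‖ :=
  tsum_enorm_ne_top_iff_summable_norm.1 h

theorem enorm_fourierSeries_le (c : ℤ → ℂ) (x : Torus) : ‖fourierSeries c x‖ₑ ≤ wNorm c := by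
  refine enorm_tsum_le_tsum_enorm.trans (ENNReal.tsum_le_tsum fun k => ?_)
  rw [enorm_mul, enorm_fourier_apply, mul_one]

theorem enorm_re_le (z : ℂ) : ‖z.re‖ₑ ≤ ‖z‖ₑ := by
  rw [← ofReal_norm, ← ofReal_norm]
  exact ENNReal.ofReal_le_ofReal (Complex.abs_re_le_norm z)

theorem enorm_synth_le (c : ℤ → ℂ) (x : Torus) : ‖synth c x‖ₑ ≤ wNorm c :=
  (enorm_re_le _).trans (enorm_fourierSeries_le c x)

theorem summable_fourierSeries {c : ℤ → ℂ} (h : wNorm c ≠ ∞) (x : Torus) :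
    Summable fun k => c k * fourier k x := by
  refine Summable.of_norm ?_
  simpa only [norm_mul, norm_fourier_apply, mul_one] using summable_norm_of_wNorm h

theorem continuous_fourierSeries {c : ℤ → ℂ} (h : wNorm c ≠ ∞) : Continuous (fourierSeries c) :=
  continuous_tsum (fun k => continuous_const.mul (fourier k).continuous)
    (summable_norm_of_wNorm h) fun k x => by
      rw [norm_mul, norm_fourier_apply, mul_one]

theorem continuous_synth {c : ℤ → ℂ} (h : wNorm c ≠ ∞) : Continuous (synth c) :=
  Complex.continuous_re.comp (continuous_fourierSeries h)

theorem hasDerivAt_fourierSeries {c : ℤ → ℂ} (h : wNorm c ≠ ∞) (h' : wNorm (dCoeff c) ≠ ∞)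
    (a : ℝ) : HasDerivAt (fun y : ℝ => fourierSeries c (y : Torus))
      (fourierSeries (dCoeff c) (a : Torus)) a := by
  refine hasDerivAt_tsum (𝕜 := ℝ) (u := fun k => ‖dCoeff c k‖) (summable_norm_of_wNorm h')
    (g := fun k y => c k * fourier k (y : Torus))
    (g' := fun k y => dCoeff c k * fourier k (y : Torus)) (fun k y => ?_) (fun k y => ?_)
    (y₀ := 0) (summable_fourierSeries h _) a
  · simp only [fourier_coe]
    have h1 : HasDerivAt (fun y : ℝ => (y : ℂ)) 1 y := Complex.ofRealCLM.hasDerivAt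
    have h2 := (((h1.const_mul (k : ℂ)).const_mul Complex.I).cexp).const_mul (c k)
    simp only [Complex.ofReal_mul, Complex.ofReal_intCast]
    exact h2.congr_deriv (by simp only [dCoeff, mul_one]; ring)
  · rw [norm_mul, norm_fourier_apply, mul_one]

theorem hasDx_synth {c : ℤ → ℂ} (h : wNorm c ≠ ∞) (h' : wNorm (dCoeff c) ≠ ∞) :
    HasDx (synth c) (synth (dCoeff c)) := fun a => by
  exact Complex.reCLM.hasFDerivAt.comp_hasDerivAt a (hasDerivAt_fourierSeries h h' a)

/-! ### Fourier coefficients -/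

theorem fourierCoeff_fourierSeries {c : ℤ → ℂ} (h : wNorm c ≠ ∞) (k : ℤ) :
    fourierCoeff (fourierSeries c) k = c k := by
  have h1 : fourierCoeff (fourierSeries c) k =
      ∑' l, ∫ x : Torus, fourier (-k) x • (c l * fourier l x) ∂AddCircle.haarAddCircle := by
    rw [← integral_tsum]
    · unfold fourierCoeff fourierSeries
      congr 1; funext x
      rw [(summable_fourierSeries h x).tsum_const_smul]
    · intro l
      exact Continuous.aestronglyMeasurable (by fun_prop)
    · simp only [smul_eq_mul, enorm_mul, enorm_fourier_apply, one_mul, mul_one, lintegral_const,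
        measure_univ]
      exact h
  have h2 : ∀ l, ∫ x : Torus, fourier (-k) x • (c l * fourier l x) ∂AddCircle.haarAddCircle =
      if l = k then c k else 0 := by
    intro l
    have := fourierCoeff.const_mul (T := 2 * Real.pi) (fourier l : Torus → ℂ) (c l) k
    unfold fourierCoeff at this
    rw [this]
    change c l * fourierCoeff (fourier l : Torus → ℂ) k = _
    rw [fourierCoeff_fourier, Pi.single_apply]
    by_cases hkl : l = k
    · subst hkl; simp
    · rw [if_neg (Ne.symm hkl), if_neg hkl, mul_zero]
  rw [h1]
  simp only [h2]
  exact tsum_ite_eq k (fun _ => c k)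

theorem tsum_comp_neg (f : ℤ → ℝ≥0∞) : ∑' k, f (-k) = ∑' k, f k := (Equiv.neg ℤ).tsum_eq f

open ComplexConjugate in
/-- The conjugate symmetric part of a sequence of Fourier coefficients. -/
def symmCoeff (c : ℤ → ℂ) (k : ℤ) : ℂ := (c k + conj (c (-k))) / 2

theorem enorm_conj (z : ℂ) : ‖(starRingEnd ℂ) z‖ₑ = ‖z‖ₑ := by
  rw [← ofReal_norm, RCLike.norm_conj, ofReal_norm]

theorem wNorm_symmCoeff_le (c : ℤ → ℂ) (w : ℤ → ℝ≥0∞) (hw : ∀ k, w (-k) = w k) :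
    ∑' k, w k * ‖symmCoeff c k‖ₑ ≤ ∑' k, w k * ‖c k‖ₑ := by
  have h1 : ∀ k, w k * ‖symmCoeff c k‖ₑ ≤ 2⁻¹ * (w k * ‖c k‖ₑ + w (-k) * ‖c (-k)‖ₑ) := by
    intro k
    rw [hw, ← mul_add, mul_left_comm]
    gcongr
    rw [symmCoeff, div_eq_inv_mul, enorm_mul]
    have : ‖(2⁻¹ : ℂ)‖ₑ = 2⁻¹ := by
      rw [enorm_inv (by norm_num), ← ofReal_norm]; simp
    rw [this]
    gcongr
    exact (enorm_add_le _ _).trans (by rw [enorm_conj])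
  refine (ENNReal.tsum_le_tsum h1).trans ?_
  rw [ENNReal.tsum_mul_left, ENNReal.tsum_add,
    tsum_comp_neg (fun k => w k * ‖c k‖ₑ), ← two_mul, ← mul_assoc,
    ENNReal.inv_mul_cancel (by norm_num) (by norm_num), one_mul]

theorem wNorm_symmCoeff (c : ℤ → ℂ) : wNorm (symmCoeff c) ≤ wNorm c := by
  simpa [wNorm] using wNorm_symmCoeff_le c (fun _ => 1) (fun _ => rfl)

open ComplexConjugate in
theorem conj_fourierSeries (c : ℤ → ℂ) (x : Torus) :
    conj (fourierSeries c x) = fourierSeries (fun k => conj (c (-k))) x := by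
  unfold fourierSeries
  rw [Complex.conj_tsum, ← (Equiv.neg ℤ).tsum_eq]
  refine tsum_congr fun k => ?_
  rw [Equiv.neg_apply, map_mul, fourier_neg, Complex.conj_conj]

theorem ofReal_synth {c : ℤ → ℂ} (h : wNorm c ≠ ∞) (x : Torus) :
    (synth c x : ℂ) = fourierSeries (symmCoeff c) x := by
  have h2 : wNorm (fun k => (starRingEnd ℂ) (c (-k))) ≠ ∞ := by
    unfold wNorm
    simp only [enorm_conj]
    rw [tsum_comp_neg (fun k => ‖c k‖ₑ)]
    exact h
  rw [synth, Complex.re_eq_add_conj, conj_fourierSeries]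
  unfold fourierSeries
  rw [← (summable_fourierSeries h x).tsum_add (summable_fourierSeries h2 x), ← tsum_div_const]
  refine tsum_congr fun k => ?_
  rw [symmCoeff]; ring

theorem ofReal_synth_of_conj {c : ℤ → ℂ} (hc : ∀ k, c (-k) = (starRingEnd ℂ) (c k)) (x : Torus) :
    (synth c x : ℂ) = fourierSeries c x := by
  have h : (starRingEnd ℂ) (fourierSeries c x) = fourierSeries c x := by
    rw [conj_fourierSeries]
    congr 1; funext k
    rw [hc, Complex.conj_conj]
  exact Complex.conj_eq_iff_re.1 h

theorem fourierHat_synth {c : ℤ → ℂ} (h : wNorm c ≠ ∞) (k : ℤ) :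
    fourierHat (synth c) k = symmCoeff c k := by
  unfold fourierHat
  simp only [ofReal_synth h]
  exact fourierCoeff_fourierSeries (ne_top_of_le_ne_top h (wNorm_symmCoeff c)) k

theorem fourierHat_zero (u : Torus → ℝ) : fourierHat u 0 = ((2 * Real.pi)⁻¹ * ∫ x, u x : ℝ) := by
  unfold fourierHat fourierCoeff
  rw [AddCircle.integral_haarAddCircle]
  simp only [neg_zero, fourier_zero, one_smul, integral_complex_ofReal]
  rw [Complex.real_smul]; push_cast; rfl

theorem integral_eq_zero_of_fourierHat {u : Torus → ℝ} (h : fourierHat u 0 = 0) : ∫ x, u x = 0 := by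
  rw [fourierHat_zero] at h
  have h1 : (2 * Real.pi)⁻¹ * ∫ x, u x = 0 := by exact_mod_cast h
  exact (mul_eq_zero.1 h1).resolve_left (by positivity)

theorem integrable_haar_iff {u : Torus → ℝ} :
    Integrable u AddCircle.haarAddCircle ↔ Integrable u volume := by
  rw [AddCircle.volume_eq_smul_haarAddCircle, integrable_smul_measure]
  · simp [Real.pi_pos]
  · exact ENNReal.ofReal_ne_top

theorem ae_haar_iff {p : Torus → Prop} :
    (∀ᵐ x ∂(AddCircle.haarAddCircle : Measure Torus), p x) ↔ ∀ᵐ x : Torus, p x := by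
  rw [AddCircle.volume_eq_smul_haarAddCircle,
    Measure.ae_ennreal_smul_measure_eq (by simp [Real.pi_pos])]

/-- An integrable function on the torus all of whose Fourier coefficients vanish is zero. -/
theorem ae_eq_zero_of_fourierHat {u : Torus → ℝ} (hu : Integrable u volume)
    (h : ∀ k, fourierHat u k = 0) : u =ᵐ[volume] 0 := by
  have hu' : Integrable u (AddCircle.haarAddCircle : Measure Torus) := integrable_haar_iff.2 hu
  have hmul : ∀ g : C(Torus, ℂ),
      Integrable (fun x => g x * (u x : ℂ)) (AddCircle.haarAddCircle : Measure Torus) := by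
    intro g
    exact hu'.ofReal.bdd_mul (c := ‖g‖) g.continuous.aestronglyMeasurable
      (ae_of_all _ fun x => g.norm_coe_le_norm x)
  have hC : ∀ g : C(Torus, ℂ), ∫ x, g x * (u x : ℂ) ∂AddCircle.haarAddCircle = 0 := by
    let L : C(Torus, ℂ) →L[ℂ] ℂ := LinearMap.mkContinuous
      { toFun := fun g => ∫ x, g x * (u x : ℂ) ∂AddCircle.haarAddCircle
        map_add' := fun a b => by
          rw [← integral_add (hmul a) (hmul b)]
          simp [add_mul]
        map_smul' := fun c a => by
          simp only [RingHom.id_apply, smul_eq_mul]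
          rw [← integral_const_mul]
          simp [mul_assoc] }
      (∫ x, ‖u x‖ ∂AddCircle.haarAddCircle) fun g => by
        refine (norm_integral_le_of_norm_le (hu'.norm.mul_const ‖g‖)
          (ae_of_all _ fun x => ?_)).trans_eq (integral_mul_const _ _)
        rw [norm_mul, Complex.norm_real, mul_comm]
        gcongr
        exact g.norm_coe_le_norm x
    -- `g ↦ ∫ g u` is continuous for the sup norm and vanishes on trigonometric polynomials, which
    -- are dense.
    have hle : Submodule.span ℂ (Set.range (fourier (T := 2 * Real.pi))) ≤ L.ker := by
      rw [Submodule.span_le]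
      rintro _ ⟨k, rfl⟩
      have := h (-k)
      unfold fourierHat fourierCoeff at this
      rw [neg_neg] at this
      exact this
    have htop : (⊤ : Submodule ℂ C(Torus, ℂ)) ≤ L.ker := by
      rw [← span_fourier_closure_eq_top]
      exact Submodule.topologicalClosure_minimal _ hle L.isClosed_ker
    exact fun g => htop (Submodule.mem_top (x := g))
  have hR : ∀ f : BoundedContinuousFunction Torus ℝ,
      ∫ x, u x * f x ∂AddCircle.haarAddCircle = 0 := by
    intro f
    have := hC ⟨fun x => (f x : ℂ), by fun_prop⟩
    simp only [ContinuousMap.coe_mk, ← Complex.ofReal_mul, integral_complex_ofReal] at this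
    simpa only [mul_comm] using (by exact_mod_cast this :
      ∫ x, f x * u x ∂AddCircle.haarAddCircle = 0)
  have hb : ∀ f : BoundedContinuousFunction Torus ℝ, ∀ v : Torus → ℝ,
      Integrable v (AddCircle.haarAddCircle : Measure Torus) →
      Integrable (fun x => v x * f x) (AddCircle.haarAddCircle : Measure Torus) := fun f v hv =>
    hv.mul_bdd (c := ‖f‖) f.continuous.aestronglyMeasurable
      (ae_of_all _ fun x => f.norm_coe_le_norm x)
  have hm := hu'.aestronglyMeasurable.aemeasurable
  have := isFiniteMeasure_withDensity_ofReal hu'.2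
  have := isFiniteMeasure_withDensity_ofReal hu'.neg.2
  -- The finite measures with densities `u⁺` and `u⁻` have the same integrals of continuous
  -- functions.
  have hμ : (AddCircle.haarAddCircle : Measure Torus).withDensity (fun x => ENNReal.ofReal (u x)) =
      (AddCircle.haarAddCircle : Measure Torus).withDensity (fun x => ENNReal.ofReal ((-u) x)) := by
    refine ext_of_forall_integral_eq_of_IsFiniteMeasure fun f => ?_
    rw [integral_withDensity_eq_integral_toReal_smul₀ hm.ennreal_ofReal
        (ae_of_all _ fun _ => ENNReal.ofReal_lt_top),
      integral_withDensity_eq_integral_toReal_smul₀ hm.neg.ennreal_ofReal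
        (ae_of_all _ fun _ => ENNReal.ofReal_lt_top), ← sub_eq_zero]
    simp only [ENNReal.toReal_ofReal', smul_eq_mul, Pi.neg_apply]
    rw [← integral_sub (hb f _ hu'.pos_part) (hb f _ hu'.neg_part)]
    refine Eq.trans ?_ (hR f)
    congr 1; funext x
    rw [← sub_mul]
    congr 1
    rcases le_total (u x) 0 with hx | hx
    · rw [max_eq_right hx, max_eq_left (by linarith)]; ring
    · rw [max_eq_left hx, max_eq_right (by linarith)]; ring
  have hae := (withDensity_eq_iff hm.ennreal_ofReal hm.neg.ennreal_ofReal
    ((lintegral_mono fun x => Real.ofReal_le_enorm (u x)).trans_lt hu'.2).ne).1 hμ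
  refine ae_haar_iff.1 ?_
  filter_upwards [hae] with x hx
  simp only [Pi.zero_apply]
  rcases le_total (u x) 0 with h0 | h0
  · rw [ENNReal.ofReal_eq_zero.2 h0] at hx
    have := ENNReal.ofReal_eq_zero.1 hx.symm
    simp only [Pi.neg_apply] at this
    linarith
  · rw [ENNReal.ofReal_eq_zero.2 (by simpa using h0 : (-u) x ≤ 0)] at hx
    exact le_antisymm (ENNReal.ofReal_eq_zero.1 hx) h0

theorem fourierHat_sub {u v : Torus → ℝ} (hu : Integrable u volume) (hv : Integrable v volume)
    (k : ℤ) : fourierHat (fun x => u x - v x) k = fourierHat u k - fourierHat v k := by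
  unfold fourierHat fourierCoeff
  rw [← integral_sub]
  · congr 1; funext x; push_cast; rw [smul_sub]
  · exact (integrable_haar_iff.2 hu).ofReal.fourier_smul _
  · exact (integrable_haar_iff.2 hv).ofReal.fourier_smul _

open ComplexConjugate in
theorem fourierHat_neg (u : Torus → ℝ) (k : ℤ) : fourierHat u (-k) = conj (fourierHat u k) := by
  unfold fourierHat fourierCoeff
  rw [← integral_conj]
  congr 1; funext x
  simp only [smul_eq_mul, map_mul, Complex.conj_ofReal, ← fourier_neg]

theorem symmCoeff_of_conj {c : ℤ → ℂ} (hc : ∀ k, c (-k) = (starRingEnd ℂ) (c k)) :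
    symmCoeff c = c := by
  funext k
  rw [symmCoeff, hc, Complex.conj_conj]; ring

/-- An integrable function with absolutely summable Fourier coefficients is almost everywhere the
sum of its Fourier series. -/
theorem ae_eq_synth {u : Torus → ℝ} (hu : Integrable u volume) (h : wNorm (fourierHat u) ≠ ∞) :
    u =ᵐ[volume] synth (fourierHat u) := by
  have h1 := ae_eq_zero_of_fourierHat
    (hu.sub (integrable_of_continuous (continuous_synth h))) fun k => by
      have := fourierHat_sub hu (integrable_of_continuous (continuous_synth h)) k
      rw [fourierHat_synth h, symmCoeff_of_conj (fourierHat_neg u), sub_self] at this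
      exact this
  filter_upwards [h1] with x hx
  exact sub_eq_zero.1 hx

/-! ### Norms of absolutely convergent Fourier series -/

/-- The norm `∑ₖ |k|² |cₖ|`. -/
def dNorm (c : ℤ → ℂ) : ℝ≥0∞ := dissip fun k => ‖c k‖ₑ

theorem wNorm_dCoeff (c : ℤ → ℂ) : wNorm (dCoeff c) = ∑' k : ℤ, (k.natAbs : ℝ≥0∞) * ‖c k‖ₑ :=
  tsum_congr fun k => enorm_I_mul_intCast k (c k)

theorem wNorm_dCoeff_dCoeff (c : ℤ → ℂ) : wNorm (dCoeff (dCoeff c)) = dNorm c := by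
  rw [wNorm_dCoeff]
  refine tsum_congr fun k => ?_
  rw [dCoeff, enorm_I_mul_intCast, ← mul_assoc, sq]

theorem wNorm_le_wNorm_dCoeff {c : ℤ → ℂ} (h : c 0 = 0) : wNorm c ≤ wNorm (dCoeff c) := by
  rw [wNorm_dCoeff]
  refine ENNReal.tsum_le_tsum fun k => ?_
  rcases eq_or_ne k 0 with rfl | hk
  · simp [h]
  · have : (1 : ℝ≥0∞) ≤ (k.natAbs : ℝ≥0∞) := by exact_mod_cast Int.natAbs_pos.2 hk
    calc ‖c k‖ₑ = 1 * ‖c k‖ₑ := (one_mul _).symm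
      _ ≤ _ := by gcongr

theorem wNorm_dCoeff_le_dNorm (c : ℤ → ℂ) : wNorm (dCoeff c) ≤ dNorm c := by
  rw [← wNorm_dCoeff_dCoeff]
  refine wNorm_le_wNorm_dCoeff (by simp [dCoeff])

theorem wNorm_le_dNorm {c : ℤ → ℂ} (h : c 0 = 0) : wNorm c ≤ dNorm c :=
  (wNorm_le_wNorm_dCoeff h).trans (wNorm_dCoeff_le_dNorm c)

/-- The interpolation inequality `‖u‖²_{Ȧ¹} ≤ ‖u‖_{Ȧ⁰} ‖u‖_{Ȧ²}`. -/
theorem wNorm_dCoeff_sq_le (c : ℤ → ℂ) : wNorm (dCoeff c) ^ 2 ≤ wNorm c * dNorm c := by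
  have key : 2 * wNorm (dCoeff c) ^ 2 ≤ 2 * (wNorm c * dNorm c) := by
    have e1 : wNorm (dCoeff c) ^ 2 =
        ∑' k : ℤ, ∑' l : ℤ, (k.natAbs * ‖c k‖ₑ) * (l.natAbs * ‖c l‖ₑ) := by
      simp only [ENNReal.tsum_mul_left, ENNReal.tsum_mul_right, ← wNorm_dCoeff, sq]
    have e2 : 2 * (wNorm c * dNorm c) = ∑' k : ℤ, ∑' l : ℤ,
        (‖c k‖ₑ * ((l.natAbs : ℝ≥0∞) ^ 2 * ‖c l‖ₑ) + (k.natAbs : ℝ≥0∞) ^ 2 * ‖c k‖ₑ * ‖c l‖ₑ) := by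
      simp only [ENNReal.tsum_add, ENNReal.tsum_mul_left, ENNReal.tsum_mul_right]
      simp only [wNorm, dNorm, dissip]
      ring
    rw [e1, e2, ← ENNReal.tsum_mul_left]
    refine ENNReal.tsum_le_tsum fun k => ?_
    rw [← ENNReal.tsum_mul_left]
    refine ENNReal.tsum_le_tsum fun l => ?_
    have h1 : (2 * k.natAbs * l.natAbs : ℝ≥0∞) ≤ k.natAbs ^ 2 + l.natAbs ^ 2 := by
      exact_mod_cast two_mul_le_add_sq k.natAbs l.natAbs
    calc _ = (2 * k.natAbs * l.natAbs : ℝ≥0∞) * (‖c k‖ₑ * ‖c l‖ₑ) := by ring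
      _ ≤ (k.natAbs ^ 2 + l.natAbs ^ 2) * (‖c k‖ₑ * ‖c l‖ₑ) := by gcongr
      _ = _ := by ring
  exact (ENNReal.mul_le_mul_iff_right (by norm_num) (by norm_num)).1 key

/-- The torus has measure `2π`, between `1` and `8`. -/
theorem eLpNorm_le_of_bound {u : Torus → ℝ} {C : ℝ≥0∞} (h : ∀ x, ‖u x‖ₑ ≤ C) {p : ℝ≥0∞}
    (hp : 1 ≤ p) : eLpNorm u p volume ≤ 8 * C := by
  refine (eLpNorm_le_of_ae_enorm_bound (ae_of_all _ h)).trans ?_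
  rw [smul_eq_mul, mul_comm]
  gcongr
  have hv : volume (univ : Set Torus) = ENNReal.ofReal (2 * Real.pi) :=
    AddCircle.measure_univ (2 * Real.pi)
  have h1 : (1 : ℝ≥0∞) ≤ volume (univ : Set Torus) := by
    rw [hv, ENNReal.one_le_ofReal]; linarith [Real.pi_gt_three]
  have h8 : volume (univ : Set Torus) ≤ 8 := by
    rw [hv]
    exact (ENNReal.ofReal_le_ofReal (by linarith [Real.pi_lt_four] : 2 * Real.pi ≤ 8)).trans_eq
      (by norm_num)
  have hp1 : p.toReal⁻¹ ≤ 1 := by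
    rcases eq_or_ne p ∞ with rfl | hp'
    · simp
    · exact inv_le_one_of_one_le₀ (by simpa using ENNReal.toReal_mono hp' hp)
  calc _ ≤ volume (univ : Set Torus) ^ (1 : ℝ) := ENNReal.rpow_le_rpow_of_exponent_le h1 hp1
    _ ≤ 8 := by simpa using h8

variable {c : ℤ → ℂ}

theorem wNorm_ne_top (h₀ : c 0 = 0) (h : dNorm c ≠ ∞) : wNorm c ≠ ∞ :=
  ne_top_of_le_ne_top h (wNorm_le_dNorm h₀)

theorem wNorm_dCoeff_ne_top (h : dNorm c ≠ ∞) : wNorm (dCoeff c) ≠ ∞ :=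
  ne_top_of_le_ne_top h (wNorm_dCoeff_le_dNorm c)

theorem sobolevNorm_one_synth_le (h₀ : c 0 = 0) (h : wNorm (dCoeff c) ≠ ∞) {p : ℝ≥0∞}
    (hp : 1 ≤ p) : sobolevNorm 1 p (synth c) ≤ 16 * wNorm (dCoeff c) := by
  have hw : wNorm c ≠ ∞ := ne_top_of_le_ne_top h (wNorm_le_wNorm_dCoeff h₀)
  unfold sobolevNorm
  refine (iInf₂_le (synth (dCoeff c))
    ((hasDx_synth hw h).hasWeakDeriv_one (continuous_synth h))).trans ?_
  calc _ ≤ 8 * wNorm c + 8 * wNorm (dCoeff c) :=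
        add_le_add (eLpNorm_le_of_bound (enorm_synth_le c) hp)
          (eLpNorm_le_of_bound (enorm_synth_le _) hp)
    _ ≤ 8 * wNorm (dCoeff c) + 8 * wNorm (dCoeff c) := by
        gcongr; exact wNorm_le_wNorm_dCoeff h₀
    _ = _ := by ring

theorem sobolevNorm_two_synth_le (h₀ : c 0 = 0) (h : dNorm c ≠ ∞) :
    sobolevNorm 2 ∞ (synth c) ≤ 16 * dNorm c := by
  have h1 := wNorm_dCoeff_ne_top h
  have h2 : wNorm (dCoeff (dCoeff c)) ≠ ∞ := by rwa [wNorm_dCoeff_dCoeff]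
  unfold sobolevNorm
  refine (iInf₂_le (synth (dCoeff (dCoeff c)))
    ((hasDx_synth (wNorm_ne_top h₀ h) h1).hasWeakDeriv_two (hasDx_synth h1 h2)
      (continuous_synth h2))).trans ?_
  calc _ ≤ 8 * wNorm c + 8 * wNorm (dCoeff (dCoeff c)) :=
        add_le_add (eLpNorm_le_of_bound (enorm_synth_le c) le_top)
          (eLpNorm_le_of_bound (enorm_synth_le _) le_top)
    _ ≤ 8 * dNorm c + 8 * dNorm c := by
        rw [wNorm_dCoeff_dCoeff]; gcongr; exact wNorm_le_dNorm h₀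
    _ = _ := by ring

theorem ofReal_abs_rpow_two (k : ℤ) :
    ENNReal.ofReal (|(k : ℝ)| ^ (2 : ℝ)) = (k.natAbs : ℝ≥0∞) ^ 2 := by
  rw [Real.rpow_two, ENNReal.ofReal_pow (abs_nonneg _), ← Int.cast_abs, ← Nat.cast_natAbs,
    ENNReal.ofReal_natCast]

theorem synth_zero_mean (h₀ : c 0 = 0) (h : wNorm c ≠ ∞) : ∫ x, synth c x = 0 := by
  refine integral_eq_zero_of_fourierHat ?_
  rw [fourierHat_synth h, symmCoeff, neg_zero, h₀]; simp

theorem memLp_synth (h : wNorm c ≠ ∞) (p : ℝ≥0∞) : MemLp (synth c) p volume :=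
  (continuous_synth h).memLp_of_hasCompactSupport (HasCompactSupport.of_compactSpace _)

theorem hDotNorm_one_synth_le (h₀ : c 0 = 0) (h : wNorm (dCoeff c) ≠ ∞) :
    hDotNorm 1 (synth c) ≤ wNorm (dCoeff c) := by
  have hw : wNorm c ≠ ∞ := ne_top_of_le_ne_top h (wNorm_le_wNorm_dCoeff h₀)
  unfold hDotNorm
  refine (iInf_le _ ⟨memLp_synth hw 2, synth_zero_mean h₀ hw⟩).trans ?_
  simp only [fourierHat_synth hw, mul_one, ofReal_abs_rpow_two]
  have h1 : ∑' k : ℤ, (k.natAbs : ℝ≥0∞) ^ 2 * ‖symmCoeff c k‖ₑ ^ 2 ≤ wNorm (dCoeff c) ^ 2 := by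
    calc ∑' k : ℤ, (k.natAbs : ℝ≥0∞) ^ 2 * ‖symmCoeff c k‖ₑ ^ 2
        = ∑' k : ℤ, (k.natAbs * ‖symmCoeff c k‖ₑ) * (k.natAbs * ‖symmCoeff c k‖ₑ) :=
          tsum_congr fun k => by ring
      _ ≤ ∑' k : ℤ, (k.natAbs * ‖symmCoeff c k‖ₑ) * ∑' l : ℤ, (l.natAbs * ‖symmCoeff c l‖ₑ) := by
          gcongr with k
          exact ENNReal.le_tsum (f := fun l : ℤ => (l.natAbs : ℝ≥0∞) * ‖symmCoeff c l‖ₑ) k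
      _ ≤ _ := by
          rw [ENNReal.tsum_mul_right, ← sq, wNorm_dCoeff]
          gcongr 1
          exact wNorm_symmCoeff_le c (fun k => (k.natAbs : ℝ≥0∞)) (fun k => by simp)
  calc _ ≤ (wNorm (dCoeff c) ^ 2) ^ (1 / 2 : ℝ) := ENNReal.rpow_le_rpow h1 (by norm_num)
    _ = _ := by rw [← ENNReal.rpow_natCast, ← ENNReal.rpow_mul]; norm_num

theorem exists_coe_eq_abs_eq_norm (z : Torus) : ∃ a : ℝ, (a : Torus) = z ∧ |a| = ‖z‖ := by
  induction z using QuotientAddGroup.induction_on with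
  | H x =>
    refine ⟨x - round ((2 * Real.pi)⁻¹ * x) * (2 * Real.pi), ?_, (AddCircle.norm_eq _).symm⟩
    rw [AddCircle.coe_sub]
    have : ((round ((2 * Real.pi)⁻¹ * x) * (2 * Real.pi) : ℝ) : Torus) = 0 := by
      rw [← zsmul_eq_mul, AddCircle.coe_zsmul, AddCircle.coe_period, smul_zero]
    rw [this, sub_zero]

theorem enorm_fourier_sub_le (k : ℤ) (x y : Torus) :
    ‖fourier k x - fourier k y‖ₑ ≤ k.natAbs * edist x y := by
  obtain ⟨a, ha, hn⟩ := exists_coe_eq_abs_eq_norm (x - y)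
  have h1 : fourier k x = fourier k y * fourier k (a : Torus) := by
    rw [show x = y + (a : Torus) by rw [ha]; abel, fourier_apply, fourier_apply, fourier_apply,
      ← Circle.coe_mul, ← AddCircle.toCircle_add, ← smul_add]
  have h2 : fourier k x - fourier k y = fourier k y * (fourier k (a : Torus) - 1) := by
    rw [h1]; ring
  rw [h2, enorm_mul, enorm_fourier_apply, one_mul, fourier_coe, edist_eq_enorm_sub]
  refine (Real.enorm_exp_I_mul_ofReal_sub_one_le).trans_eq ?_
  rw [enorm_mul]
  congr 1
  · have := enorm_intCast k
    rw [← ofReal_norm] at this ⊢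
    rw [← this]; simp
  · rw [← ofReal_norm, ← ofReal_norm, ← hn, Real.norm_eq_abs]

theorem edist_synth_le (h : wNorm c ≠ ∞) (x y : Torus) :
    edist (synth c x) (synth c y) ≤ wNorm (dCoeff c) * edist x y := by
  rw [edist_eq_enorm_sub]
  have h1 : synth c x - synth c y = (fourierSeries c x - fourierSeries c y).re := by
    simp [synth]
  rw [h1]
  refine (enorm_re_le _).trans ?_
  unfold fourierSeries
  rw [← (summable_fourierSeries h x).tsum_sub (summable_fourierSeries h y), wNorm_dCoeff,
    ← ENNReal.tsum_mul_right]
  refine enorm_tsum_le_tsum_enorm.trans (ENNReal.tsum_le_tsum fun k => ?_)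
  rw [← mul_sub, enorm_mul, mul_comm (k.natAbs : ℝ≥0∞), mul_assoc]
  gcongr
  exact enorm_fourier_sub_le k x y

theorem edist_torus_le (x y : Torus) : edist x y ≤ 4 := by
  rw [edist_eq_enorm_sub, ← ofReal_norm]
  have h1 := AddCircle.norm_le_half_period (2 * Real.pi) (x := x - y) (by positivity)
  have h2 : ‖x - y‖ ≤ 4 := by
    rw [abs_of_pos Real.two_pi_pos] at h1
    linarith [Real.pi_lt_four]
  calc ENNReal.ofReal ‖x - y‖ ≤ ENNReal.ofReal 4 := ENNReal.ofReal_le_ofReal h2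
    _ = 4 := by norm_num

/-- The torus has diameter at most `4`, so that Lipschitz functions are Hölder continuous. -/
theorem edist_torus_le_rpow (x y : Torus) {α : ℝ≥0} (hα : α ≤ 1) :
    edist x y ≤ 4 * edist x y ^ (α : ℝ) := by
  have hα' : (0 : ℝ) ≤ 1 - α := sub_nonneg.2 (by exact_mod_cast hα)
  calc edist x y = edist x y ^ ((1 - α : ℝ) + α) := by simp
    _ = edist x y ^ (1 - α : ℝ) * edist x y ^ (α : ℝ) :=
        ENNReal.rpow_add_of_nonneg _ _ hα' α.coe_nonneg
    _ ≤ 4 ^ (1 - α : ℝ) * edist x y ^ (α : ℝ) := by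
        gcongr; exact edist_torus_le x y
    _ ≤ 4 ^ (1 : ℝ) * edist x y ^ (α : ℝ) := by
        gcongr
        · norm_num
        · simp
    _ = _ := by simp

theorem c1HolderNorm_synth_le (h₀ : c 0 = 0) (h : dNorm c ≠ ∞) {α : ℝ≥0} (hα : α ≤ 1) :
    c1HolderNorm α (synth c) ≤ 16 * dNorm c := by
  have hw := wNorm_ne_top h₀ h
  have h1 := wNorm_dCoeff_ne_top h
  have hdx := hasDx_synth hw h1
  unfold c1HolderNorm
  refine (iInf_le _ (hdx.isCn_one (continuous_synth h1))).trans ?_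
  rw [hdx.dx_eq]
  have hH : HolderWith (4 * dNorm c).toNNReal α (synth (dCoeff c)) := by
    intro x y
    rw [ENNReal.coe_toNNReal (ENNReal.mul_ne_top (by norm_num) h)]
    refine (edist_synth_le h1 x y).trans ?_
    rw [wNorm_dCoeff_dCoeff, mul_comm 4, mul_assoc]
    gcongr
    exact edist_torus_le_rpow x y hα
  calc _ ≤ dNorm c + dNorm c + 4 * dNorm c := by
        refine add_le_add (add_le_add ?_ ?_) ?_
        · exact iSup_le fun x => (enorm_synth_le c x).trans (wNorm_le_dNorm h₀)
        · exact iSup_le fun x => (enorm_synth_le _ x).trans (wNorm_dCoeff_le_dNorm c)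
        · refine hH.eHolderNorm_le.trans_eq ?_
          rw [ENNReal.coe_toNNReal (ENNReal.mul_ne_top (by norm_num) h)]
    _ = 6 * dNorm c := by ring
    _ ≤ _ := by gcongr; norm_num

/-! ### Time dependent Fourier series -/

/-- Fourier coefficients of a zero mean function in `L^∞(Ȧ⁰) ∩ L^1_loc(Ȧ²)`, the supremum being at
most `e₀`. -/
structure WienerPath (c : ℝ → ℤ → ℂ) (e₀ : ℝ≥0) : Prop where
  meas : ∀ k, Measurable fun t => c t k
  zero : ∀ t, c t 0 = 0
  bound : ∀ t, wNorm (c t) ≤ e₀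
  integrable : ∀ T, ∫⁻ t in Ioc 0 T, dNorm (c t) ≠ ∞

theorem measurable_dNorm {c : ℝ → ℤ → ℂ} (h : ∀ k, Measurable fun t => c t k) :
    Measurable fun t => dNorm (c t) := measurable_dissip fun k => (h k).enorm

theorem measurable_fourierSeries_path {c : ℝ → ℤ → ℂ} (h : ∀ k, Measurable fun t => c t k) :
    Measurable fun p : ℝ × Torus => fourierSeries (c p.1) p.2 := by
  unfold fourierSeries
  exact Measurable.tsum fun k => ((h k).comp measurable_fst).mul
    ((fourier k).continuous.measurable.comp measurable_snd)

theorem measurable_synth_path {c : ℝ → ℤ → ℂ} (h : ∀ k, Measurable fun t => c t k) :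
    Measurable fun p : ℝ × Torus => synth (c p.1) p.2 :=
  Complex.measurable_re.comp (measurable_fourierSeries_path h)

theorem synth_sub {c d : ℤ → ℂ} (hc : wNorm c ≠ ∞) (hd : wNorm d ≠ ∞) :
    synth c - synth d = synth (fun k => c k - d k) := by
  funext x
  simp only [Pi.sub_apply, synth, ← Complex.sub_re, fourierSeries, sub_mul]
  rw [(summable_fourierSeries hc x).tsum_sub (summable_fourierSeries hd x)]

/-- A simple function of time with values in trigonometric polynomials. -/
def trigApprox {c : ℝ → ℤ → ℂ} (h : ∀ k, Measurable fun t => c t k) (n : ℕ) :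
    SimpleFunc ℝ (ℤ → ℂ) :=
  ∑ k ∈ Finset.Icc (-n : ℤ) n,
    (SimpleFunc.approxOn (fun t => c t k) (h k) univ 0 (mem_univ _) n).map
      (fun z => (Pi.single k z : ℤ → ℂ))

theorem trigApprox_apply {c : ℝ → ℤ → ℂ} (h : ∀ k, Measurable fun t => c t k) (n : ℕ) (t : ℝ)
    (l : ℤ) : trigApprox h n t l = if l ∈ Finset.Icc (-n : ℤ) n then
      SimpleFunc.approxOn (fun t => c t l) (h l) univ 0 (mem_univ _) n t else 0 := by
  have h1 : trigApprox h n t = ∑ k ∈ Finset.Icc (-n : ℤ) n,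
      (Pi.single k (SimpleFunc.approxOn (fun t => c t k) (h k) univ 0 (mem_univ _) n t) :
        ℤ → ℂ) := by
    unfold trigApprox
    induction Finset.Icc (-n : ℤ) n using Finset.induction_on with
    | empty => rfl
    | insert a s ha ih =>
      rw [Finset.sum_insert ha, Finset.sum_insert ha, SimpleFunc.add_apply, ih]
      rfl
  rw [h1, Finset.sum_apply]
  simp only [Pi.single_apply, Finset.sum_ite_eq]

/-- The simple functions approximate starting from `0`, hence stay within `‖c t l‖` of `c t l`. -/
theorem trigApprox_enorm_le {c : ℝ → ℤ → ℂ} (h : ∀ k, Measurable fun t => c t k) (n : ℕ) (t : ℝ)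
    (l : ℤ) : ‖trigApprox h n t l‖ₑ ≤ 2 * ‖c t l‖ₑ := by
  rw [trigApprox_apply]
  split_ifs
  · have := SimpleFunc.norm_approxOn_zero_le (h l) (s := univ) (mem_univ _) t n
    rw [← two_mul] at this
    rw [← ofReal_norm, ← ofReal_norm]
    calc _ ≤ ENNReal.ofReal (2 * ‖c t l‖) := ENNReal.ofReal_le_ofReal this
      _ = _ := by rw [ENNReal.ofReal_mul (by norm_num)]; norm_num
  · simp

theorem tendsto_trigApprox {c : ℝ → ℤ → ℂ} (h : ∀ k, Measurable fun t => c t k) (t : ℝ) (l : ℤ) :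
    Tendsto (fun n => trigApprox h n t l) atTop (𝓝 (c t l)) := by
  have h1 := SimpleFunc.tendsto_approxOn (h l) (mem_univ (0 : ℂ)) (x := t) (by simp)
  refine h1.congr' ?_
  filter_upwards [eventually_ge_atTop l.natAbs] with n hn
  rw [trigApprox_apply, if_pos]
  rw [Finset.mem_Icc]; omega

theorem dNorm_trigApprox_ne_top {c : ℝ → ℤ → ℂ} (h : ∀ k, Measurable fun t => c t k) (n : ℕ)
    (t : ℝ) : dNorm (trigApprox h n t) ≠ ∞ := by
  unfold dNorm dissip
  rw [tsum_eq_sum (s := Finset.Icc (-n : ℤ) n)]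
  · refine (ENNReal.sum_lt_top.2 fun k _ => ENNReal.mul_lt_top ?_ ENNReal.coe_lt_top).ne
    exact_mod_cast ENNReal.coe_lt_top
  · intro k hk
    simp only
    rw [trigApprox_apply, if_neg hk]; simp

/-- Dominated convergence for the sum over the modes. -/
theorem tendsto_dNorm_trigApprox {c : ℝ → ℤ → ℂ} (h : ∀ k, Measurable fun t => c t k) {t : ℝ}
    (ht : dNorm (c t) ≠ ∞) :
    Tendsto (fun n => dNorm fun k => c t k - trigApprox h n t k) atTop (𝓝 0) := by
  have h1 : ∀ b : ℤ → ℝ≥0∞, ∑' k, b k = ∫⁻ k, b k ∂Measure.count := fun b =>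
    (lintegral_count b).symm
  unfold dNorm dissip at ht ⊢
  simp only [h1] at ht ⊢
  have h2 := tendsto_lintegral_of_dominated_convergence
    (μ := (Measure.count : Measure ℤ))
    (F := fun n (k : ℤ) => (k.natAbs : ℝ≥0∞) ^ 2 * ‖c t k - trigApprox h n t k‖ₑ)
    (f := fun _ => 0) (fun k : ℤ => 3 * ((k.natAbs : ℝ≥0∞) ^ 2 * ‖c t k‖ₑ))
    (fun n => measurable_of_countable _) (fun n => ae_of_all _ fun k => ?_) ?_
    (ae_of_all _ fun k => ?_)
  · simpa using h2
  · simp only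
    rw [mul_left_comm]
    gcongr
    refine (enorm_sub_le).trans ((add_le_add_right (trigApprox_enorm_le h n t k) _).trans_eq ?_)
    ring
  · rw [lintegral_const_mul _ (measurable_of_countable _)]
    exact ENNReal.mul_ne_top (by norm_num) ht
  · have h3 : Tendsto (fun n => ‖c t k - trigApprox h n t k‖ₑ) atTop (𝓝 0) := by
      have := ((tendsto_trigApprox h t k).const_sub (c t k)).enorm
      simpa using this
    have h4 := ENNReal.Tendsto.const_mul h3 (a := (k.natAbs : ℝ≥0∞) ^ 2)
      (Or.inr (by exact_mod_cast ENNReal.coe_ne_top))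
    simpa using h4

section

variable {c : ℝ → ℤ → ℂ} {e₀ : ℝ≥0}

theorem WienerPath.wNorm_ne_top (h : WienerPath c e₀) (t : ℝ) : wNorm (c t) ≠ ∞ :=
  ne_top_of_le_ne_top ENNReal.coe_ne_top (h.bound t)

theorem WienerPath.ae_dNorm_ne_top (h : WienerPath c e₀) (T : ℝ) :
    ∀ᵐ t ∂(volume.restrict (Ioo 0 T)), dNorm (c t) ≠ ∞ := by
  have := ae_lt_top (measurable_dNorm h.meas) (h.integrable T)
  filter_upwards [ae_restrict_of_ae_restrict_of_subset Ioo_subset_Ioc_self this] with t ht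
  exact ht.ne

/-- Membership in a Bochner space of functions of time with values in a space whose norm is
dominated by the one of `Ȧ²`. -/
theorem WienerPath.memBochner (h : WienerPath c e₀) {N : (Torus → ℝ) → ℝ≥0∞} {C : ℝ≥0}
    (hN : ∀ d : ℤ → ℂ, d 0 = 0 → dNorm d ≠ ∞ → N (synth d) ≤ C * dNorm d) {p T : ℝ}
    (hp : ∫⁻ t in Ioo 0 T, N (synth (c t)) ^ p < ∞) :
    MemBochner p T N (fun t => synth (c t)) := by
  have hz : ∀ n t, trigApprox h.meas n t 0 = 0 := by
    intro n t
    have := trigApprox_enorm_le h.meas n t 0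
    rw [h.zero] at this
    simpa using this
  refine ⟨⟨fun n => (trigApprox h.meas n).map synth, fun n t => ?_, ?_⟩, hp⟩
  · exact (hN _ (hz n t) (dNorm_trigApprox_ne_top h.meas n t)).trans_lt
      (ENNReal.mul_lt_top ENNReal.coe_lt_top (dNorm_trigApprox_ne_top h.meas n t).lt_top)
  · filter_upwards [h.ae_dNorm_ne_top T] with t ht
    have h1 := ENNReal.Tendsto.const_mul (tendsto_dNorm_trigApprox h.meas ht) (a := (C : ℝ≥0∞))
      (Or.inr ENNReal.coe_ne_top)
    rw [mul_zero] at h1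
    have hfin : ∀ n, dNorm (fun k => c t k - trigApprox h.meas n t k) ≠ ∞ := by
      intro n
      refine ne_top_of_le_ne_top (ENNReal.mul_ne_top (by norm_num : (3 : ℝ≥0∞) ≠ ∞) ht) ?_
      unfold dNorm dissip
      rw [← ENNReal.tsum_mul_left]
      refine ENNReal.tsum_le_tsum fun k => ?_
      rw [mul_left_comm]
      gcongr
      refine (enorm_sub_le).trans
        ((add_le_add_right (trigApprox_enorm_le h.meas n t k) _).trans_eq ?_)
      ring
    refine tendsto_of_tendsto_of_tendsto_of_le_of_le tendsto_const_nhds h1 (fun _ => zero_le)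
      fun n => ?_
    simp only [SimpleFunc.map_apply]
    rw [synth_sub (h.wNorm_ne_top t) (ThinFilm.wNorm_ne_top (hz n t)
      (dNorm_trigApprox_ne_top h.meas n t))]
    exact hN _ (by rw [h.zero, hz, sub_zero]) (hfin n)

theorem WienerPath.memBochner_one (h : WienerPath c e₀) {N : (Torus → ℝ) → ℝ≥0∞} {C : ℝ≥0}
    (hN : ∀ d : ℤ → ℂ, d 0 = 0 → dNorm d ≠ ∞ → N (synth d) ≤ C * dNorm d) (T : ℝ) :
    MemBochner 1 T N (fun t => synth (c t)) := by
  refine h.memBochner hN ?_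
  simp only [ENNReal.rpow_one]
  calc ∫⁻ t in Ioo 0 T, N (synth (c t)) ≤ ∫⁻ t in Ioo 0 T, C * dNorm (c t) := by
        refine lintegral_mono_ae ?_
        filter_upwards [h.ae_dNorm_ne_top T] with t ht using hN _ (h.zero t) ht
    _ ≤ ∫⁻ t in Ioc 0 T, C * dNorm (c t) := lintegral_mono_set Ioo_subset_Ioc_self
    _ < ∞ := by
        rw [lintegral_const_mul _ (measurable_dNorm h.meas)]
        exact ENNReal.mul_lt_top ENNReal.coe_lt_top (h.integrable T).lt_top

/-- By the interpolation inequality `wNorm_dCoeff_sq_le` a function in `L^∞(Ȧ⁰) ∩ L^1(Ȧ²)` is in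
`L²(0, T)` with values in any space whose norm is dominated by the one of `Ȧ¹`. -/
theorem WienerPath.memBochner_two (h : WienerPath c e₀) {N : (Torus → ℝ) → ℝ≥0∞} {C : ℝ≥0}
    (hN : ∀ d : ℤ → ℂ, d 0 = 0 → wNorm (dCoeff d) ≠ ∞ → N (synth d) ≤ C * wNorm (dCoeff d))
    (T : ℝ) : MemBochner 2 T N (fun t => synth (c t)) := by
  refine h.memBochner (C := C) (fun d h₀ hd => (hN d h₀ (wNorm_dCoeff_ne_top hd)).trans
    (mul_le_mul_right (wNorm_dCoeff_le_dNorm d) _)) ?_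
  simp only [ENNReal.rpow_two]
  calc ∫⁻ t in Ioo 0 T, N (synth (c t)) ^ 2 ≤ ∫⁻ t in Ioo 0 T, C ^ 2 * e₀ * dNorm (c t) := by
        refine lintegral_mono_ae ?_
        filter_upwards [h.ae_dNorm_ne_top T] with t ht
        calc N (synth (c t)) ^ 2 ≤ (C * wNorm (dCoeff (c t))) ^ 2 := by
              gcongr 1
              exact hN _ (h.zero t) (wNorm_dCoeff_ne_top ht)
          _ = C ^ 2 * wNorm (dCoeff (c t)) ^ 2 := mul_pow _ _ _
          _ ≤ C ^ 2 * (wNorm (c t) * dNorm (c t)) := by gcongr; exact wNorm_dCoeff_sq_le _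
          _ ≤ C ^ 2 * (e₀ * dNorm (c t)) := by gcongr; exact h.bound t
          _ = _ := by ring
    _ ≤ ∫⁻ t in Ioc 0 T, C ^ 2 * e₀ * dNorm (c t) := lintegral_mono_set Ioo_subset_Ioc_self
    _ < ∞ := by
        rw [lintegral_const_mul _ (measurable_dNorm h.meas)]
        exact ENNReal.mul_lt_top (by exact_mod_cast ENNReal.coe_lt_top) (h.integrable T).lt_top

instance (T : ℝ) : IsFiniteMeasure (slab T) := by unfold slab; infer_instance

theorem WienerPath.isBounded (h : WienerPath c e₀) (T : ℝ) :
    IsBounded T (fun t => synth (c t)) := by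
  refine ⟨(measurable_synth_path h.meas).aestronglyMeasurable, ?_⟩
  refine lt_of_le_of_lt (eLpNorm_le_of_ae_enorm_bound (C := e₀) (ae_of_all _ fun p =>
    (enorm_synth_le _ _).trans (h.bound _))) ?_
  simp

theorem WienerPath.integrable_slab (h : WienerPath c e₀) (T : ℝ) :
    Integrable (fun p : ℝ × Torus => synth (c p.1) p.2) (slab T) :=
  memLp_one_iff_integrable.1 ((h.isBounded T).mono_exponent le_top)

theorem WienerPath.integrableOn_synth (h : WienerPath c e₀) (x : Torus) {B : Set ℝ}
    (hB : volume B ≠ ∞) : IntegrableOn (fun t => synth (c t) x) B := by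
  refine ⟨((measurable_synth_path h.meas).comp
    (measurable_id.prodMk measurable_const)).aestronglyMeasurable, ?_⟩
  refine lt_of_le_of_lt (lintegral_mono (g := fun _ => (e₀ : ℝ≥0∞)) fun t =>
    (enorm_synth_le _ _).trans (h.bound t)) ?_
  simpa using ENNReal.mul_lt_top ENNReal.coe_lt_top hB.lt_top

/-- Integrating a Fourier series in time term by term. -/
theorem integral_synth {c : ℝ → ℤ → ℂ} (hm : ∀ k, Measurable fun t => c t k) (x : Torus)
    {B : Set ℝ} (hB : ∫⁻ t in B, wNorm (c t) ≠ ∞) :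
    ∫ t in B, synth (c t) x = synth (fun k => ∫ t in B, c t k) x := by
  have hint : IntegrableOn (fun t => fourierSeries (c t) x) B := by
    refine ⟨((measurable_fourierSeries_path hm).comp
      (measurable_id.prodMk measurable_const)).aestronglyMeasurable, ?_⟩
    exact lt_of_le_of_lt (lintegral_mono fun t => enorm_fourierSeries_le _ _) hB.lt_top
  have h1 : ∫ t in B, synth (c t) x = (∫ t in B, fourierSeries (c t) x).re :=
    Complex.reCLM.integral_comp_comm hint
  rw [h1, synth]
  congr 1
  unfold fourierSeries
  rw [integral_tsum]
  · exact tsum_congr fun k => integral_mul_const _ _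
  · exact fun k => ((hm k).mul_const _).aestronglyMeasurable
  · rw [← lintegral_tsum fun k => ((hm k).mul_const _).enorm.aemeasurable]
    simp only [enorm_mul, enorm_fourier_apply, mul_one]
    exact hB

theorem WienerPath.lintegral_wNorm_ne_top (h : WienerPath c e₀) {B : Set ℝ}
    (hB : volume B ≠ ∞) : ∫⁻ t in B, wNorm (c t) ≠ ∞ := by
  refine (lt_of_le_of_lt (lintegral_mono (g := fun _ => (e₀ : ℝ≥0∞)) fun t => h.bound t) ?_).ne
  simpa using ENNReal.mul_lt_top ENNReal.coe_lt_top hB.lt_top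

/-- Minkowski's inequality for the norm of `Ȧ²`. -/
theorem dNorm_integral_le {c : ℝ → ℤ → ℂ} (hm : ∀ k, Measurable fun t => c t k) (B : Set ℝ) :
    dNorm (fun k => ∫ t in B, c t k) ≤ ∫⁻ t in B, dNorm (c t) := by
  unfold dNorm dissip
  rw [lintegral_tsum fun k => ((hm k).enorm.const_mul _).aemeasurable]
  refine ENNReal.tsum_le_tsum fun k => ?_
  rw [lintegral_const_mul _ (hm k).enorm]
  gcongr
  exact enorm_integral_le_lintegral_enorm _

/-- A density in `L^1(Ȧ²)` defines a measure of bounded variation with values in any space whose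
norm is dominated by the one of `Ȧ²`. -/
theorem WienerPath.memRadon (h : WienerPath c e₀) {N : (Torus → ℝ) → ℝ≥0∞} {C : ℝ≥0}
    (hN : ∀ d : ℤ → ℂ, d 0 = 0 → dNorm d ≠ ∞ → N (synth d) ≤ C * dNorm d) (T : ℝ) :
    MemRadon T N (fun t => synth (c t)) := by
  have hvol : ∀ B : Set ℝ, B ⊆ Icc 0 T → volume B ≠ ∞ := fun B hB =>
    ne_top_of_le_ne_top (by simp) (measure_mono hB)
  have hIcc : ∫⁻ t in Icc 0 T, dNorm (c t) ≠ ∞ := by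
    rw [← setLIntegral_congr (Ioc_ae_eq_Icc (μ := volume))]
    exact h.integrable T
  have hfin : ∀ B : Set ℝ, B ⊆ Icc 0 T → ∫⁻ t in B, dNorm (c t) ≠ ∞ := fun B hB =>
    ne_top_of_le_ne_top hIcc (lintegral_mono_set hB)
  have hNB : ∀ B : Set ℝ, B ⊆ Icc 0 T →
      N (timeIntegral (fun t => synth (c t)) B) ≤ C * ∫⁻ t in B, dNorm (c t) := by
    intro B hB
    have h1 : timeIntegral (fun t => synth (c t)) B = synth (fun k => ∫ t in B, c t k) :=
      funext fun x => integral_synth h.meas x (h.lintegral_wNorm_ne_top (hvol B hB))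
    have h2 := dNorm_integral_le h.meas B
    rw [h1]
    refine (hN _ ?_ (ne_top_of_le_ne_top (hfin B hB) h2)).trans (by gcongr)
    simp [h.zero]
  refine ⟨h.integrable_slab T, fun B _ hB => ?_, fun B hB hd => ?_,
    C * (∫⁻ t in Icc 0 T, dNorm (c t)).toNNReal, fun n B hB hd => ?_⟩
  · exact (hNB B hB).trans_lt (ENNReal.mul_lt_top ENNReal.coe_lt_top (hfin B hB).lt_top)
  · have hsub : ⋃ i, B i ⊆ Icc 0 T := iUnion_subset fun i => (hB i).2
    have htail : ∀ n, timeIntegral (fun t => synth (c t)) (⋃ i, B i) -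
        ∑ i ∈ Finset.range n, timeIntegral (fun t => synth (c t)) (B i) =
        timeIntegral (fun t => synth (c t)) (⋃ i, B (i + n)) := by
      intro n
      funext x
      have hi := h.integrableOn_synth x (hvol _ hsub)
      have h1 := hasSum_integral_iUnion (fun i => (hB i).1) hd hi
      have h2 := hasSum_integral_iUnion (s := fun i => B (i + n)) (fun i => (hB _).1)
        (fun i j hij => hd (by simpa using hij)) (hi.mono_set
          (iUnion_subset fun i => subset_iUnion B (i + n)))
      have h3 := h1.summable.sum_add_tsum_nat_add n
      rw [h1.tsum_eq, h2.tsum_eq] at h3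
      simp only [Pi.sub_apply, Finset.sum_apply, timeIntegral]
      rw [← h3]; ring
    simp only [htail]
    have h1 : ∑' i, ∫⁻ t in B i, dNorm (c t) ≠ ∞ := by
      rw [← lintegral_iUnion (fun i => (hB i).1) hd]
      exact hfin _ hsub
    have h2 := ENNReal.Tendsto.const_mul (ENNReal.tendsto_sum_nat_add _ h1) (a := (C : ℝ≥0∞))
      (Or.inr ENNReal.coe_ne_top)
    rw [mul_zero] at h2
    refine tendsto_of_tendsto_of_tendsto_of_le_of_le tendsto_const_nhds h2 (fun _ => zero_le)
      fun n => ?_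
    refine (hNB _ (iUnion_subset fun i => (hB _).2)).trans_eq ?_
    rw [lintegral_iUnion (fun i => (hB _).1) (fun i j hij => hd (by simpa using hij))]
  · push_cast
    rw [ENNReal.coe_toNNReal hIcc]
    calc ∑ i, N (timeIntegral (fun t => synth (c t)) (B i))
        ≤ ∑ i, C * ∫⁻ t in B i, dNorm (c t) := Finset.sum_le_sum fun i _ => hNB _ (hB i).2
      _ = C * ∫⁻ t in ⋃ i, B i, dNorm (c t) := by
          rw [lintegral_iUnion (fun i => (hB i).1) hd, tsum_fintype, Finset.mul_sum]
      _ ≤ _ := by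
          gcongr
          exact iUnion_subset fun i => (hB i).2

theorem WienerPath.isRegular (h : WienerPath c e₀) (T : ℝ) :
    IsRegular T (fun t => synth (c t)) := by
  refine ⟨h.isBounded T, h.memBochner_two (C := 16) (fun d h₀ hd => ?_) T,
    fun α hα => h.memBochner_one (C := 16) (fun d h₀ hd => ?_) T,
    h.memRadon (C := 16) (fun d h₀ hd => ?_) T,
    h.memBochner_two (C := 1) (fun d h₀ hd => ?_) T⟩
  · exact sobolevNorm_one_synth_le h₀ hd le_top
  · exact c1HolderNorm_synth_le h₀ hd (hα.le.trans (by norm_num))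
  · exact sobolevNorm_two_synth_le h₀ hd
  · simpa using hDotNorm_one_synth_le h₀ hd

theorem WienerPath.memBochner_sobolev (h : WienerPath c e₀) (T : ℝ) :
    MemBochner 1 T (sobolevNorm 1 1) (fun t => synth (c t)) :=
  h.memBochner_one (C := 16) (fun d h₀ hd => (sobolevNorm_one_synth_le h₀ (wNorm_dCoeff_ne_top hd)
    le_rfl).trans (mul_le_mul_right (wNorm_dCoeff_le_dNorm d) _)) T

end

/-! ### Test functions -/

theorem continuous_slab_of_lift {X : Type*} [TopologicalSpace X] {u : ℝ × Torus → X}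
    (h : Continuous fun p : ℝ × ℝ => u (p.1, (p.2 : Torus))) : Continuous u := by
  have hq : IsOpenQuotientMap (Prod.map id ((↑) : ℝ → Torus) : ℝ × ℝ → ℝ × Torus) :=
    IsOpenQuotientMap.id.prodMap QuotientAddGroup.isOpenQuotientMap_mk
  exact hq.isQuotientMap.continuous_iff.2 h

theorem IsTest.continuous {T : ℝ} {φ : ℝ → Torus → ℝ} (h : IsTest T φ) :
    Continuous fun p : ℝ × Torus => φ p.1 p.2 :=
  continuous_slab_of_lift h.1.continuous

theorem IsTest.hasDerivAt_time {T : ℝ} {φ : ℝ → Torus → ℝ} (h : IsTest T φ) (t : ℝ) (x : Torus) :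
    HasDerivAt (fun s => φ s x) (deriv (fun s => φ s x) t) t := by
  induction x using QuotientAddGroup.induction_on with
  | H a =>
    have h1 : DifferentiableAt ℝ (fun p : ℝ × ℝ => φ p.1 (p.2 : Torus)) (t, a) :=
      h.1.differentiable (by norm_num) _
    have h2 : DifferentiableAt ℝ (fun s : ℝ => (s, a)) t := by fun_prop
    exact (DifferentiableAt.comp t (f := fun s : ℝ => (s, a)) h1 h2).hasDerivAt

theorem IsTest.continuous_time_deriv {T : ℝ} {φ : ℝ → Torus → ℝ} (h : IsTest T φ) :
    Continuous fun p : ℝ × Torus => deriv (fun s => φ s p.2) p.1 := by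
  refine continuous_slab_of_lift ?_
  have h1 : Continuous fun p : ℝ × ℝ =>
      fderiv ℝ (fun p : ℝ × ℝ => φ p.1 (p.2 : Torus)) p (1, 0) :=
    (h.1.continuous_fderiv (by norm_num)).clm_apply continuous_const
  refine h1.congr fun p => ?_
  have h2 := (h.1.differentiable (by norm_num) p).hasFDerivAt.comp_hasDerivAt p.1
    (f := fun s : ℝ => (s, p.2)) ((hasDerivAt_id p.1).prodMk (hasDerivAt_const p.1 p.2))
  exact h2.deriv.symm

theorem IsTest.isCn {T : ℝ} {φ : ℝ → Torus → ℝ} (h : IsTest T φ) (t : ℝ) : IsCn 1 (φ t) :=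
  h.1.comp (contDiff_const.prodMk contDiff_id)

theorem IsTest.continuous_dx {T : ℝ} {φ : ℝ → Torus → ℝ} (h : IsTest T φ) :
    Continuous fun p : ℝ × Torus => dx (φ p.1) p.2 := by
  refine continuous_slab_of_lift ?_
  have h1 : Continuous fun p : ℝ × ℝ =>
      fderiv ℝ (fun p : ℝ × ℝ => φ p.1 (p.2 : Torus)) p (0, 1) :=
    (h.1.continuous_fderiv (by norm_num)).clm_apply continuous_const
  refine h1.congr fun p => ?_
  have h2 := (h.1.differentiable (by norm_num) p).hasFDerivAt.comp_hasDerivAt p.2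
    (f := fun s : ℝ => (p.1, s)) ((hasDerivAt_const p.2 p.1).prodMk (hasDerivAt_id p.2))
  exact h2.unique ((h.isCn p.1).hasDx p.2)

theorem exists_bound_slab {F : ℝ × Torus → ℝ} (h : Continuous F) (T : ℝ) :
    ∃ C : ℝ, ∀ t ∈ Icc 0 T, ∀ x, ‖F (t, x)‖ ≤ C := by
  obtain ⟨C, hC⟩ := (isCompact_Icc (a := (0 : ℝ)) (b := T)).prod
    (isCompact_univ (X := Torus)) |>.exists_bound_of_continuousOn h.continuousOn
  exact ⟨C, fun t ht x => hC (t, x) ⟨ht, mem_univ x⟩⟩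

theorem ae_slab_mem (T : ℝ) : ∀ᵐ p ∂(slab T), p.1 ∈ Ioo 0 T := by
  unfold slab
  exact Measure.quasiMeasurePreserving_fst.ae (ae_restrict_mem measurableSet_Ioo)

theorem Integrable.mul_continuous_slab {T : ℝ} {F G : ℝ × Torus → ℝ} (hF : Integrable F (slab T))
    (hG : Continuous G) : Integrable (fun p => F p * G p) (slab T) := by
  obtain ⟨C, hC⟩ := exists_bound_slab hG T
  refine hF.mul_bdd (c := C) hG.aestronglyMeasurable ?_
  filter_upwards [ae_slab_mem T] with p hp
  exact hC p.1 (Ioo_subset_Icc_self hp) p.2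

theorem integrable_slab_of_bound {T : ℝ} {F : ℝ × Torus → ℝ} (hF : Measurable F)
    {g : ℝ → ℝ≥0∞} (hg : ∀ t x, ‖F (t, x)‖ₑ ≤ g t) (hgi : ∫⁻ t in Ioo 0 T, g t ≠ ∞) :
    Integrable F (slab T) := by
  refine ⟨hF.aestronglyMeasurable, ?_⟩
  unfold HasFiniteIntegral slab
  rw [lintegral_prod _ hF.enorm.aemeasurable]
  calc ∫⁻ t in Ioo 0 T, ∫⁻ x : Torus, ‖F (t, x)‖ₑ
      ≤ ∫⁻ t in Ioo 0 T, volume (univ : Set Torus) * g t := by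
        refine lintegral_mono fun t => ?_
        refine (lintegral_mono (g := fun _ => g t) fun x => hg t x).trans_eq ?_
        rw [lintegral_const, mul_comm]
    _ = volume (univ : Set Torus) * ∫⁻ t in Ioo 0 T, g t :=
        lintegral_const_mul' _ _ (measure_ne_top _ _)
    _ < ∞ := ENNReal.mul_lt_top (measure_lt_top _ _) hgi.lt_top

/-! ### Products of Fourier series -/

/-- Products of Fourier series correspond to convolutions of the coefficients. -/
theorem fourierSeries_mul {a b : ℤ → ℂ} (ha : wNorm a ≠ ∞) (hb : wNorm b ≠ ∞) (x : Torus) :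
    fourierSeries a x * fourierSeries b x = fourierSeries (fun k => ∑' l, a (k - l) * b l) x := by
  have ha' : Summable fun k => ‖a k * fourier k x‖ := by
    simpa only [norm_mul, norm_fourier_apply, mul_one] using summable_norm_of_wNorm ha
  have hb' : Summable fun k => ‖b k * fourier k x‖ := by
    simpa only [norm_mul, norm_fourier_apply, mul_one] using summable_norm_of_wNorm hb
  have hs := summable_mul_of_summable_norm ha' hb'
  -- The change of variables `(k, l) ↦ (k - l, l)` turns the double series into a convolution.
  let e : ℤ × ℤ ≃ ℤ × ℤ :=
    { toFun := fun p => (p.1 - p.2, p.2)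
      invFun := fun p => (p.1 + p.2, p.2)
      left_inv := fun p => by simp
      right_inv := fun p => by simp }
  have hs' : Summable fun p : ℤ × ℤ =>
      (a (e p).1 * fourier (e p).1 x) * (b (e p).2 * fourier (e p).2 x) := (e.summable_iff).2 hs
  unfold fourierSeries
  rw [tsum_mul_tsum_of_summable_norm ha' hb', ← e.tsum_eq, hs'.tsum_prod]
  refine tsum_congr fun k => ?_
  rw [← tsum_mul_right]
  refine tsum_congr fun l => ?_
  simp only [e, Equiv.coe_fn_mk]
  have : (fourier k x : ℂ) = fourier (k - l) x * fourier l x := by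
    rw [← fourier_add, sub_add_cancel]
  rw [this]; ring

theorem wNorm_le_add (c : ℤ → ℂ) : wNorm c ≤ ‖c 0‖ₑ + wNorm (dCoeff c) := by
  have h : ∀ k : ℤ, ‖c k‖ₑ ≤ (if k = 0 then ‖c 0‖ₑ else 0) + k.natAbs * ‖c k‖ₑ := by
    intro k
    split_ifs with hk
    · subst hk; simp
    · have : (1 : ℝ≥0∞) ≤ (k.natAbs : ℝ≥0∞) := by exact_mod_cast Int.natAbs_pos.2 hk
      rw [zero_add]
      calc ‖c k‖ₑ = 1 * ‖c k‖ₑ := (one_mul _).symm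
        _ ≤ _ := by gcongr
  refine (ENNReal.tsum_le_tsum h).trans ?_
  rw [ENNReal.tsum_add, tsum_ite_eq, wNorm_dCoeff]

section

variable {ι : Type*} [Fintype ι] [DecidableEq ι] {m : ι → ℝ≥0} {B : ι → ι → ℝ≥0}

/-- The Fourier coefficients of `(uᵢ + mᵢ) ∑ⱼ Bᵢⱼ ∂ₓuⱼ`. -/
def totalFlux (m : ι → ℝ≥0) (B : ι → ι → ℝ≥0) (u : ι → ℤ → ℂ) (i : ι) (k : ℤ) : ℂ :=
  m i * ∑ j, ((B i j : ℝ) : ℂ) * dCoeff (u j) k + flux B u i k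

/-- The Fourier coefficients of `∂ₓ((uᵢ + mᵢ) ∑ⱼ Bᵢⱼ ∂ₓuⱼ)`. -/
def timeDeriv (m : ι → ℝ≥0) (B : ι → ι → ℝ≥0) (u : ι → ℤ → ℂ) (i : ι) (k : ℤ) : ℂ :=
  -(damping m B i k * u i k) + rhs m B u i k

/-- The splitting into damping and right-hand side is compatible with the divergence form. -/
theorem dCoeff_totalFlux (u : ι → ℤ → ℂ) (i : ι) :
    dCoeff (totalFlux m B u i) = timeDeriv m B u i := by
  funext k
  have h1 : ∑ j, ((B i j : ℝ) : ℂ) * dCoeff (u j) k = ((B i i : ℝ) : ℂ) * dCoeff (u i) k +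
      ∑ j ∈ Finset.univ.erase i, ((B i j : ℝ) : ℂ) * dCoeff (u j) k :=
    (Finset.add_sum_erase _ _ (Finset.mem_univ i)).symm
  have h2 : ∑ j ∈ Finset.univ.erase i, ((m i * B i j : ℝ) : ℂ) * ((k : ℂ) ^ 2 * u j k) =
      -(Complex.I * k * m i * ∑ j ∈ Finset.univ.erase i, ((B i j : ℝ) : ℂ) * dCoeff (u j) k) := by
    rw [Finset.mul_sum, ← Finset.sum_neg_distrib]
    refine Finset.sum_congr rfl fun j _ => ?_
    unfold dCoeff
    push_cast
    linear_combination ((m i : ℝ) * (B i j : ℝ) * k ^ 2 * u j k : ℂ) * Complex.I_sq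
  unfold timeDeriv rhs
  rw [h2]
  unfold dCoeff totalFlux damping
  rw [h1]
  unfold dCoeff
  push_cast
  linear_combination ((m i : ℝ) * (B i i : ℝ) * k ^ 2 * u i k : ℂ) * Complex.I_sq

theorem dCoeff_conj {c : ℤ → ℂ} (h : ∀ k, c (-k) = (starRingEnd ℂ) (c k)) (k : ℤ) :
    dCoeff c (-k) = (starRingEnd ℂ) (dCoeff c k) := by
  unfold dCoeff
  rw [h, map_mul, map_mul, Complex.conj_I, map_intCast]
  push_cast; ring

theorem fourierSeries_const_mul (z : ℂ) (c : ℤ → ℂ) (x : Torus) :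
    fourierSeries (fun k => z * c k) x = z * fourierSeries c x := by
  unfold fourierSeries
  rw [← tsum_mul_left]
  exact tsum_congr fun k => mul_assoc _ _ _

theorem fourierSeries_sum {c : ι → ℤ → ℂ} (h : ∀ j, wNorm (c j) ≠ ∞) (x : Torus) :
    fourierSeries (fun k => ∑ j, c j k) x = ∑ j, fourierSeries (c j) x := by
  unfold fourierSeries
  simp only [Finset.sum_mul]
  exact Summable.tsum_finsetSum fun j _ => summable_fourierSeries (h j) x

theorem fourierSeries_add {c d : ℤ → ℂ} (hc : wNorm c ≠ ∞) (hd : wNorm d ≠ ∞) (x : Torus) :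
    fourierSeries (fun k => c k + d k) x = fourierSeries c x + fourierSeries d x := by
  unfold fourierSeries
  simp only [add_mul]
  exact (summable_fourierSeries hc x).tsum_add (summable_fourierSeries hd x)

theorem wNorm_const_mul (z : ℂ) (c : ℤ → ℂ) : wNorm (fun k => z * c k) = ‖z‖ₑ * wNorm c := by
  unfold wNorm
  rw [← ENNReal.tsum_mul_left]
  exact tsum_congr fun k => enorm_mul _ _

theorem wNorm_convolution_ne_top {a b : ℤ → ℂ} (ha : wNorm a ≠ ∞) (hb : wNorm b ≠ ∞) :
    wNorm (fun k => ∑' l, a (k - l) * b l) ≠ ∞ := by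
  refine ne_top_of_le_ne_top (ENNReal.mul_ne_top ha hb) ?_
  calc wNorm (fun k => ∑' l, a (k - l) * b l) ≤ ∑' k, ∑' l, ‖a (k - l)‖ₑ * ‖b l‖ₑ := by
        refine ENNReal.tsum_le_tsum fun k => enorm_tsum_le_tsum_enorm.trans_eq ?_
        exact tsum_congr fun l => enorm_mul _ _
    _ = _ := by
        rw [ENNReal.tsum_comm, wNorm, wNorm, ← ENNReal.tsum_mul_left]
        congr 1; funext l
        rw [ENNReal.tsum_mul_right]
        exact congrArg (· * ‖b l‖ₑ) ((Equiv.subRight l).tsum_eq fun k => ‖a k‖ₑ)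

theorem wNorm_sum_ne_top {c : ι → ℤ → ℂ} (h : ∀ j, wNorm (c j) ≠ ∞) :
    wNorm (fun k => ∑ j, c j k) ≠ ∞ := by
  refine ne_top_of_le_ne_top
    (ENNReal.sum_lt_top.2 fun j (_ : j ∈ Finset.univ) => (h j).lt_top).ne ?_
  unfold wNorm
  rw [← Summable.tsum_finsetSum fun _ _ => ENNReal.summable]
  exact ENNReal.tsum_le_tsum fun k => enorm_sum_le _ _

theorem wNorm_coe_mul_ne_top (r : ℝ) {c : ℤ → ℂ} (h : wNorm c ≠ ∞) :
    wNorm (fun k => (r : ℂ) * c k) ≠ ∞ := by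
  rw [wNorm_const_mul]
  exact ENNReal.mul_ne_top enorm_ne_top h

theorem wNorm_flux_ne_top {u : ι → ℤ → ℂ} (hu : ∀ i, wNorm (u i) ≠ ∞)
    (hu' : ∀ i, wNorm (dCoeff (u i)) ≠ ∞) (i : ι) : wNorm (flux B u i) ≠ ∞ :=
  wNorm_sum_ne_top (c := fun j k => ((B i j : ℝ) : ℂ) * ∑' l, u i (k - l) * dCoeff (u j) l)
    fun j => wNorm_coe_mul_ne_top _ (wNorm_convolution_ne_top (hu i) (hu' j))

theorem wNorm_totalFlux_ne_top {u : ι → ℤ → ℂ} (hu : ∀ i, wNorm (u i) ≠ ∞)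
    (hu' : ∀ i, wNorm (dCoeff (u i)) ≠ ∞) (i : ι) : wNorm (totalFlux m B u i) ≠ ∞ := by
  refine ne_top_of_le_ne_top (ENNReal.add_ne_top.2 ⟨wNorm_coe_mul_ne_top (m i)
    (wNorm_sum_ne_top fun j => wNorm_coe_mul_ne_top (B i j) (hu' j)), wNorm_flux_ne_top hu hu' i⟩)
    (le_trans (ENNReal.tsum_le_tsum fun k => enorm_add_le _ _) ENNReal.tsum_add.le)

theorem totalFlux_conj {u : ι → ℤ → ℂ} (hc : ∀ i k, u i (-k) = (starRingEnd ℂ) (u i k)) (i : ι)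
    (k : ℤ) : totalFlux m B u i (-k) = (starRingEnd ℂ) (totalFlux m B u i k) := by
  unfold totalFlux
  simp only [flux_conj hc, dCoeff_conj (hc _), map_add, map_mul, map_sum, Complex.conj_ofReal]

/-- In physical space `totalFlux` is the product that it stands for. -/
theorem synth_totalFlux {u : ι → ℤ → ℂ} (hu : ∀ i, wNorm (u i) ≠ ∞)
    (hu' : ∀ i, wNorm (dCoeff (u i)) ≠ ∞) (hc : ∀ i k, u i (-k) = (starRingEnd ℂ) (u i k))
    (i : ι) (x : Torus) :
    synth (totalFlux m B u i) x =
      (synth (u i) x + m i) * ∑ j, (B i j : ℝ) * synth (dCoeff (u j)) x := by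
  have hlin := fun j => wNorm_coe_mul_ne_top (B i j) (hu' j)
  have hf : fourierSeries (flux B u i) x =
      fourierSeries (u i) x * ∑ j, ((B i j : ℝ) : ℂ) * fourierSeries (dCoeff (u j)) x := by
    have h1 := fourierSeries_sum (c := fun j k => ((B i j : ℝ) : ℂ) *
      ∑' l, u i (k - l) * dCoeff (u j) l) (fun j =>
        wNorm_coe_mul_ne_top _ (wNorm_convolution_ne_top (hu i) (hu' j))) x
    refine h1.trans ?_
    rw [Finset.mul_sum]
    refine Finset.sum_congr rfl fun j _ => ?_
    rw [fourierSeries_const_mul, ← fourierSeries_mul (hu i) (hu' j)]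
    ring
  have h1 : fourierSeries (totalFlux m B u i) x = (fourierSeries (u i) x + m i) *
      ∑ j, ((B i j : ℝ) : ℂ) * fourierSeries (dCoeff (u j)) x := by
    have h2 := fourierSeries_add (c := fun k => m i * ∑ j, ((B i j : ℝ) : ℂ) * dCoeff (u j) k)
      (d := flux B u i) (wNorm_coe_mul_ne_top _ (wNorm_sum_ne_top hlin))
      (wNorm_flux_ne_top hu hu' i) x
    refine h2.trans ?_
    rw [fourierSeries_const_mul, fourierSeries_sum hlin, hf]
    simp only [fourierSeries_const_mul]
    ring
  have h3 : ((synth (u i) x + m i) * ∑ j, (B i j : ℝ) * synth (dCoeff (u j)) x : ℝ) =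
      fourierSeries (totalFlux m B u i) x := by
    rw [h1]
    push_cast
    rw [ofReal_synth_of_conj (hc i)]
    simp only [ofReal_synth_of_conj (dCoeff_conj (hc _))]
  rw [synth, ← h3, Complex.ofReal_re]

end

section

variable {ι : Type*} [Fintype ι] [DecidableEq ι] {m : ι → ℝ≥0} {B : ι → ι → ℝ≥0}

/-! ### From Fourier coefficients to weak solutions -/

/-- The family `c i t` of Fourier coefficients of `uᵢ(t)` solves the system
`∂ₜuᵢ = ∂ₓ((uᵢ + mᵢ) ∑ⱼ Bᵢⱼ ∂ₓuⱼ)` mode by mode, in integrated form. -/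
structure ModeSolution (m : ι → ℝ≥0) (B : ι → ι → ℝ≥0) (c : ι → ℝ → ℤ → ℂ) (e₀ : ℝ≥0) :
    Prop where
  path : ∀ i, WienerPath (c i) e₀
  conj : ∀ i t k, c i t (-k) = (starRingEnd ℂ) (c i t k)
  lintegral_ne_top : ∀ i T, ∫⁻ t in Ioc 0 T, wNorm (timeDeriv m B (fun j => c j t) i) ≠ ∞
  integrated : ∀ i k {T : ℝ}, 0 ≤ T →
    c i T k = c i 0 k + ∫ t in Ioc 0 T, timeDeriv m B (fun j => c j t) i k

variable {c : ι → ℝ → ℤ → ℂ} {e₀ : ℝ≥0}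

theorem ModeSolution.measurable_timeDeriv (h : ModeSolution m B c e₀) (i : ι) (k : ℤ) :
    Measurable fun t => timeDeriv m B (fun j => c j t) i k := by
  unfold timeDeriv
  exact (((h.path i).meas k).const_mul _).neg.add
    (measurable_rhs (u := fun t j => c j t) (fun j l => (h.path j).meas l) i k)

/-- The integrated equation at each point of the torus. -/
theorem ModeSolution.synth_eq (h : ModeSolution m B c e₀) (i : ι) {T : ℝ} (hT : 0 ≤ T)
    (x : Torus) : synth (c i T) x = synth (c i 0) x +
      ∫ t in Ioc 0 T, synth (timeDeriv m B (fun j => c j t) i) x := by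
  rw [integral_synth (h.measurable_timeDeriv i) x (h.lintegral_ne_top i T)]
  have hfin : wNorm (fun k => ∫ t in Ioc 0 T, timeDeriv m B (fun j => c j t) i k) ≠ ∞ := by
    refine ne_top_of_le_ne_top (h.lintegral_ne_top i T) ?_
    unfold wNorm
    rw [lintegral_tsum fun k => (h.measurable_timeDeriv i k).enorm.aemeasurable]
    exact ENNReal.tsum_le_tsum fun k => enorm_integral_le_lintegral_enorm _
  have h1 := fourierSeries_add ((h.path i).wNorm_ne_top 0) hfin x
  unfold synth
  rw [← Complex.add_re, ← h1]
  congr 2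
  funext k
  exact h.integrated i k hT

theorem measurable_dCoeff_path {c : ℝ → ℤ → ℂ} (h : ∀ k, Measurable fun t => c t k) (k : ℤ) :
    Measurable fun t => dCoeff (c t) k := (h k).const_mul _

theorem lintegral_Ioo_ne_top {g : ℝ → ℝ≥0∞} {T : ℝ} (h : ∫⁻ t in Ioc 0 T, g t ≠ ∞) :
    ∫⁻ t in Ioo 0 T, g t ≠ ∞ :=
  ne_top_of_le_ne_top h (lintegral_mono_set Ioo_subset_Ioc_self)

/-- The function `∑ⱼ Bᵢⱼ ∂ₓuⱼ`. -/
def velocity (B : ι → ι → ℝ≥0) (c : ι → ℝ → ℤ → ℂ) (i : ι) (t : ℝ) (x : Torus) : ℝ :=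
  ∑ j, (B i j : ℝ) * synth (dCoeff (c j t)) x

theorem ModeSolution.measurable_velocity (h : ModeSolution m B c e₀) (i : ι) :
    Measurable fun p : ℝ × Torus => velocity B c i p.1 p.2 := by
  unfold velocity
  exact Finset.measurable_fun_sum _ fun j _ =>
    (measurable_synth_path (measurable_dCoeff_path (h.path j).meas)).const_mul _

theorem enorm_velocity_le (i : ι) (t : ℝ) (x : Torus) :
    ‖velocity B c i t x‖ₑ ≤ ∑ j, (B i j : ℝ≥0∞) * dNorm (c j t) := by
  unfold velocity
  refine (enorm_sum_le _ _).trans (Finset.sum_le_sum fun j _ => ?_)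
  rw [enorm_mul]
  have hB : ‖(B i j : ℝ)‖ₑ = B i j := by
    rw [← ofReal_norm, Real.norm_of_nonneg (B i j).coe_nonneg, ENNReal.ofReal_coe_nnreal]
  rw [hB]
  gcongr
  exact (enorm_synth_le _ x).trans (wNorm_dCoeff_le_dNorm _)

theorem ModeSolution.lintegral_velocity_bound (h : ModeSolution m B c e₀) (i : ι) (T : ℝ) :
    ∫⁻ t in Ioc 0 T, ∑ j, (B i j : ℝ≥0∞) * dNorm (c j t) ≠ ∞ := by
  rw [lintegral_finsetSum _ fun j _ => (measurable_dNorm (h.path j).meas).const_mul _]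
  refine (ENNReal.sum_lt_top.2 fun j _ => ?_).ne
  rw [lintegral_const_mul _ (measurable_dNorm (h.path j).meas)]
  exact ENNReal.mul_lt_top ENNReal.coe_lt_top ((h.path j).integrable T).lt_top

theorem ModeSolution.integrable_velocity (h : ModeSolution m B c e₀) (i : ι) (T : ℝ) :
    Integrable (fun p : ℝ × Torus => velocity B c i p.1 p.2) (slab T) :=
  integrable_slab_of_bound (h.measurable_velocity i) (enorm_velocity_le i)
    (lintegral_Ioo_ne_top (h.lintegral_velocity_bound i T))

theorem ModeSolution.integrable_mul_velocity (h : ModeSolution m B c e₀) (i : ι) (T : ℝ) :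
    Integrable (fun p : ℝ × Torus => synth (c i p.1) p.2 * velocity B c i p.1 p.2) (slab T) := by
  refine (h.integrable_velocity i T).bdd_mul (c := e₀)
    (measurable_synth_path (h.path i).meas).aestronglyMeasurable (ae_of_all _ fun p => ?_)
  have := (enorm_synth_le (c i p.1) p.2).trans ((h.path i).bound p.1)
  rw [← ofReal_norm, ← ENNReal.ofReal_coe_nnreal] at this
  exact (ENNReal.ofReal_le_ofReal_iff e₀.coe_nonneg).1 this

theorem ModeSolution.integrable_timeDeriv (h : ModeSolution m B c e₀) (i : ι) (T : ℝ) :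
    Integrable (fun p : ℝ × Torus => synth (timeDeriv m B (fun j => c j p.1) i) p.2) (slab T) :=
  integrable_slab_of_bound (measurable_synth_path (h.measurable_timeDeriv i))
    (fun _ x => enorm_synth_le _ x) (lintegral_Ioo_ne_top (h.lintegral_ne_top i T))

/-- The equation holds in divergence form at almost every time. -/
theorem ModeSolution.ae_integral_timeDeriv (h : ModeSolution m B c e₀) (i : ι) (T : ℝ) :
    ∀ᵐ t ∂(volume.restrict (Ioo 0 T)), ∀ v v' : Torus → ℝ, HasDx v v' → Continuous v' →
      ∫ x, synth (timeDeriv m B (fun j => c j t) i) x * v x =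
        -∫ x, (synth (c i t) x + m i) * velocity B c i t x * v' x := by
  have h1 := ae_lt_top (Measurable.tsum fun k => (h.measurable_timeDeriv i k).enorm)
    (h.lintegral_ne_top i T)
  filter_upwards [ae_restrict_of_ae_restrict_of_subset Ioo_subset_Ioc_self h1,
    ae_all_iff.2 fun j => (h.path j).ae_dNorm_ne_top T] with t ht hd v v' hv hv'
  have hd' : ∀ j, wNorm (dCoeff (c j t)) ≠ ∞ := fun j => wNorm_dCoeff_ne_top (hd j)
  have h2 : wNorm (timeDeriv m B (fun j => c j t) i) ≠ ∞ := ht.ne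
  have h3 : wNorm (dCoeff (totalFlux m B (fun j => c j t) i)) ≠ ∞ := by rwa [dCoeff_totalFlux]
  -- Summability of the flux follows from that of its derivative, up to the zero mode.
  have h4 : wNorm (totalFlux m B (fun j => c j t) i) ≠ ∞ :=
    ne_top_of_le_ne_top (ENNReal.add_ne_top.2 ⟨enorm_ne_top, h3⟩) (wNorm_le_add _)
  have h5 := (hasDx_synth h4 h3).integral_mul hv (continuous_synth h3) hv'
  rw [dCoeff_totalFlux] at h5
  rw [eq_neg_iff_add_eq_zero, add_comm, ← eq_neg_iff_add_eq_zero, ← h5]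
  refine integral_congr_ae (ae_of_all _ fun x => ?_)
  simp only [velocity]
  rw [synth_totalFlux (fun j => (h.path j).wNorm_ne_top t) hd' (fun j k => h.conj j t k)]

theorem setIntegral_slice {F : ℝ × Torus → ℝ} {T : ℝ} (hF : Integrable F (slab T)) :
    ∫ x, ∫ t in Ioc 0 T, F (t, x) = ∫ p, F p ∂(slab T) := by
  unfold slab at hF ⊢
  rw [integral_prod_symm _ hF]
  refine integral_congr_ae (ae_of_all _ fun x => ?_)
  exact setIntegral_congr_set Ioo_ae_eq_Ioc.symm

theorem integrable_slice {F : ℝ × Torus → ℝ} {T : ℝ} (hF : Integrable F (slab T)) :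
    Integrable (fun x => ∫ t in Ioc 0 T, F (t, x)) volume := by
  unfold slab at hF
  refine hF.integral_prod_right.congr (ae_of_all _ fun x => ?_)
  exact setIntegral_congr_set Ioo_ae_eq_Ioc

/-- A solution on the Fourier side is a weak solution: for fixed `x` the product rule for primitives
moves the time derivative to the test function, for fixed `t` integration by parts moves the space
derivative. -/
theorem ModeSolution.weakEq (h : ModeSolution m B c e₀) (i : ι) {T : ℝ} (hT : 0 < T)
    {u₀ : Torus → ℝ} (hu₀ : u₀ =ᵐ[volume] synth (c i 0)) :
    WeakEq T (m i) u₀ (fun t => synth (c i t)) (velocity B c i) := by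
  refine ⟨h.integrable_mul_velocity i T, fun φ hφ => ?_⟩
  obtain ⟨τ, hτ, hφT⟩ := hφ.2
  have hiu := h.path i |>.integrable_slab T
  have hih := h.integrable_timeDeriv i T
  have hi1 := Integrable.mul_continuous_slab hih hφ.continuous
  have hi2 := Integrable.mul_continuous_slab hiu hφ.continuous_time_deriv
  have hi3 := Integrable.mul_continuous_slab (h.integrable_velocity i T) hφ.continuous_dx
  have hi4 := Integrable.mul_continuous_slab (h.integrable_mul_velocity i T) hφ.continuous_dx
  have hih_x : ∀ x, IntegrableOn (fun t => synth (timeDeriv m B (fun j => c j t) i) x)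
      (Ioc 0 T) := fun x =>
    ⟨((measurable_synth_path (h.measurable_timeDeriv i)).comp
      (measurable_id.prodMk measurable_const)).aestronglyMeasurable,
      (lintegral_mono fun t => enorm_synth_le _ x).trans_lt (h.lintegral_ne_top i T).lt_top⟩
  have hcont : ∀ x, Continuous fun t => φ t x := fun x =>
    hφ.continuous.comp (continuous_id.prodMk continuous_const)
  have hcont' : ∀ x, Continuous fun t => deriv (fun s => φ s x) t := fun x =>
    hφ.continuous_time_deriv.comp (continuous_id.prodMk continuous_const)
  have hx : ∀ x, 0 = synth (c i 0) x * φ 0 x +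
      ((∫ t in Ioc 0 T, synth (timeDeriv m B (fun j => c j t) i) x * φ t x) +
        ∫ t in Ioc 0 T, synth (c i t) x * deriv (fun s => φ s x) t) := by
    intro x
    have key := primitive_mul_primitive (v := fun t => synth (c i t) x) (χ := fun t => φ t x)
      (χ₀ := φ 0 x) (η := fun t => deriv (fun s => φ s x) t) hT.le (hih_x x)
      ((hcont' x).integrableOn_Ioc) (fun t ht => h.synth_eq i ht.1 x) (fun t ht => ?_)
      (((hih_x x).congr_set_ae Ioc_ae_eq_Icc.symm).mul_continuousOn (hcont x).continuousOn
        isCompact_Icc |>.mono_set Ioc_subset_Icc_self)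
      (((h.path i).integrableOn_synth x (by simp)).mul_continuousOn (hcont' x).continuousOn
        isCompact_Icc |>.mono_set Ioc_subset_Icc_self)
    · rw [← key, hφT T hτ.le x, mul_zero]
    · have := intervalIntegral.integral_eq_sub_of_hasDerivAt
        (fun s (_ : s ∈ uIcc 0 t) => hφ.hasDerivAt_time s x) ((hcont' x).intervalIntegrable _ _)
      rw [intervalIntegral.integral_of_le ht.1] at this
      rw [this]; ring
  have hA : ∫ x, u₀ x * φ 0 x = ∫ x, synth (c i 0) x * φ 0 x := by
    refine integral_congr_ae ?_
    filter_upwards [hu₀] with x hx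
    simp only [hx]
  have hsum : (∫ x, synth (c i 0) x * φ 0 x) +
      ((∫ p, synth (timeDeriv m B (fun j => c j p.1) i) p.2 * φ p.1 p.2 ∂(slab T)) +
        ∫ p, synth (c i p.1) p.2 * deriv (fun s => φ s p.2) p.1 ∂(slab T)) = 0 := by
    have hc0 : Integrable (fun x => synth (c i 0) x * φ 0 x) volume :=
      integrable_of_continuous ((continuous_synth ((h.path i).wNorm_ne_top 0)).mul
        (hφ.continuous.comp (continuous_const.prodMk continuous_id)))
    rw [← setIntegral_slice hi1, ← setIntegral_slice hi2, ← integral_add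
      (integrable_slice hi1) (integrable_slice hi2)]
    refine (integral_add hc0 ((integrable_slice hi1).add (integrable_slice hi2))).symm.trans ?_
    exact integral_eq_zero_of_ae (ae_of_all _ fun x => (hx x).symm)
  have hB : ∫ p, synth (timeDeriv m B (fun j => c j p.1) i) p.2 * φ p.1 p.2 ∂(slab T) =
      -(m i * ∫ p, velocity B c i p.1 p.2 * dx (φ p.1) p.2 ∂(slab T)) -
        ∫ p, synth (c i p.1) p.2 * velocity B c i p.1 p.2 * dx (φ p.1) p.2 ∂(slab T) := by
    have hi5 := (hi3.const_mul (m i : ℝ)).neg.sub hi4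
    rw [← integral_const_mul, ← integral_neg]
    refine Eq.trans ?_ (integral_sub (hi3.const_mul (m i : ℝ)).neg hi4)
    unfold slab at hi1 hi5 ⊢
    rw [integral_prod _ hi1]
    refine Eq.trans ?_ (integral_prod _ hi5).symm
    refine integral_congr_ae ?_
    filter_upwards [h.ae_integral_timeDeriv i T] with t ht
    rw [ht _ _ (hφ.isCn t).hasDx (hφ.isCn t).continuous_dx, ← integral_neg]
    refine integral_congr_ae (ae_of_all _ fun x => ?_)
    simp only [Pi.sub_apply, Pi.neg_apply]
    ring
  rw [hA]
  linear_combination -hsum + hB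

end

/-- The limit of the Picard iterates solves the system on the Fourier side. -/
theorem StableData.modeSolution {ι : Type*} [Fintype ι] [DecidableEq ι] {m : ι → ℝ≥0}
    {B : ι → ι → ℝ≥0} {V : ι → ℤ → ℂ} {U₀ : ι → ℤ → ℝ≥0∞} {β e₀ δ : ℝ≥0}
    (h : StableData m B U₀ β e₀ δ) (hV : ∀ i k, ‖V i k‖ₑ ≤ U₀ i k)
    (hVc : ∀ i k, V i (-k) = (starRingEnd ℂ) (V i k)) :
    ModeSolution m B (fun i t k => modes m B V i k t) e₀ := by
  have hpath : ∀ i, WienerPath (fun t k => modes m B V i k t) e₀ := fun i =>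
    { meas := fun k => h.measurable_modes hV i k
      zero := fun t => h.modes_zero hV i t
      bound := fun t => (Finset.single_le_sum (f := fun i => ∑' k, ‖modes m B V i k t‖ₑ)
        (fun _ _ => zero_le) (Finset.mem_univ i)).trans (h.mass_modes_le hV t)
      integrable := fun T => h.lintegral_dissip_modes_ne_top hV T i }
  refine ⟨hpath, fun i t k => h.modes_conj hV hVc i k t, fun i T => ?_, fun i k T hT => ?_⟩
  · rcases lt_or_ge T 0 with hT | hT
    · simp [Ioc_eq_empty (not_lt.2 hT.le)]
    have h1 : ∀ t, wNorm (timeDeriv m B (fun j k => modes m B V j k t) i) ≤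
        ((m i * B i i : ℝ≥0) : ℝ≥0∞) * dNorm (fun k => modes m B V i k t) +
          ∑ i, ∑' k, ‖rhs m B (fun j k => modes m B V j k t) i k‖ₑ := by
      intro t
      unfold wNorm timeDeriv dNorm dissip
      rw [← ENNReal.tsum_mul_left]
      refine (ENNReal.tsum_le_tsum fun k => enorm_add_le _ _).trans ?_
      rw [ENNReal.tsum_add]
      refine add_le_add (ENNReal.tsum_le_tsum fun k => ?_)
        (Finset.single_le_sum (f := fun i => ∑' k, ‖rhs m B (fun j k => modes m B V j k t) i k‖ₑ)
          (fun _ _ => zero_le) (Finset.mem_univ i))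
      have h2 : ‖((damping m B i k : ℝ) : ℂ)‖ₑ = ENNReal.ofReal (damping m B i k) := by
        rw [← ofReal_norm, Complex.norm_real, Real.norm_of_nonneg (damping_nonneg i k)]
      rw [enorm_neg, enorm_mul, h2, ofReal_damping, mul_assoc]
    refine ne_top_of_le_ne_top ?_ (lintegral_mono h1)
    rw [lintegral_add_left ((measurable_dNorm (hpath i).meas).const_mul _),
      lintegral_const_mul _ (measurable_dNorm (hpath i).meas)]
    exact ENNReal.add_ne_top.2 ⟨ENNReal.mul_ne_top ENNReal.coe_ne_top ((hpath i).integrable T),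
      h.lintegral_rhs_modes_ne_top hV hT⟩
  · have h0 := h.modes_integrated hV i k le_rfl
    rw [Ioc_self, setIntegral_empty, add_zero] at h0
    rw [h0]
    exact h.modes_integrated hV i k hT

/-! ### The thin film Muskat system -/

section

variable (P : Fluids) (f₀ g₀ : Torus → ℝ)

/-- The diffusion coefficients of the system. -/
def diffusion : Fin 2 → Fin 2 → ℝ≥0 :=
  ![![P.bρ.toNNReal, P.b.toNNReal], ![P.bμ.toNNReal, P.bμ.toNNReal]]

/-- The mean heights of the two fluids. -/
def means : Fin 2 → ℝ≥0 := ![(mean f₀).toNNReal, (mean g₀).toNNReal]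

/-- The Fourier coefficients of the initial datum. -/
def initialModes : Fin 2 → ℤ → ℂ := ![fourierHat (fluct f₀), fourierHat (fluct g₀)]

theorem Fluids.b_pos : 0 < P.b := P.ρp_pos

theorem Fluids.bμ_pos : 0 < P.bμ := mul_pos (div_pos P.μm_pos P.μp_pos) P.b_pos

theorem Fluids.bρ_pos : 0 < P.bρ := mul_pos (div_pos P.ρm_pos P.ρp_pos) P.b_pos

variable {f₀ g₀}

theorem of_wienerNorm_lt_top {s : ℝ} {u : Torus → ℝ} (h : wienerNorm s u < ∞) :
    Integrable u volume ∧ ∫ x, u x = 0 := by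
  by_contra hn
  rw [wienerNorm, iInf_neg hn] at h
  exact lt_irrefl _ h

theorem wienerNorm_zero_eq {u : Torus → ℝ} (h : wienerNorm 0 u < ∞) :
    wienerNorm 0 u = wNorm (fourierHat u) := by
  rw [wienerNorm, iInf_pos (of_wienerNorm_lt_top h)]
  simp [wNorm]

theorem fourierHat_zero_of_wienerNorm {s : ℝ} {u : Torus → ℝ} (h : wienerNorm s u < ∞) :
    fourierHat u 0 = 0 := by
  rw [fourierHat_zero, (of_wienerNorm_lt_top h).2]; simp

theorem initialSize_nonneg : 0 ≤ initialSize f₀ g₀ := by unfold initialSize; positivity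

/-- The smallness condition on the data, with `β = b_ρ + b + b_μ` as a bound for the coefficients:
`2β` is at most the factor `2b_ρ + 2b + 4b_μ` of the size of the data in `σ₁` and `σ₂`. -/
theorem stableData_of_decayRate (hf₀ : wienerNorm 0 (fluct f₀) < ∞)
    (hg₀ : wienerNorm 0 (fluct g₀) < ∞)
    (hsize : initialSize f₀ g₀ < min (mean f₀) (mean g₀)) (hσ : 0 < decayRate P f₀ g₀) :
    StableData (means f₀ g₀) (diffusion P) (fun i k => ‖initialModes f₀ g₀ i k‖ₑ)
      (P.bρ + P.b + P.bμ).toNNReal (initialSize f₀ g₀).toNNReal (decayRate P f₀ g₀).toNNReal := by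
  have hb := P.b_pos
  have hbμ := P.bμ_pos
  have hbρ := P.bρ_pos
  have hE : 0 ≤ initialSize f₀ g₀ := initialSize_nonneg
  have hm := lt_min_iff.1 hsize
  have hf : 0 ≤ mean f₀ := hE.trans hm.1.le
  have hg : 0 ≤ mean g₀ := hE.trans hm.2.le
  have h1 : decayRate P f₀ g₀ ≤ σ₁ P f₀ g₀ := min_le_left _ _
  have h2 : decayRate P f₀ g₀ ≤ σ₂ P f₀ g₀ := min_le_right _ _
  unfold σ₁ at h1
  unfold σ₂ at h2
  refine ⟨fun i j => ?_, Real.toNNReal_pos.2 hσ, fun j => ?_, fun i => ?_, ?_⟩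
  · fin_cases i <;> fin_cases j <;>
      exact Real.toNNReal_le_toNNReal (by linarith)
  · rw [← NNReal.coe_le_coe]
    push_cast
    rw [Real.coe_toNNReal _ hσ.le, Real.coe_toNNReal _ hE, Real.coe_toNNReal _ (by positivity)]
    have e0 : Finset.univ.erase (0 : Fin 2) = {1} := by decide
    have e1 : Finset.univ.erase (1 : Fin 2) = {0} := by decide
    fin_cases j
    · simp only [offDiag, Fin.zero_eta, e0, Finset.sum_singleton, means, diffusion]
      simp only [Matrix.cons_val_zero, Matrix.cons_val_one, Matrix.cons_val_fin_one, NNReal.coe_mul,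
        Real.coe_toNNReal _ hf, Real.coe_toNNReal _ hg,
        Real.coe_toNNReal _ hbμ.le, Real.coe_toNNReal _ hbρ.le]
      nlinarith [mul_nonneg hE hbμ.le]
    · simp only [offDiag, Fin.mk_one, e1, Finset.sum_singleton, means, diffusion]
      simp only [Matrix.cons_val_zero, Matrix.cons_val_one, Matrix.cons_val_fin_one, NNReal.coe_mul,
        Real.coe_toNNReal _ hf, Real.coe_toNNReal _ hg, Real.coe_toNNReal _ hb.le,
        Real.coe_toNNReal _ hbμ.le]
      nlinarith [mul_nonneg hE hbμ.le]
  · fin_cases i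
    · simpa [initialModes] using fourierHat_zero_of_wienerNorm hf₀
    · simpa [initialModes] using fourierHat_zero_of_wienerNorm hg₀
  · change ∑ i, wNorm (initialModes f₀ g₀ i) ≤ ENNReal.ofReal _
    rw [Fin.sum_univ_two]
    simp only [initialModes, Matrix.cons_val_zero, Matrix.cons_val_one, Matrix.cons_val_fin_one]
    rw [← wienerNorm_zero_eq hf₀, ← wienerNorm_zero_eq hg₀, initialSize,
      ENNReal.ofReal_add ENNReal.toReal_nonneg ENNReal.toReal_nonneg,
      ENNReal.ofReal_toReal hf₀.ne, ENNReal.ofReal_toReal hg₀.ne]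

theorem WienerPath.isSpaceDeriv {c : ℝ → ℤ → ℂ} {e₀ : ℝ≥0} (h : WienerPath c e₀) (T : ℝ) :
    IsSpaceDeriv T (fun t => synth (c t)) (fun t => synth (dCoeff (c t))) := by
  refine ⟨h.integrable_slab T, integrable_slab_of_bound
    (measurable_synth_path (measurable_dCoeff_path h.meas)) (fun t x => (enorm_synth_le _ x).trans
      (wNorm_dCoeff_le_dNorm _)) (lintegral_Ioo_ne_top (h.integrable T)), ?_⟩
  filter_upwards [h.ae_dNorm_ne_top T] with t ht
  exact (hasDx_synth (h.wNorm_ne_top t) (wNorm_dCoeff_ne_top ht)).hasWeakDeriv_one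
    (continuous_synth (wNorm_dCoeff_ne_top ht))

theorem ModeSolution.isWeakSolution {c : Fin 2 → ℝ → ℤ → ℂ} {e₀ : ℝ≥0}
    (h : ModeSolution (means f₀ g₀) (diffusion P) c e₀) (hf : 0 ≤ mean f₀) (hg : 0 ≤ mean g₀)
    (hf₀ : fluct f₀ =ᵐ[volume] synth (c 0 0)) (hg₀ : fluct g₀ =ᵐ[volume] synth (c 1 0)) {T : ℝ}
    (hT : 0 < T) :
    IsWeakSolution P f₀ g₀ T (fun t => synth (c 0 t)) (fun t => synth (c 1 t)) := by
  refine ⟨(h.path 0).memBochner_sobolev T, (h.path 1).memBochner_sobolev T,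
    ae_of_all _ fun t => synth_zero_mean ((h.path 0).zero t) ((h.path 0).wNorm_ne_top t),
    ae_of_all _ fun t => synth_zero_mean ((h.path 1).zero t) ((h.path 1).wNorm_ne_top t),
    fun t => synth (dCoeff (c 0 t)), fun t => synth (dCoeff (c 1 t)),
    (h.path 0).isSpaceDeriv T, (h.path 1).isSpaceDeriv T, ?_, ?_⟩
  · have := h.weakEq 0 hT hf₀
    have e : velocity (diffusion P) c 0 = fun t x => P.bρ * synth (dCoeff (c 0 t)) x +
        P.b * synth (dCoeff (c 1 t)) x := by
      funext t x
      simp [velocity, Fin.sum_univ_two, diffusion, P.bρ_pos.le, P.b_pos.le]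
    rw [e] at this
    simpa only [means, Matrix.cons_val_zero, Real.coe_toNNReal _ hf] using this
  · have := h.weakEq 1 hT hg₀
    have e : velocity (diffusion P) c 1 = fun t x => P.bμ * synth (dCoeff (c 0 t)) x +
        P.bμ * synth (dCoeff (c 1 t)) x := by
      funext t x
      simp [velocity, Fin.sum_univ_two, diffusion, P.bμ_pos.le]
    rw [e] at this
    simpa only [means, Matrix.cons_val_one, Matrix.cons_val_fin_one, Real.coe_toNNReal _ hg]
      using this

/-- The global solution, in terms of its Fourier coefficients. -/
theorem exists_modeSolution (hf₀ : wienerNorm 0 (fluct f₀) < ∞) (hg₀ : wienerNorm 0 (fluct g₀) < ∞)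
    (hsize : initialSize f₀ g₀ < min (mean f₀) (mean g₀)) (hσ : 0 < decayRate P f₀ g₀) :
    ∃ c : Fin 2 → ℝ → ℤ → ℂ,
      ModeSolution (means f₀ g₀) (diffusion P) c (initialSize f₀ g₀).toNNReal ∧
      (∀ i, c i 0 = initialModes f₀ g₀ i) ∧
      ∀ t, 0 ≤ t → wNorm (c 0 t) + wNorm (c 1 t) ≤
        ENNReal.ofReal (initialSize f₀ g₀ * Real.exp (-(decayRate P f₀ g₀ * t))) := by
  have h := stableData_of_decayRate P hf₀ hg₀ hsize hσ
  have hV : ∀ i k, ‖initialModes f₀ g₀ i k‖ₑ ≤ ‖initialModes f₀ g₀ i k‖ₑ := fun _ _ => le_rfl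
  have hinit : ∀ i k, modes (means f₀ g₀) (diffusion P) (initialModes f₀ g₀) i k 0 =
      initialModes f₀ g₀ i k := by
    intro i k
    have h0 := h.modes_integrated hV i k le_rfl
    rwa [Ioc_self, setIntegral_empty, add_zero] at h0
  refine ⟨_, h.modeSolution hV fun i k => ?_, fun i => funext (hinit i), fun t ht => ?_⟩
  · fin_cases i <;> exact fourierHat_neg _ k
  · have h1 := h.exp_mul_mass_modes_le hV ht
    rw [mass, Fin.sum_univ_two, Real.coe_toNNReal _ hσ.le] at h1
    rw [mul_comm, ENNReal.ofReal_mul (Real.exp_pos _).le, Real.exp_neg,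
      ENNReal.ofReal_inv_of_pos (Real.exp_pos _), mul_comm, ← div_eq_mul_inv,
      ENNReal.le_div_iff_mul_le (Or.inl (by simp [Real.exp_pos])) (Or.inl ENNReal.ofReal_ne_top),
      mul_comm]
    exact h1

theorem eLpNorm_synth_top_le (c : ℤ → ℂ) : eLpNorm (synth c) ∞ volume ≤ wNorm c := by
  rw [eLpNorm_exponent_top]
  exact eLpNormEssSup_le_of_ae_enorm_bound (ae_of_all _ fun x => enorm_synth_le c x)

end

/-! ### An integral Gronwall inequality -/

/-- The fundamental theorem of calculus for powers of a primitive of an integrable function. -/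
theorem primitive_pow {M : ℝ → ℝ} {T : ℝ} (hM : IntegrableOn M (Ioc 0 T)) (n : ℕ) :
    ∀ t ∈ Icc 0 T, (∫ s in Ioc 0 t, M s) ^ (n + 1) =
      ∫ s in Ioc 0 t, (n + 1) * M s * (∫ r in Ioc 0 s, M r) ^ n := by
  have hsub : ∀ t ∈ Icc 0 T, IntegrableOn M (Ioc 0 t) := fun t ht =>
    hM.mono_set (Ioc_subset_Ioc_right ht.2)
  have hc : ContinuousOn (fun s => ∫ r in Ioc 0 s, M r) (Icc 0 T) :=
    intervalIntegral.continuousOn_primitive ((integrableOn_Icc_iff_integrableOn_Ioc (by simp)).2 hM)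
  have hi : ∀ n : ℕ, ∀ t ∈ Icc 0 T,
      IntegrableOn (fun s => M s * (∫ r in Ioc 0 s, M r) ^ n) (Ioc 0 t) := fun n t ht =>
    ((((integrableOn_Icc_iff_integrableOn_Ioc (by simp)).2 hM).mul_continuousOn (hc.pow n)
      isCompact_Icc).mono_set Ioc_subset_Icc_self).mono_set (Ioc_subset_Ioc_right ht.2)
  induction n with
  | zero => intro t _; simp
  | succ n ih =>
    intro t ht
    have key := primitive_mul_primitive (v := fun t => (∫ s in Ioc 0 t, M s) ^ (n + 1))
      (χ := fun t => ∫ s in Ioc 0 t, M s) (v₀ := 0) (χ₀ := 0) (η := M)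
      (h := fun s => (n + 1) * M s * (∫ r in Ioc 0 s, M r) ^ n) ht.1 ?_ (hsub t ht)
      (fun s hs => by rw [zero_add]; exact ih s ⟨hs.1, hs.2.trans ht.2⟩)
      (fun s _ => (zero_add _).symm) ?_ ?_
    · rw [pow_succ, key, mul_zero, zero_add, ← integral_add]
      · refine integral_congr_ae (ae_of_all _ fun s => ?_)
        push_cast; ring
      · exact IntegrableOn.congr_fun ((hi (n + 1) t ht).const_mul (n + 1 : ℝ))
          (fun s _ => by ring) measurableSet_Ioc
      · exact (hi (n + 1) t ht).congr_fun (fun s _ => by ring) measurableSet_Ioc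
    · exact IntegrableOn.congr_fun ((hi n t ht).const_mul (n + 1 : ℝ))
          (fun s _ => by ring) measurableSet_Ioc
    · exact IntegrableOn.congr_fun ((hi (n + 1) t ht).const_mul (n + 1 : ℝ))
          (fun s _ => by ring) measurableSet_Ioc
    · exact (hi (n + 1) t ht).congr_fun (fun s _ => by ring) measurableSet_Ioc

/-- Gronwall's inequality for a bounded function and an integrable coefficient. -/
theorem ae_eq_zero_of_le_integral {z M : ℝ → ℝ} {T C : ℝ} (hM : IntegrableOn M (Ioc 0 T))
    (hM0 : ∀ t, 0 ≤ M t) (hz0 : ∀ t, 0 ≤ z t) (hzC : ∀ t, z t ≤ C)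
    (hzm : AEStronglyMeasurable z (volume.restrict (Ioc 0 T)))
    (hz : ∀ᵐ t ∂(volume.restrict (Ioc 0 T)), z t ≤ ∫ s in Ioc 0 t, M s * z s) :
    ∀ᵐ t ∂(volume.restrict (Ioc 0 T)), z t = 0 := by
  have hC : 0 ≤ C := (hz0 0).trans (hzC 0)
  have hc : ContinuousOn (fun s => ∫ r in Ioc 0 s, M r) (Icc 0 T) :=
    intervalIntegral.continuousOn_primitive ((integrableOn_Icc_iff_integrableOn_Ioc (by simp)).2 hM)
  have hMz : IntegrableOn (fun s => M s * z s) (Ioc 0 T) :=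
    Integrable.mul_bdd (c := C) hM hzm (ae_of_all _ fun t => by
      rw [Real.norm_of_nonneg (hz0 t)]; exact hzC t)
  -- Iterating the inequality `n` times gives the `n`-th term of an exponential series.
  have hbound : ∀ n : ℕ, ∀ᵐ t ∂(volume.restrict (Ioc 0 T)),
      z t ≤ C * ((∫ s in Ioc 0 t, M s) ^ n / n.factorial) := by
    intro n
    induction n with
    | zero => exact ae_of_all _ fun t => by simpa using hzC t
    | succ n ih =>
      filter_upwards [hz, ae_restrict_mem measurableSet_Ioc] with t ht htT
      refine ht.trans ?_
      have hsub : Ioc 0 t ⊆ Ioc 0 T := Ioc_subset_Ioc_right htT.2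
      have hi : IntegrableOn (fun s => M s * (C * ((∫ r in Ioc 0 s, M r) ^ n / n.factorial)))
          (Ioc 0 t) := by
        refine ((((integrableOn_Icc_iff_integrableOn_Ioc (by simp)).2 hM).mul_continuousOn
          (continuousOn_const.mul ((hc.pow n).div_const _)) isCompact_Icc).mono_set
          Ioc_subset_Icc_self).mono_set hsub
      calc ∫ s in Ioc 0 t, M s * z s
          ≤ ∫ s in Ioc 0 t, M s * (C * ((∫ r in Ioc 0 s, M r) ^ n / n.factorial)) := by
            refine integral_mono_ae (hMz.mono_set hsub) hi ?_
            filter_upwards [ae_restrict_of_ae_restrict_of_subset hsub ih] with s hs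
            exact mul_le_mul_of_nonneg_left hs (hM0 s)
        _ = ∫ s in Ioc 0 t, C / (n + 1).factorial *
              ((n + 1) * M s * (∫ r in Ioc 0 s, M r) ^ n) := by
            refine integral_congr_ae (ae_of_all _ fun s => ?_)
            simp only
            rw [Nat.factorial_succ]
            push_cast
            have : (n.factorial : ℝ) ≠ 0 := by positivity
            field_simp
        _ = _ := by
            rw [integral_const_mul, ← primitive_pow hM n t ⟨htT.1.le, htT.2⟩]
            ring
  filter_upwards [ae_all_iff.2 hbound] with t ht
  have h1 : Tendsto (fun n : ℕ => C * ((∫ s in Ioc 0 t, M s) ^ n / n.factorial)) atTop (𝓝 0) := by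
    simpa using (FloorSemiring.tendsto_pow_div_factorial_atTop (∫ s in Ioc 0 t, M s)).const_mul C
  exact le_antisymm (ge_of_tendsto' h1 ht) (hz0 t)

/-! ### Parseval's identity -/

theorem integral_torus_eq (u : Torus → ℝ) :
    ((∫ x, u x : ℝ) : ℂ) = 2 * Real.pi * fourierCoeff (fun x => (u x : ℂ)) 0 := by
  have h := fourierHat_zero u
  unfold fourierHat at h
  rw [h]
  have : (Real.pi : ℂ) ≠ 0 := by exact_mod_cast Real.pi_ne_zero
  push_cast
  field_simp

/-- Parseval's identity, read off from the zeroth Fourier coefficient of the product. -/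
theorem parseval_synth {a b : ℤ → ℂ} (ha : wNorm a ≠ ∞) (hb : wNorm b ≠ ∞)
    (hac : ∀ k, a (-k) = (starRingEnd ℂ) (a k)) (hbc : ∀ k, b (-k) = (starRingEnd ℂ) (b k)) :
    ((∫ x, synth a x * synth b x : ℝ) : ℂ) =
      2 * Real.pi * ∑' k, a k * (starRingEnd ℂ) (b k) := by
  rw [integral_torus_eq]
  congr 1
  have h1 : (fun x => ((synth a x * synth b x : ℝ) : ℂ)) =
      fourierSeries (fun k => ∑' l, a (k - l) * b l) := by
    funext x
    rw [← fourierSeries_mul ha hb, Complex.ofReal_mul, ofReal_synth_of_conj hac,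
      ofReal_synth_of_conj hbc]
  rw [h1, fourierCoeff_fourierSeries (wNorm_convolution_ne_top ha hb), ← (Equiv.neg ℤ).tsum_eq]
  refine tsum_congr fun k => ?_
  rw [Equiv.neg_apply, hbc, zero_sub, neg_neg]

/-- Parseval's identity in `[0, ∞]`. -/
theorem tsum_enorm_sq_eq {a : ℤ → ℂ} (ha : wNorm a ≠ ∞)
    (hac : ∀ k, a (-k) = (starRingEnd ℂ) (a k)) :
    ∑' k, ‖a k‖ₑ ^ 2 = ENNReal.ofReal ((2 * Real.pi)⁻¹ * ∫ x, synth a x ^ 2) := by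
  have h1 := parseval_synth ha ha hac hac
  have h2 : ∑' k, a k * (starRingEnd ℂ) (a k) = ((∑' k, ‖a k‖ ^ 2 : ℝ) : ℂ) := by
    rw [Complex.ofReal_tsum]
    refine tsum_congr fun k => ?_
    rw [Complex.mul_conj, Complex.normSq_eq_norm_sq]
  have h3 : ∫ x, synth a x * synth a x = 2 * Real.pi * ∑' k, ‖a k‖ ^ 2 := by
    rw [h2] at h1
    exact_mod_cast h1
  have h4 : (2 * Real.pi)⁻¹ * ∫ x, synth a x ^ 2 = ∑' k, ‖a k‖ ^ 2 := by
    simp only [sq] at h3 ⊢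
    rw [h3, inv_mul_cancel_left₀ Real.two_pi_pos.ne']
  rw [h4, ENNReal.ofReal_tsum_of_nonneg (fun k => sq_nonneg _)]
  · exact tsum_congr fun k => by rw [ENNReal.ofReal_pow (norm_nonneg _), ofReal_norm]
  · have hs := summable_norm_of_wNorm ha
    have h5 := (hs.mul_norm hs).comp_injective (i := fun k : ℤ => (k, k))
      fun k l hkl => congrArg Prod.fst hkl
    refine h5.congr fun k => ?_
    simp only [Function.comp_apply, norm_mul, sq]

section

variable {ι : Type*} [Fintype ι] [DecidableEq ι] {m : ι → ℝ≥0} {B : ι → ι → ℝ≥0}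

/-! ### The energy inequality at a fixed time -/

/-- The diffusion matrix `(yᵢ + mᵢ) Bᵢⱼ` is nonnegative at all states `y` of size at most `E`. -/
def IsParabolic (m : ι → ℝ≥0) (B : ι → ι → ℝ≥0) (E : ℝ) : Prop :=
  ∀ y v : ι → ℝ, (∀ i, |y i| ≤ E) → 0 ≤ ∑ i, (y i + m i) * (∑ j, (B i j : ℝ) * v j) * v i

/-- A bound for the derivatives of all the velocities. -/
def stretch (B : ι → ι → ℝ≥0) (a : ι → ℤ → ℂ) : ℝ≥0∞ := ∑ i, ∑ j, B i j * dNorm (a j)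

theorem HasDx.const_mul_sum {u u' : ι → Torus → ℝ} (h : ∀ j, HasDx (u j) (u' j)) (r : ι → ℝ) :
    HasDx (fun x => ∑ j, r j * u j x) (fun x => ∑ j, r j * u' j x) := fun y =>
  HasDerivAt.fun_sum fun j _ => (h j y).const_mul (r j)

theorem HasDx.sub {u u' v v' : Torus → ℝ} (hu : HasDx u u') (hv : HasDx v v') :
    HasDx (fun x => u x - v x) (fun x => u' x - v' x) := fun y => (hu y).sub (hv y)

theorem stretch_ne_top {a : ι → ℤ → ℂ} (h : ∀ i, dNorm (a i) ≠ ∞) : stretch B a ≠ ∞ :=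
  (ENNReal.sum_lt_top.2 fun _ _ => ENNReal.sum_lt_top.2 fun j _ =>
    ENNReal.mul_lt_top ENNReal.coe_lt_top (h j).lt_top).ne

theorem abs_sum_synth_le_stretch {a : ι → ℤ → ℂ} (h : ∀ i, dNorm (a i) ≠ ∞) (i : ι) (x : Torus) :
    |∑ j, (B i j : ℝ) * synth (dCoeff (dCoeff (a j))) x| ≤ (stretch B a).toReal := by
  rw [← Real.norm_eq_abs, ← toReal_enorm]
  refine ENNReal.toReal_mono (stretch_ne_top h) ?_
  refine le_trans ?_ (Finset.single_le_sum (f := fun i => ∑ j, (B i j : ℝ≥0∞) * dNorm (a j))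
    (fun _ _ => zero_le) (Finset.mem_univ i))
  refine (enorm_sum_le _ _).trans (Finset.sum_le_sum fun j _ => ?_)
  rw [enorm_mul, ← wNorm_dCoeff_dCoeff]
  have hB : ‖(B i j : ℝ)‖ₑ = B i j := by
    rw [← ofReal_norm, Real.norm_of_nonneg (B i j).coe_nonneg, ENNReal.ofReal_coe_nnreal]
  rw [hB]
  gcongr
  exact enorm_synth_le _ x

/-- The fluxes of two states differ by `(bᵢ + mᵢ) ∑ⱼ Bᵢⱼ ∂ₓwⱼ + wᵢ qᵢ` with `w = a - b` and `qᵢ = ∑ⱼ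
Bᵢⱼ ∂ₓaⱼ`. Tested with `∂ₓw` the first part has a sign by parabolicity at `b`, and the second one is
`-½ ∫ wᵢ² ∂ₓqᵢ` after an integration by parts. Only `b` has to be in the region of parabolicity. -/
theorem energy_inequality {E : ℝ} (hE : IsParabolic m B E) {a b : ι → ℤ → ℂ}
    (ha₀ : ∀ i, a i 0 = 0) (hb₀ : ∀ i, b i 0 = 0) (ha : ∀ i, dNorm (a i) ≠ ∞)
    (hb : ∀ i, dNorm (b i) ≠ ∞) (hac : ∀ i k, a i (-k) = (starRingEnd ℂ) (a i k))
    (hbc : ∀ i k, b i (-k) = (starRingEnd ℂ) (b i k)) (hbE : ∀ i x, |synth (b i) x| ≤ E) :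
    -∑ i, ∫ x, (synth (totalFlux m B a i) x - synth (totalFlux m B b i) x) *
        (synth (dCoeff (a i)) x - synth (dCoeff (b i)) x) ≤
      2⁻¹ * ((stretch B a).toReal * ∑ i, ∫ x, (synth (a i) x - synth (b i) x) ^ 2) := by
  have hwa := fun i => wNorm_ne_top (ha₀ i) (ha i)
  have hwb := fun i => wNorm_ne_top (hb₀ i) (hb i)
  have hwa' := fun i => wNorm_dCoeff_ne_top (ha i)
  have hwb' := fun i => wNorm_dCoeff_ne_top (hb i)
  have hwa'' : ∀ i, wNorm (dCoeff (dCoeff (a i))) ≠ ∞ := fun i => by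
    rw [wNorm_dCoeff_dCoeff]; exact ha i
  have hw := fun i => (hasDx_synth (hwa i) (hwa' i)).sub (hasDx_synth (hwb i) (hwb' i))
  have hcw' := fun i => (continuous_synth (hwa' i)).sub (continuous_synth (hwb' i))
  have hcw := fun i => (continuous_synth (hwa i)).sub (continuous_synth (hwb i))
  have hq := fun i => HasDx.const_mul_sum (fun j => hasDx_synth (hwa' j) (hwa'' j))
    (fun j => (B i j : ℝ))
  have hcq : ∀ i, Continuous fun x => ∑ j, (B i j : ℝ) * synth (dCoeff (a j)) x := fun i =>
    (hq i).continuous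
  have hcq' : ∀ i, Continuous fun x => ∑ j, (B i j : ℝ) * synth (dCoeff (dCoeff (a j))) x :=
    fun i => continuous_finsetSum _ fun j _ => continuous_const.mul (continuous_synth (hwa'' j))
  set w : ι → Torus → ℝ := fun i x => synth (a i) x - synth (b i) x with hw_def
  set w' : ι → Torus → ℝ := fun i x => synth (dCoeff (a i)) x - synth (dCoeff (b i)) x with hw'_def
  set q : ι → Torus → ℝ := fun i x => ∑ j, (B i j : ℝ) * synth (dCoeff (a j)) x with hq_def
  set q' : ι → Torus → ℝ := fun i x => ∑ j, (B i j : ℝ) * synth (dCoeff (dCoeff (a j))) x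
    with hq'_def
  set Q : ι → Torus → ℝ := fun i x => (synth (b i) x + m i) * (∑ j, (B i j : ℝ) * w' j x) * w' i x
    with hQ_def
  have hcQ : ∀ i, Continuous (Q i) := fun i =>
    (((continuous_synth (hwb i)).add continuous_const).mul
      (continuous_finsetSum _ fun j _ => continuous_const.mul (hcw' j))).mul (hcw' i)
  have hsplit : ∀ i x, (synth (totalFlux m B a i) x - synth (totalFlux m B b i) x) * w' i x =
      Q i x + w i x * w' i x * q i x := by
    intro i x
    rw [synth_totalFlux hwa hwa' hac, synth_totalFlux hwb hwb' hbc]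
    have h1 : ∑ j, (B i j : ℝ) * w' j x = q i x - ∑ j, (B i j : ℝ) * synth (dCoeff (b j)) x := by
      rw [hq_def, ← Finset.sum_sub_distrib]
      exact Finset.sum_congr rfl fun j _ => mul_sub _ _ _
    simp only [hQ_def, h1]
    simp only [hw_def, hq_def]
    ring
  have hnonneg : 0 ≤ ∑ i, ∫ x, Q i x := by
    rw [← integral_finsetSum _ fun i _ => integrable_of_continuous (hcQ i)]
    exact integral_nonneg fun x => hE (fun i => synth (b i) x) (fun i => w' i x) fun i => hbE i x
  have hibp : ∀ i, -∫ x, w i x * w' i x * q i x = 2⁻¹ * ∫ x, w i x ^ 2 * q' i x := by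
    intro i
    have h1 := ((hw i).mul (hw i)).integral_mul (hq i)
      (((hcw' i).mul (hcw i)).add ((hcw i).mul (hcw' i))) (hcq' i)
    have h2 : ∫ x, w i x ^ 2 * q' i x = -(2 * ∫ x, w i x * w' i x * q i x) := by
      rw [← integral_const_mul]
      refine Eq.trans ?_ (h1.trans ?_)
      · exact integral_congr_ae (ae_of_all _ fun x => by simp only [sq, hw_def, hq'_def])
      · congr 1
        exact integral_congr_ae (ae_of_all _ fun x => by simp only [hw_def, hw'_def, hq_def]; ring)
    rw [h2]; ring
  have hle : ∀ i, ∫ x, w i x ^ 2 * q' i x ≤ (stretch B a).toReal * ∫ x, w i x ^ 2 := by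
    intro i
    rw [← integral_const_mul]
    refine integral_mono (integrable_of_continuous (((hcw i).pow 2).mul (hcq' i)))
      (integrable_of_continuous (continuous_const.mul ((hcw i).pow 2))) fun x => ?_
    simp only
    rw [mul_comm]
    exact mul_le_mul_of_nonneg_right ((le_abs_self _).trans (abs_sum_synth_le_stretch ha i x))
      (sq_nonneg _)
  calc -∑ i, ∫ x, (synth (totalFlux m B a i) x - synth (totalFlux m B b i) x) * w' i x
      = -(∑ i, ∫ x, Q i x) + ∑ i, -∫ x, w i x * w' i x * q i x := by
        rw [Finset.sum_neg_distrib, ← neg_add, ← Finset.sum_add_distrib]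
        congr 1
        refine Finset.sum_congr rfl fun i _ => ?_
        exact (integral_congr_ae (ae_of_all _ fun x => hsplit i x)).trans
          (integral_add (integrable_of_continuous (hcQ i))
            (integrable_of_continuous (((hcw i).mul (hcw' i)).mul (hcq i))))
    _ ≤ ∑ i, -∫ x, w i x * w' i x * q i x := by linarith
    _ = 2⁻¹ * ∑ i, ∫ x, w i x ^ 2 * q' i x := by
        rw [Finset.mul_sum]
        exact Finset.sum_congr rfl fun i _ => hibp i
    _ ≤ _ := by
        refine mul_le_mul_of_nonneg_left ?_ (by norm_num)
        rw [Finset.mul_sum]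
        exact Finset.sum_le_sum fun i _ => hle i

end

/-! ### The energy identity mode by mode -/

open ComplexConjugate in
/-- The derivative of `|w|²` for an absolutely continuous `w`, in integrated form. -/
theorem mode_normSq {r w : ℝ → ℂ} {T : ℝ} (hr : IntegrableOn r (Ioc 0 T))
    (hw : ∀ᵐ t ∂(volume.restrict (Ioc 0 T)), w t = ∫ s in Ioc 0 t, r s) :
    ∀ᵐ t ∂(volume.restrict (Ioc 0 T)), ‖w t‖ ^ 2 = ∫ s in Ioc 0 t, 2 * (r s * conj (w s)).re := by
  filter_upwards [hw, ae_restrict_mem measurableSet_Ioc] with t ht htT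
  have hsub : Ioc 0 t ⊆ Ioc 0 T := Ioc_subset_Ioc_right htT.2
  have hrI : IntegrableOn r (Icc 0 t) :=
    (integrableOn_Icc_iff_integrableOn_Ioc (by simp)).2 (hr.mono_set hsub)
  have hc : ContinuousOn (fun s => ∫ u in Ioc 0 s, r u) (Icc 0 t) :=
    intervalIntegral.continuousOn_primitive hrI
  have hrc : IntegrableOn (fun s => conj (r s)) (Icc 0 t) :=
    (RCLike.conjLIE (K := ℂ)).toContinuousLinearEquiv.toContinuousLinearMap.integrable_comp hrI
  have hcc : ContinuousOn (fun s => conj (∫ u in Ioc 0 s, r u)) (Icc 0 t) :=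
    Complex.continuous_conj.comp_continuousOn hc
  have hi₁ : IntegrableOn (fun s => r s * conj (∫ u in Ioc 0 s, r u)) (Ioc 0 t) :=
    (hrI.mul_continuousOn hcc isCompact_Icc).mono_set Ioc_subset_Icc_self
  have hi₂ : IntegrableOn (fun s => (∫ u in Ioc 0 s, r u) * conj (r s)) (Ioc 0 t) :=
    (hrc.continuousOn_mul hc isCompact_Icc).mono_set Ioc_subset_Icc_self
  have key := primitive_mul_primitive (v := fun s => ∫ u in Ioc 0 s, r u)
    (χ := fun s => conj (∫ u in Ioc 0 s, r u)) (v₀ := 0) (χ₀ := 0) (h := r)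
    (η := fun s => conj (r s)) htT.1.le (hr.mono_set hsub) (hrc.mono_set Ioc_subset_Icc_self)
    (fun s _ => (zero_add _).symm) (fun s _ => by rw [zero_add, integral_conj]) hi₁ hi₂
  rw [← ht, mul_zero, zero_add, ← integral_add hi₁ hi₂, Complex.mul_conj,
    Complex.normSq_eq_norm_sq] at key
  have h2 : ∫ s in Ioc 0 t,
      (r s * conj (∫ u in Ioc 0 s, r u) + (∫ u in Ioc 0 s, r u) * conj (r s)) =
      ((∫ s in Ioc 0 t, 2 * (r s * conj (w s)).re : ℝ) : ℂ) := by
    rw [← integral_complex_ofReal]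
    refine integral_congr_ae ?_
    filter_upwards [ae_restrict_of_ae_restrict_of_subset hsub hw] with s hs
    rw [← hs]
    have : w s * conj (r s) = conj (r s * conj (w s)) := by
      rw [map_mul, Complex.conj_conj, mul_comm]
    rw [this, Complex.add_conj]
  rw [h2] at key
  exact_mod_cast key

/-- The energy density `-2 ∑ₖ Re(sₖ conj (ik wₖ))`. -/
def energyRate (s w : ℤ → ℂ) : ℝ := ∑' k, -2 * (s k * (starRingEnd ℂ) (dCoeff w k)).re

theorem enorm_energyRate_term (s w : ℤ → ℂ) (k : ℤ) :
    ‖-2 * (s k * (starRingEnd ℂ) (dCoeff w k)).re‖ₑ ≤ 2 * (‖s k‖ₑ * ‖dCoeff w k‖ₑ) := by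
  rw [enorm_mul]
  have : ‖(-2 : ℝ)‖ₑ = 2 := by rw [← ofReal_norm]; norm_num
  rw [this]
  gcongr
  refine (enorm_re_le _).trans ?_
  rw [enorm_mul, enorm_conj]

section

variable {s w : ℝ → ℤ → ℂ} {T : ℝ}

theorem measurable_energyRate_term (hs : ∀ k, Measurable fun t => s t k)
    (hw : ∀ k, Measurable fun t => w t k) (k : ℤ) :
    Measurable fun t => -2 * (s t k * (starRingEnd ℂ) (dCoeff (w t) k)).re := by
  unfold dCoeff
  have := hs k
  have := hw k
  have hc : Measurable (starRingEnd ℂ : ℂ → ℂ) := Complex.continuous_conj.measurable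
  exact (Complex.measurable_re.comp ((hs k).mul (hc.comp ((hw k).const_mul _)))).const_mul _

theorem lintegral_energyRate_ne_top
    (hfin : ∫⁻ t in Ioc 0 T, ∑' k, ‖s t k‖ₑ * ‖dCoeff (w t) k‖ₑ ≠ ∞) :
    ∫⁻ t in Ioc 0 T, ∑' k, ‖-2 * (s t k * (starRingEnd ℂ) (dCoeff (w t) k)).re‖ₑ ≠ ∞ := by
  refine ne_top_of_le_ne_top (ENNReal.mul_ne_top (by norm_num : (2 : ℝ≥0∞) ≠ ∞) hfin) ?_
  rw [← lintegral_const_mul' _ _ (by norm_num)]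
  refine lintegral_mono fun t => ?_
  simp only
  rw [← ENNReal.tsum_mul_left]
  exact ENNReal.tsum_le_tsum fun k => enorm_energyRate_term _ _ k

theorem integrableOn_energyRate (hs : ∀ k, Measurable fun t => s t k)
    (hw : ∀ k, Measurable fun t => w t k)
    (hfin : ∫⁻ t in Ioc 0 T, ∑' k, ‖s t k‖ₑ * ‖dCoeff (w t) k‖ₑ ≠ ∞) :
    IntegrableOn (fun t => energyRate (s t) (w t)) (Ioc 0 T) := by
  refine ⟨(Measurable.tsum fun k => measurable_energyRate_term hs hw k).aestronglyMeasurable, ?_⟩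
  refine lt_of_le_of_lt (lintegral_mono fun t => ?_) (lintegral_energyRate_ne_top hfin).lt_top
  exact enorm_tsum_le_tsum_enorm

/-- If `∂ₜw = ∂ₓs` and `w(0) = 0` in terms of Fourier coefficients, then
`∑ |wₖ(t)|² = -2 ∫₀ᵗ Re ∑ sₖ conj (ik wₖ)`. -/
theorem tsum_normSq_eq_integral (hs : ∀ k, Measurable fun t => s t k)
    (hw : ∀ k, Measurable fun t => w t k)
    (hfin : ∫⁻ t in Ioc 0 T, ∑' k, ‖s t k‖ₑ * ‖dCoeff (w t) k‖ₑ ≠ ∞)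
    (hsi : ∀ k, IntegrableOn (fun t => dCoeff (s t) k) (Ioc 0 T))
    (heq : ∀ k, ∀ᵐ t ∂(volume.restrict (Ioc 0 T)), w t k = ∫ r in Ioc 0 t, dCoeff (s r) k) :
    ∀ᵐ t ∂(volume.restrict (Ioc 0 T)),
      ∑' k, ‖w t k‖ ^ 2 = ∫ r in Ioc 0 t, energyRate (s r) (w r) := by
  filter_upwards [ae_all_iff.2 fun k => mode_normSq (hsi k) (heq k),
    ae_restrict_mem measurableSet_Ioc] with t ht htT
  have hsub : Ioc 0 t ⊆ Ioc 0 T := Ioc_subset_Ioc_right htT.2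
  set F : ℤ → ℝ → ℝ := fun k r => -2 * (s r k * (starRingEnd ℂ) (dCoeff (w r) k)).re with hF
  have hFm : ∀ k, Measurable (F k) := measurable_energyRate_term hs hw
  have hsum : ∑' k, ∫⁻ r in Ioc 0 t, ‖F k r‖ₑ ≠ ∞ := by
    rw [← lintegral_tsum fun k => (hFm k).enorm.aemeasurable]
    exact ne_top_of_le_ne_top (lintegral_energyRate_ne_top hfin) (lintegral_mono_set hsub)
  have hFi : ∀ k, IntegrableOn (F k) (Ioc 0 t) := fun k =>
    ⟨(hFm k).aestronglyMeasurable, (ENNReal.ne_top_of_tsum_ne_top hsum k).lt_top⟩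
  have hFs : Summable fun k => ∫ r in Ioc 0 t, ‖F k r‖ := by
    simp only [integral_norm_eq_lintegral_enorm (hFm _).aestronglyMeasurable]
    exact ENNReal.summable_toReal hsum
  have h1 := (hasSum_integral_of_summable_integral_norm hFi hFs).tsum_eq
  unfold energyRate
  rw [← h1]
  refine tsum_congr fun k => ?_
  rw [ht k]
  refine integral_congr_ae (ae_of_all _ fun r => ?_)
  simp only [hF, dCoeff, map_mul, Complex.conj_I, map_intCast]
  have : Complex.I * k * s r k * (starRingEnd ℂ) (w r k) =
      -(s r k * (-Complex.I * k * (starRingEnd ℂ) (w r k))) := by ring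
  rw [this, Complex.neg_re]; ring

end

/-- The energy density in physical space, by Parseval's identity. -/
theorem energyRate_eq {s w : ℤ → ℂ} (hs : wNorm s ≠ ∞) (hw : wNorm (dCoeff w) ≠ ∞)
    (hsc : ∀ k, s (-k) = (starRingEnd ℂ) (s k)) (hwc : ∀ k, w (-k) = (starRingEnd ℂ) (w k)) :
    energyRate s w = (2 * Real.pi)⁻¹ * (-2 * ∫ x, synth s x * synth (dCoeff w) x) := by
  have h1 := parseval_synth hs hw hsc (dCoeff_conj hwc)
  have hsum : Summable fun k => s k * (starRingEnd ℂ) (dCoeff w k) := by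
    have h5 := ((summable_norm_of_wNorm hs).mul_norm (summable_norm_of_wNorm hw)).comp_injective
      (i := fun k : ℤ => (k, k)) fun k l hkl => congrArg Prod.fst hkl
    refine Summable.of_norm (h5.congr fun k => ?_)
    simp only [Function.comp_apply, norm_mul, RCLike.norm_conj]
  unfold energyRate
  rw [tsum_mul_left, ← Complex.re_tsum hsum]
  have h2 : ∑' k, s k * (starRingEnd ℂ) (dCoeff w k) =
      (((2 * Real.pi)⁻¹ * ∫ x, synth s x * synth (dCoeff w) x : ℝ) : ℂ) := by
    rw [Complex.ofReal_mul, h1]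
    have : (Real.pi : ℂ) ≠ 0 := by exact_mod_cast Real.pi_ne_zero
    push_cast
    field_simp
  rw [h2, Complex.ofReal_re]; ring

/-! ### Square summability -/

theorem integral_const_torus (r : ℝ) : ∫ _ : Torus, r = 2 * Real.pi * r := by
  rw [integral_const, smul_eq_mul, measureReal_def, AddCircle.measure_univ,
    ENNReal.toReal_ofReal Real.two_pi_pos.le]

/-- A Fourier coefficient is at most the sup norm. -/
theorem enorm_le_of_synth_bound {c : ℤ → ℂ} (hc : wNorm c ≠ ∞)
    (hcc : ∀ k, c (-k) = (starRingEnd ℂ) (c k)) {A : ℝ} (hA : ∀ x, |synth c x| ≤ A) (k : ℤ) :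
    ‖c k‖ₑ ≤ ENNReal.ofReal A := by
  have hA0 : 0 ≤ A := (abs_nonneg _).trans (hA 0)
  have h1 : ‖c k‖ₑ ^ 2 ≤ ENNReal.ofReal A ^ 2 := by
    refine (ENNReal.le_tsum k).trans ((tsum_enorm_sq_eq hc hcc).trans_le ?_)
    rw [← ENNReal.ofReal_pow hA0]
    refine ENNReal.ofReal_le_ofReal ?_
    have h2 : ∫ x, synth c x ^ 2 ≤ ∫ _ : Torus, A ^ 2 :=
      integral_mono (integrable_of_continuous ((continuous_synth hc).pow 2))
        (integrable_const _) fun x => sq_le_sq' (abs_le.1 (hA x)).1 (abs_le.1 (hA x)).2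
    rw [integral_const_torus] at h2
    rw [inv_mul_le_iff₀ Real.two_pi_pos]
    exact h2
  exact (ENNReal.pow_le_pow_left_iff two_ne_zero).1 h1

/-- The interpolation inequality `‖∂ₓu‖²_{L²} ≤ ‖u‖_{L^∞} ‖u‖_{Ȧ²}`. -/
theorem tsum_dCoeff_sq_le {c : ℤ → ℂ} (hc : wNorm c ≠ ∞)
    (hcc : ∀ k, c (-k) = (starRingEnd ℂ) (c k)) {A : ℝ} (hA : ∀ x, |synth c x| ≤ A) :
    ∑' k, ‖dCoeff c k‖ₑ ^ 2 ≤ ENNReal.ofReal A * dNorm c := by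
  unfold dNorm dissip
  rw [← ENNReal.tsum_mul_left]
  refine ENNReal.tsum_le_tsum fun k => ?_
  rw [dCoeff, enorm_I_mul_intCast]
  calc (k.natAbs * ‖c k‖ₑ) ^ 2 = ‖c k‖ₑ * ((k.natAbs : ℝ≥0∞) ^ 2 * ‖c k‖ₑ) := by ring
    _ ≤ _ := by gcongr; exact enorm_le_of_synth_bound hc hcc hA k

section

variable {ι : Type*} [Fintype ι] [DecidableEq ι] {m : ι → ℝ≥0} {B : ι → ι → ℝ≥0}

/-- The `L²` norm of the flux of a bounded state is controlled by its norm in `Ȧ²`, by the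
Cauchy-Schwarz inequality for `∑ⱼ Bᵢⱼ ∂ₓuⱼ` and `tsum_dCoeff_sq_le`. -/
theorem tsum_totalFlux_sq_le {c : ι → ℤ → ℂ} (hc₀ : ∀ i, c i 0 = 0) (hc : ∀ i, dNorm (c i) ≠ ∞)
    (hcc : ∀ i k, c i (-k) = (starRingEnd ℂ) (c i k)) {A : ℝ} (hA : ∀ i x, |synth (c i) x| ≤ A)
    (i : ι) : ∑' k, ‖totalFlux m B c i k‖ₑ ^ 2 ≤
      ENNReal.ofReal ((A + m i) ^ 2 * ∑ j, (B i j : ℝ) ^ 2) * ENNReal.ofReal A *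
        ∑ j, dNorm (c j) := by
  have hw := fun i => wNorm_ne_top (hc₀ i) (hc i)
  have hw' := fun i => wNorm_dCoeff_ne_top (hc i)
  set K : ℝ := (A + m i) ^ 2 * ∑ j, (B i j : ℝ) ^ 2 with hK
  have hK0 : 0 ≤ K := by positivity
  have hpt : ∀ x, synth (totalFlux m B c i) x ^ 2 ≤ K * ∑ j, synth (dCoeff (c j)) x ^ 2 := by
    intro x
    rw [synth_totalFlux hw hw' hcc, mul_pow, hK, mul_assoc]
    refine mul_le_mul ?_ (Finset.sum_mul_sq_le_sq_mul_sq _ _ _) (sq_nonneg _) (sq_nonneg _)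
    have h1 := abs_le.1 (hA i x)
    have h2 := (m i).coe_nonneg
    exact sq_le_sq' (by linarith) (by linarith)
  have hint : ∀ j, Integrable (fun x => synth (dCoeff (c j)) x ^ 2) := fun j =>
    integrable_of_continuous ((continuous_synth (hw' j)).pow 2)
  rw [tsum_enorm_sq_eq (wNorm_totalFlux_ne_top hw hw' i) (totalFlux_conj hcc i)]
  have h1 : (2 * Real.pi)⁻¹ * ∫ x, synth (totalFlux m B c i) x ^ 2 ≤
      K * ∑ j, (2 * Real.pi)⁻¹ * ∫ x, synth (dCoeff (c j)) x ^ 2 := by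
    rw [← Finset.mul_sum, mul_left_comm K]
    refine mul_le_mul_of_nonneg_left ?_ (by positivity)
    rw [← integral_finsetSum _ fun j _ => hint j, ← integral_const_mul]
    exact integral_mono (integrable_of_continuous ((continuous_synth
      (wNorm_totalFlux_ne_top hw hw' i)).pow 2))
      ((integrable_finsetSum _ fun j _ => hint j).const_mul _) hpt
  refine (ENNReal.ofReal_le_ofReal h1).trans ?_
  rw [ENNReal.ofReal_mul hK0, mul_assoc, ENNReal.ofReal_sum_of_nonneg fun j _ => by positivity]
  gcongr
  rw [Finset.mul_sum]
  refine Finset.sum_le_sum fun j _ => ?_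
  rw [← tsum_enorm_sq_eq (hw' j) (dCoeff_conj (hcc j))]
  exact tsum_dCoeff_sq_le (hw j) (hcc j) (hA j)

/-! ### Bounded solutions in terms of their Fourier coefficients -/

/-- The family `c i t`, `t ∈ (0,T)`, of Fourier coefficients of `uᵢ(t)`, bounded by `A` in physical
space and in `L^1(Ȧ²)`, solves the system mode by mode with the initial coefficients `V`. -/
structure BoundedSolution (m : ι → ℝ≥0) (B : ι → ι → ℝ≥0) (T : ℝ) (V : ι → ℤ → ℂ) (A : ℝ)
    (c : ι → ℝ → ℤ → ℂ) : Prop where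
  meas : ∀ i k, Measurable fun t => c i t k
  zero : ∀ i t, c i t 0 = 0
  conj : ∀ i t k, c i t (-k) = (starRingEnd ℂ) (c i t k)
  bound : ∀ i t x, |synth (c i t) x| ≤ A
  integrable : ∀ i, ∫⁻ t in Ioc 0 T, dNorm (c i t) ≠ ∞
  integrated : ∀ i k, ∀ᵐ t ∂(volume.restrict (Ioc 0 T)),
    c i t k = V i k + ∫ s in Ioc 0 t, timeDeriv m B (fun j => c j s) i k

variable {T A : ℝ} {V : ι → ℤ → ℂ} {c : ι → ℝ → ℤ → ℂ}

theorem BoundedSolution.ae_dNorm_ne_top (h : BoundedSolution m B T V A c) :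
    ∀ᵐ t ∂(volume.restrict (Ioc 0 T)), ∀ i, dNorm (c i t) ≠ ∞ := by
  rw [ae_all_iff]
  intro i
  filter_upwards [ae_lt_top (measurable_dNorm (h.meas i)) (h.integrable i)] with t ht
  exact ht.ne

theorem BoundedSolution.measurable_totalFlux (h : BoundedSolution m B T V A c) (i : ι) (k : ℤ) :
    Measurable fun t => totalFlux m B (fun j => c j t) i k := by
  unfold totalFlux
  exact (Measurable.const_mul (Finset.measurable_fun_sum _ fun j _ =>
    (measurable_dCoeff_path (h.meas j) k).const_mul _) _).add
    (measurable_flux (u := fun t j => c j t) h.meas i k)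

theorem BoundedSolution.lintegral_totalFlux_sq_ne_top (h : BoundedSolution m B T V A c) (i : ι) :
    ∫⁻ t in Ioc 0 T, ∑' k, ‖totalFlux m B (fun j => c j t) i k‖ₑ ^ 2 ≠ ∞ := by
  have h1 : ∫⁻ t in Ioc 0 T, ∑ j, dNorm (c j t) ≠ ∞ := by
    rw [lintegral_finsetSum _ fun j _ => measurable_dNorm (h.meas j)]
    exact (ENNReal.sum_lt_top.2 fun j _ => (h.integrable j).lt_top).ne
  have h2 : ENNReal.ofReal ((A + m i) ^ 2 * ∑ j, (B i j : ℝ) ^ 2) * ENNReal.ofReal A ≠ ∞ :=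
    ENNReal.mul_ne_top ENNReal.ofReal_ne_top ENNReal.ofReal_ne_top
  refine ne_top_of_le_ne_top (ENNReal.mul_ne_top h2 h1) ?_
  rw [← lintegral_const_mul' _ _ h2]
  refine lintegral_mono_ae ?_
  filter_upwards [h.ae_dNorm_ne_top] with t ht
  exact tsum_totalFlux_sq_le (fun i => h.zero i t) ht (fun i => h.conj i t)
    (fun i => h.bound i t) i

theorem BoundedSolution.lintegral_dCoeff_sq_ne_top (h : BoundedSolution m B T V A c) (i : ι) :
    ∫⁻ t in Ioc 0 T, ∑' k, ‖dCoeff (c i t) k‖ₑ ^ 2 ≠ ∞ := by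
  refine ne_top_of_le_ne_top (ENNReal.mul_ne_top (ENNReal.ofReal_ne_top (r := A))
    (h.integrable i)) ?_
  rw [← lintegral_const_mul' _ _ ENNReal.ofReal_ne_top]
  refine lintegral_mono_ae ?_
  filter_upwards [h.ae_dNorm_ne_top] with t ht
  exact tsum_dCoeff_sq_le (wNorm_ne_top (h.zero i t) (ht i)) (h.conj i t) (h.bound i t)

theorem BoundedSolution.integrableOn_timeDeriv (h : BoundedSolution m B T V A c) (i : ι) (k : ℤ) :
    IntegrableOn (fun t => timeDeriv m B (fun j => c j t) i k) (Ioc 0 T) := by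
  have h1 : IntegrableOn (fun t => totalFlux m B (fun j => c j t) i k) (Ioc 0 T) := by
    refine ⟨(h.measurable_totalFlux i k).aestronglyMeasurable, ?_⟩
    have h2 : ∀ t, ‖totalFlux m B (fun j => c j t) i k‖ₑ ≤
        1 + ∑' k, ‖totalFlux m B (fun j => c j t) i k‖ₑ ^ 2 := by
      intro t
      refine le_trans ?_ (add_le_add le_rfl (ENNReal.le_tsum k))
      rcases le_total ‖totalFlux m B (fun j => c j t) i k‖ₑ 1 with h3 | h3
      · exact h3.trans le_self_add
      · refine le_trans ?_ le_add_self
        rw [sq]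
        exact le_mul_of_one_le_left' h3
    refine lt_of_le_of_lt (lintegral_mono h2) ?_
    rw [lintegral_add_left measurable_const]
    exact ENNReal.add_lt_top.2 ⟨by simp, (h.lintegral_totalFlux_sq_ne_top i).lt_top⟩
  simp only [← dCoeff_totalFlux]
  exact h1.const_mul _

theorem enorm_mul_le_sq_add_sq (a b : ℝ≥0∞) : a * b ≤ a ^ 2 + b ^ 2 := by
  rcases le_total a b with h | h
  · exact (mul_le_mul_left h b).trans ((sq b).symm.le.trans le_add_self)
  · exact (mul_le_mul_right h a).trans ((sq a).symm.le.trans le_self_add)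

theorem sub_enorm_sq_le (x y : ℂ) : ‖x - y‖ₑ ^ 2 ≤ 4 * (‖x‖ₑ ^ 2 + ‖y‖ₑ ^ 2) := by
  calc ‖x - y‖ₑ ^ 2 ≤ (‖x‖ₑ + ‖y‖ₑ) ^ 2 := by gcongr; exact enorm_sub_le
    _ = ‖x‖ₑ ^ 2 + ‖y‖ₑ ^ 2 + 2 * (‖x‖ₑ * ‖y‖ₑ) := by ring
    _ ≤ ‖x‖ₑ ^ 2 + ‖y‖ₑ ^ 2 + 2 * (‖x‖ₑ ^ 2 + ‖y‖ₑ ^ 2) := by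
        gcongr; exact enorm_mul_le_sq_add_sq _ _
    _ = 3 * (‖x‖ₑ ^ 2 + ‖y‖ₑ ^ 2) := by ring
    _ ≤ _ := by gcongr; norm_num

theorem lintegral_tsum_sub_sq_ne_top {a b : ℝ → ℤ → ℂ} (ha : ∀ k, Measurable fun t => a t k)
    (hai : ∫⁻ t in Ioc 0 T, ∑' k, ‖a t k‖ₑ ^ 2 ≠ ∞)
    (hbi : ∫⁻ t in Ioc 0 T, ∑' k, ‖b t k‖ₑ ^ 2 ≠ ∞) :
    ∫⁻ t in Ioc 0 T, ∑' k, ‖a t k - b t k‖ₑ ^ 2 ≠ ∞ := by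
  refine ne_top_of_le_ne_top (ENNReal.mul_ne_top (by norm_num : (4 : ℝ≥0∞) ≠ ∞)
    (ENNReal.add_ne_top.2 ⟨hai, hbi⟩)) ?_
  rw [← lintegral_add_left (Measurable.tsum fun k => (ha k).enorm.pow_const 2),
    ← lintegral_const_mul' _ _ (by norm_num)]
  refine lintegral_mono fun t => ?_
  simp only
  rw [← ENNReal.tsum_add, ← ENNReal.tsum_mul_left]
  exact ENNReal.tsum_le_tsum fun k => sub_enorm_sq_le _ _

theorem dCoeff_sub (a b : ℤ → ℂ) : dCoeff (fun k => a k - b k) = fun k => dCoeff a k - dCoeff b k :=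
  funext fun _ => mul_sub _ _ _

/-- The energy identity for the `i`-th component of the difference of two solutions. -/
theorem BoundedSolution.energy_identity (h : BoundedSolution m B T V A c) {A' : ℝ}
    {d : ι → ℝ → ℤ → ℂ} (h' : BoundedSolution m B T V A' d) (i : ι) :
    IntegrableOn (fun t => ∫ x, (synth (totalFlux m B (fun j => c j t) i) x -
      synth (totalFlux m B (fun j => d j t) i) x) *
        (synth (dCoeff (c i t)) x - synth (dCoeff (d i t)) x)) (Ioc 0 T) ∧
    ∀ᵐ t ∂(volume.restrict (Ioc 0 T)), ∫ x, (synth (c i t) x - synth (d i t) x) ^ 2 =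
      -2 * ∫ s in Ioc 0 t, ∫ x, (synth (totalFlux m B (fun j => c j s) i) x -
        synth (totalFlux m B (fun j => d j s) i) x) *
          (synth (dCoeff (c i s)) x - synth (dCoeff (d i s)) x) := by
  set S : ℝ → ℤ → ℂ := fun t k =>
    totalFlux m B (fun j => c j t) i k - totalFlux m B (fun j => d j t) i k with hS
  set w : ℝ → ℤ → ℂ := fun t k => c i t k - d i t k with hw
  have hSm : ∀ k, Measurable fun t => S t k := fun k =>
    (h.measurable_totalFlux i k).sub (h'.measurable_totalFlux i k)
  have hwm : ∀ k, Measurable fun t => w t k := fun k => (h.meas i k).sub (h'.meas i k)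
  have hS2 : ∫⁻ t in Ioc 0 T, ∑' k, ‖S t k‖ₑ ^ 2 ≠ ∞ :=
    lintegral_tsum_sub_sq_ne_top (h.measurable_totalFlux i) (h.lintegral_totalFlux_sq_ne_top i)
      (h'.lintegral_totalFlux_sq_ne_top i)
  have hw2 : ∫⁻ t in Ioc 0 T, ∑' k, ‖dCoeff (w t) k‖ₑ ^ 2 ≠ ∞ := by
    simp only [hw, dCoeff_sub]
    exact lintegral_tsum_sub_sq_ne_top (fun k => measurable_dCoeff_path (h.meas i) k)
      (h.lintegral_dCoeff_sq_ne_top i) (h'.lintegral_dCoeff_sq_ne_top i)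
  have hfin : ∫⁻ t in Ioc 0 T, ∑' k, ‖S t k‖ₑ * ‖dCoeff (w t) k‖ₑ ≠ ∞ := by
    refine ne_top_of_le_ne_top (ENNReal.add_ne_top.2 ⟨hS2, hw2⟩) ?_
    rw [← lintegral_add_left (Measurable.tsum fun k => (hSm k).enorm.pow_const 2)]
    refine lintegral_mono fun t => ?_
    simp only
    rw [← ENNReal.tsum_add]
    exact ENNReal.tsum_le_tsum fun k => enorm_mul_le_sq_add_sq _ _
  have hdS : ∀ t k, dCoeff (S t) k =
      timeDeriv m B (fun j => c j t) i k - timeDeriv m B (fun j => d j t) i k := by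
    intro t k
    rw [← dCoeff_totalFlux, ← dCoeff_totalFlux]
    exact mul_sub _ _ _
  have hSi : ∀ k, IntegrableOn (fun t => dCoeff (S t) k) (Ioc 0 T) := by
    intro k
    simp only [hdS]
    exact (h.integrableOn_timeDeriv i k).sub (h'.integrableOn_timeDeriv i k)
  have heq : ∀ k, ∀ᵐ t ∂(volume.restrict (Ioc 0 T)),
      w t k = ∫ r in Ioc 0 t, dCoeff (S r) k := by
    intro k
    filter_upwards [h.integrated i k, h'.integrated i k, ae_restrict_mem measurableSet_Ioc]
      with t h1 h2 htT
    have hsub : Ioc 0 t ⊆ Ioc 0 T := Ioc_subset_Ioc_right htT.2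
    simp only [hw, hdS]
    rw [integral_sub ((h.integrableOn_timeDeriv i k).mono_set hsub)
      ((h'.integrableOn_timeDeriv i k).mono_set hsub), h1, h2]
    ring
  have hgood : ∀ᵐ t ∂(volume.restrict (Ioc 0 T)), wNorm (w t) ≠ ∞ ∧
      (∀ k, w t (-k) = (starRingEnd ℂ) (w t k)) ∧
      (∀ x, synth (w t) x = synth (c i t) x - synth (d i t) x) ∧
      energyRate (S t) (w t) = (2 * Real.pi)⁻¹ * (-2 * ∫ x,
        (synth (totalFlux m B (fun j => c j t) i) x -
        synth (totalFlux m B (fun j => d j t) i) x) *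
        (synth (dCoeff (c i t)) x - synth (dCoeff (d i t)) x)) := by
    filter_upwards [h.ae_dNorm_ne_top, h'.ae_dNorm_ne_top] with t h1 h2
    have hc := fun i => wNorm_ne_top (h.zero i t) (h1 i)
    have hd := fun i => wNorm_ne_top (h'.zero i t) (h2 i)
    have hc' := fun i => wNorm_dCoeff_ne_top (h1 i)
    have hd' := fun i => wNorm_dCoeff_ne_top (h2 i)
    have hsub : ∀ a b : ℤ → ℂ, wNorm a ≠ ∞ → wNorm b ≠ ∞ → wNorm (fun k => a k - b k) ≠ ∞ := by
      intro a b ha hb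
      refine ne_top_of_le_ne_top (ENNReal.add_ne_top.2 ⟨ha, hb⟩)
        (le_trans (ENNReal.tsum_le_tsum fun k => enorm_sub_le) ENNReal.tsum_add.le)
    have hsy : ∀ a b : ℤ → ℂ, wNorm a ≠ ∞ → wNorm b ≠ ∞ → ∀ x,
        synth (fun k => a k - b k) x = synth a x - synth b x := fun a b ha hb x =>
      (congrFun (synth_sub ha hb) x).symm
    have hwc : ∀ k, w t (-k) = (starRingEnd ℂ) (w t k) := fun k => by
      simp only [hw, map_sub, h.conj i t k, h'.conj i t k]
    refine ⟨hsub _ _ (hc i) (hd i), hwc, hsy _ _ (hc i) (hd i), ?_⟩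
    rw [energyRate_eq (hsub _ _ (wNorm_totalFlux_ne_top hc hc' i) (wNorm_totalFlux_ne_top hd hd' i))
      ?_ (fun k => ?_) hwc]
    · congr 2
      refine integral_congr_ae (ae_of_all _ fun x => ?_)
      simp only [hw, dCoeff_sub]
      rw [hsy _ _ (wNorm_totalFlux_ne_top hc hc' i) (wNorm_totalFlux_ne_top hd hd' i),
        hsy _ _ (hc' i) (hd' i)]
    · simp only [hw, dCoeff_sub]
      exact hsub _ _ (hc' i) (hd' i)
    · simp only [map_sub, totalFlux_conj (fun i => h.conj i t),
        totalFlux_conj (fun i => h'.conj i t)]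
  have hpi : (2 * Real.pi) ≠ 0 := Real.two_pi_pos.ne'
  constructor
  · refine ((integrableOn_energyRate hSm hwm hfin).const_mul (-(2⁻¹ * (2 * Real.pi)))).congr ?_
    filter_upwards [hgood] with t ht
    rw [ht.2.2.2]
    field_simp
  · filter_upwards [tsum_normSq_eq_integral hSm hwm hfin hSi heq, hgood,
      ae_restrict_mem measurableSet_Ioc] with t h1 h2 htT
    have hsub : Ioc 0 t ⊆ Ioc 0 T := Ioc_subset_Ioc_right htT.2
    have h3 : ∑' k, ‖w t k‖ ^ 2 =
        (2 * Real.pi)⁻¹ * ∫ x, (synth (c i t) x - synth (d i t) x) ^ 2 := by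
      have h4 := tsum_enorm_sq_eq h2.1 h2.2.1
      have h5 := congrArg ENNReal.toReal h4
      rw [ENNReal.toReal_ofReal (by positivity)] at h5
      simp only [h2.2.2.1] at h5
      rw [← h5, ENNReal.tsum_toReal_eq fun k => ENNReal.pow_ne_top enorm_ne_top]
      simp
    rw [h3] at h1
    have h6 : ∫ r in Ioc 0 t, energyRate (S r) (w r) = (2 * Real.pi)⁻¹ * (-2 * ∫ s in Ioc 0 t, ∫ x,
        (synth (totalFlux m B (fun j => c j s) i) x -
        synth (totalFlux m B (fun j => d j s) i) x) *
          (synth (dCoeff (c i s)) x - synth (dCoeff (d i s)) x)) := by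
      rw [← integral_const_mul, ← integral_const_mul]
      refine integral_congr_ae ?_
      filter_upwards [ae_restrict_of_ae_restrict_of_subset hsub hgood] with s hs
      exact hs.2.2.2
    rw [h6] at h1
    exact mul_left_cancel₀ (inv_ne_zero hpi) h1

end

section

variable {ι : Type*} [Fintype ι] [DecidableEq ι] {m : ι → ℝ≥0} {B : ι → ι → ℝ≥0}
variable {T A : ℝ} {V : ι → ℤ → ℂ} {c : ι → ℝ → ℤ → ℂ}

/-! ### Uniqueness of bounded solutions -/

theorem BoundedSolution.integrableOn_stretch (h : BoundedSolution m B T V A c) :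
    IntegrableOn (fun t => (stretch B fun j => c j t).toReal) (Ioc 0 T) := by
  have hm : Measurable fun t => stretch B fun j => c j t :=
    Finset.measurable_fun_sum _ fun _ _ => Finset.measurable_fun_sum _ fun j _ =>
      (measurable_dNorm (h.meas j)).const_mul _
  refine integrable_toReal_of_lintegral_ne_top hm.aemeasurable ?_
  unfold stretch
  rw [lintegral_finsetSum _ fun i _ => Finset.measurable_fun_sum _ fun j _ =>
    (measurable_dNorm (h.meas j)).const_mul _]
  refine (ENNReal.sum_lt_top.2 fun i _ => ?_).ne
  rw [lintegral_finsetSum _ fun j _ => (measurable_dNorm (h.meas j)).const_mul _]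
  refine ENNReal.sum_lt_top.2 fun j _ => ?_
  rw [lintegral_const_mul _ (measurable_dNorm (h.meas j))]
  exact ENNReal.mul_lt_top ENNReal.coe_lt_top (h.integrable j).lt_top

/-- Weak-strong uniqueness: a bounded solution coincides with any solution that stays in the
region of parabolicity. -/
theorem BoundedSolution.ae_eq {E : ℝ} (hE : IsParabolic m B E) (h : BoundedSolution m B T V A c)
    {d : ι → ℝ → ℤ → ℂ} (h' : BoundedSolution m B T V E d) :
    ∀ᵐ t ∂(volume.restrict (Ioc 0 T)), ∀ i, synth (c i t) = synth (d i t) := by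
  set z : ℝ → ℝ := fun t => ∑ i, ∫ x, (synth (c i t) x - synth (d i t) x) ^ 2 with hz
  have hz0 : ∀ t, 0 ≤ z t := fun t =>
    Finset.sum_nonneg fun i _ => integral_nonneg fun x => sq_nonneg _
  have hzC : ∀ t, z t ≤ ∑ _i : ι, 2 * Real.pi * (A + E) ^ 2 := by
    intro t
    refine Finset.sum_le_sum fun i _ => ?_
    rw [← integral_const_torus]
    refine integral_mono_of_nonneg (ae_of_all _ fun x => sq_nonneg _) (integrable_const _)
      (ae_of_all _ fun x => ?_)
    have h1 := abs_le.1 (h.bound i t x)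
    have h2 := abs_le.1 (h'.bound i t x)
    exact sq_le_sq' (by linarith) (by linarith)
  have hzm : AEStronglyMeasurable z (volume.restrict (Ioc 0 T)) := by
    refine (Measurable.stronglyMeasurable ?_).aestronglyMeasurable
    refine Finset.measurable_fun_sum _ fun i _ => ?_
    have h1 : Measurable fun p : ℝ × Torus => (synth (c i p.1) p.2 - synth (d i p.1) p.2) ^ 2 :=
      ((measurable_synth_path (h.meas i)).sub (measurable_synth_path (h'.meas i))).pow_const 2
    exact h1.stronglyMeasurable.integral_prod_right'.measurable
  have hid := fun i => h.energy_identity h' i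
  have hzero := ae_eq_zero_of_le_integral h.integrableOn_stretch (fun t => ENNReal.toReal_nonneg)
    hz0 hzC hzm ?_
  · filter_upwards [hzero, h.ae_dNorm_ne_top, h'.ae_dNorm_ne_top] with t ht h1 h2 i
    have hc := continuous_synth (wNorm_ne_top (h.zero i t) (h1 i))
    have hd := continuous_synth (wNorm_ne_top (h'.zero i t) (h2 i))
    have h3 := (Finset.sum_eq_zero_iff_of_nonneg fun i _ =>
      integral_nonneg fun x => sq_nonneg _).1 ht i (Finset.mem_univ i)
    have h4 := (integral_eq_zero_iff_of_nonneg (fun x => sq_nonneg _)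
      (integrable_of_continuous ((hc.sub hd).pow 2))).1 h3
    refine Continuous.ae_eq_iff_eq volume hc hd |>.1 ?_
    filter_upwards [h4] with x hx
    have := pow_eq_zero_iff two_ne_zero |>.1 hx
    exact sub_eq_zero.1 this
  · filter_upwards [ae_all_iff.2 fun i => (hid i).2, ae_restrict_mem measurableSet_Ioc]
      with t ht htT
    have hsub : Ioc 0 t ⊆ Ioc 0 T := Ioc_subset_Ioc_right htT.2
    have hi := fun i => (hid i).1.mono_set hsub
    have hMz : IntegrableOn (fun s => (stretch B fun j => c j s).toReal * z s) (Ioc 0 T) :=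
      Integrable.mul_bdd (c := ∑ _i : ι, 2 * Real.pi * (A + E) ^ 2) h.integrableOn_stretch hzm
        (ae_of_all _ fun t => by rw [Real.norm_of_nonneg (hz0 t)]; exact hzC t)
    calc z t = ∑ i, -2 * ∫ s in Ioc 0 t, ∫ x, (synth (totalFlux m B (fun j => c j s) i) x -
          synth (totalFlux m B (fun j => d j s) i) x) *
            (synth (dCoeff (c i s)) x - synth (dCoeff (d i s)) x) :=
          Finset.sum_congr rfl fun i _ => ht i
      _ = ∫ s in Ioc 0 t, 2 * -∑ i, ∫ x, (synth (totalFlux m B (fun j => c j s) i) x -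
          synth (totalFlux m B (fun j => d j s) i) x) *
            (synth (dCoeff (c i s)) x - synth (dCoeff (d i s)) x) := by
          rw [integral_const_mul, integral_neg, integral_finsetSum _ fun i _ => hi i,
            ← Finset.mul_sum]
          ring
      _ ≤ ∫ s in Ioc 0 t, (stretch B fun j => c j s).toReal * z s := by
          refine integral_mono_ae ((integrable_finsetSum _ fun i _ => hi i).neg.const_mul 2)
            (hMz.mono_set hsub) ?_
          filter_upwards [ae_restrict_of_ae_restrict_of_subset hsub h.ae_dNorm_ne_top,
            ae_restrict_of_ae_restrict_of_subset hsub h'.ae_dNorm_ne_top] with s h1 h2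
          have h3 := energy_inequality hE (fun i => h.zero i s) (fun i => h'.zero i s) h1 h2
            (fun i => h.conj i s) (fun i => h'.conj i s) (fun i => h'.bound i s)
          simp only [hz]
          linarith

/-- The solution constructed from the Picard iterates is bounded by the size of the data. -/
theorem ModeSolution.boundedSolution {e₀ : ℝ≥0} (h : ModeSolution m B c e₀) (T : ℝ) :
    BoundedSolution m B T (fun i k => c i 0 k) e₀ c where
  meas i := (h.path i).meas
  zero i := (h.path i).zero
  conj := h.conj
  bound i t x := by
    have h1 := (enorm_synth_le (c i t) x).trans ((h.path i).bound t)
    rw [← ofReal_norm, ← ENNReal.ofReal_coe_nnreal, Real.norm_eq_abs] at h1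
    exact (ENNReal.ofReal_le_ofReal_iff e₀.coe_nonneg).1 h1
  integrable i := (h.path i).integrable T
  integrated i k := by
    filter_upwards [ae_restrict_mem measurableSet_Ioc] with t ht
    exact h.integrated i k ht.1.le

end

/-- At states of size at most that of the data the heights `F`, `G` of the two fluids are
nonnegative and the quadratic form `b_ρ F v₀² + (b F + b_μ G) v₀ v₁ + b_μ G v₁²` is nonnegative. -/
theorem isParabolic (P : Fluids) {f₀ g₀ : Torus → ℝ}
    (hsize : initialSize f₀ g₀ < min (mean f₀) (mean g₀)) (hσ : 0 < decayRate P f₀ g₀) :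
    IsParabolic (means f₀ g₀) (diffusion P) (initialSize f₀ g₀) := by
  intro y v hy
  have hb := P.b_pos
  have hbμ := P.bμ_pos
  have hbρ := P.bρ_pos
  have hE : 0 ≤ initialSize f₀ g₀ := initialSize_nonneg
  have hm := lt_min_iff.1 hsize
  have hf : 0 ≤ mean f₀ := hE.trans hm.1.le
  have hg : 0 ≤ mean g₀ := hE.trans hm.2.le
  have h1 : 0 < σ₁ P f₀ g₀ := hσ.trans_le (min_le_left _ _)
  have h2 : 0 < σ₂ P f₀ g₀ := hσ.trans_le (min_le_right _ _)
  unfold σ₁ at h1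
  unfold σ₂ at h2
  simp only [Fin.sum_univ_two, means, diffusion, Matrix.cons_val_zero, Matrix.cons_val_one,
    Matrix.cons_val_fin_one, Real.coe_toNNReal _ hf, Real.coe_toNNReal _ hg,
    Real.coe_toNNReal _ hb.le, Real.coe_toNNReal _ hbμ.le, Real.coe_toNNReal _ hbρ.le]
  obtain ⟨a1, a2⟩ := abs_le.1 (hy 0)
  obtain ⟨c1, c2⟩ := abs_le.1 (hy 1)
  set E := initialSize f₀ g₀
  set F := y 0 + mean f₀ with hF
  set G := y 1 + mean g₀ with hG
  have hF0 : 0 ≤ F := by linarith [hm.1]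
  have hG0 : 0 ≤ G := by linarith [hm.2]
  have p1 := mul_le_mul_of_nonneg_right a1 hbρ.le
  have p2 := mul_le_mul_of_nonneg_right a2 hb.le
  have p3 := mul_le_mul_of_nonneg_right c1 hbμ.le
  have p4 := mul_le_mul_of_nonneg_right c2 hbμ.le
  have q1 := mul_nonneg hE hb.le
  have q2 := mul_nonneg hE hbμ.le
  have q3 := mul_nonneg hE hbρ.le
  -- the cross term is at most twice each of the diagonal ones
  have k1 : 0 ≤ 2 * (F * P.bρ) - (F * P.b + G * P.bμ) := by
    simp only [hF, hG]; nlinarith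
  have k2 : 0 ≤ G * P.bμ - F * P.b := by
    simp only [hF, hG]; nlinarith
  have k3 : 0 ≤ F * P.b + G * P.bμ := by positivity
  nlinarith [mul_nonneg k1 (sq_nonneg (v 0)), mul_nonneg k2 (sq_nonneg (v 1)),
    mul_nonneg k3 (sq_nonneg (v 0 + v 1))]

/-! ### Testing with trigonometric functions -/

/-- The trigonometric function `Re (z e^{ikx})`. -/
def trig (z : ℂ) (k : ℤ) (x : Torus) : ℝ := (z * fourier k x).re

theorem trig_coe (z : ℂ) (k : ℤ) (y : ℝ) :
    trig z k (y : Torus) = (z * Complex.exp (Complex.I * (k * y : ℝ))).re := by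
  rw [trig, fourier_coe]

theorem contDiff_trig (z : ℂ) (k : ℤ) {n : WithTop ℕ∞} :
    ContDiff ℝ n fun y : ℝ => trig z k (y : Torus) := by
  simp only [trig_coe]
  refine Complex.reCLM.contDiff.comp (contDiff_const.mul ?_)
  exact Complex.contDiff_exp.comp (contDiff_const.mul
    (Complex.ofRealCLM.contDiff.comp (contDiff_const.mul contDiff_id)))

theorem hasDx_trig (z : ℂ) (k : ℤ) : HasDx (trig z k) (trig (z * (Complex.I * k)) k) := by
  intro a
  simp only [trig_coe]
  have h1 : HasDerivAt (fun y : ℝ => (y : ℂ)) 1 a := Complex.ofRealCLM.hasDerivAt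
  have h2 := (((h1.const_mul (k : ℂ)).const_mul Complex.I).cexp).const_mul z
  have h3 := Complex.reCLM.hasFDerivAt.comp_hasDerivAt a h2
  simp only [Complex.ofReal_mul, Complex.ofReal_intCast]
  refine h3.congr_deriv ?_
  simp only [Complex.reCLM_apply, mul_one]
  congr 1; ring

theorem continuous_trig (z : ℂ) (k : ℤ) : Continuous (trig z k) := (hasDx_trig z k).continuous

theorem fourierHat_eq (u : Torus → ℝ) (k : ℤ) :
    2 * Real.pi * fourierHat u k = ∫ x, (u x : ℂ) * fourier (-k) x := by
  unfold fourierHat fourierCoeff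
  rw [AddCircle.integral_haarAddCircle, Complex.real_smul]
  push_cast
  rw [mul_inv_cancel_left₀ (by simp)]
  exact integral_congr_ae (ae_of_all _ fun x => by simp only [smul_eq_mul, mul_comm])

/-- Real test functions `Re (z e^{ikx})` with arbitrary complex `z` recover a complex Fourier
coefficient. -/
theorem integral_mul_trig {u : Torus → ℝ} (hu : Integrable u volume) (z : ℂ) (k : ℤ) :
    ∫ x, u x * trig z k x = (z * (2 * Real.pi * fourierHat u (-k))).re := by
  rw [fourierHat_eq, neg_neg, ← integral_const_mul]
  have h1 : Integrable (fun x => z * ((u x : ℂ) * fourier k x)) volume :=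
    (hu.ofReal.mul_bdd (c := 1) (fourier k).continuous.aestronglyMeasurable
      (ae_of_all _ fun x => (norm_fourier_apply k x).le)).const_mul z
  refine Eq.trans ?_ (Complex.reCLM.integral_comp_comm h1)
  refine integral_congr_ae (ae_of_all _ fun x => ?_)
  simp only [trig, Complex.reCLM_apply]
  rw [mul_left_comm, Complex.re_ofReal_mul]

theorem eq_of_forall_re_mul_eq {a b : ℂ} (h : ∀ z : ℂ, (z * a).re = (z * b).re) : a = b := by
  refine Complex.ext (by simpa using h 1) ?_
  have := h Complex.I
  simpa using this

/-- The Fourier coefficients of a weak derivative. -/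
theorem HasWeakDeriv.fourierHat_eq {u v : Torus → ℝ} (h : HasWeakDeriv 1 u v) :
    fourierHat v = dCoeff (fourierHat u) := by
  funext k
  have hpi : (2 * Real.pi : ℂ) ≠ 0 := by exact_mod_cast Real.two_pi_pos.ne'
  refine mul_left_cancel₀ hpi (eq_of_forall_re_mul_eq fun z => ?_)
  have h1 := h.2.2 (trig z (-k)) (contDiff_trig z (-k))
  rw [Function.iterate_one, (hasDx_trig z (-k)).dx_eq, integral_mul_trig h.1,
    integral_mul_trig h.2.1, neg_neg] at h1
  have h2 : z * (2 * Real.pi * dCoeff (fourierHat u) k) =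
      -(z * (Complex.I * ((-k : ℤ) : ℂ)) * (2 * Real.pi * fourierHat u k)) := by
    unfold dCoeff; push_cast; ring
  rw [h2, Complex.neg_re, h1]; ring

/-! ### Weak derivatives in time -/

/-- A function compactly supported in `(0, T)` vanishes near `T`. -/
theorem exists_lt_of_tsupport_subset {g : ℝ → ℝ} {T : ℝ} (hT : 0 < T) (hg : HasCompactSupport g)
    (hgT : tsupport g ⊆ Ioo 0 T) : ∃ τ < T, ∀ t, τ < t → g t = 0 := by
  obtain ⟨τ, hτ, hmax⟩ := (hg.isCompact.insert 0).exists_isGreatest (insert_nonempty _ _)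
  refine ⟨τ, ?_, fun t ht => ?_⟩
  · rcases hτ with rfl | h
    · exact hT
    · exact (hgT h).2
  · by_contra h
    exact absurd (hmax (mem_insert_of_mem _ (subset_tsupport g h))) (not_le.2 ht)

/-- A function with weak derivative `r` and initial value `V` is almost everywhere equal to
`V + ∫₀ᵗ r`. -/
theorem ae_eq_primitive {y r : ℝ → ℂ} {V : ℂ} {T : ℝ} (hT : 0 < T) (hy : IntegrableOn y (Ioo 0 T))
    (hr : IntegrableOn r (Ioo 0 T))
    (h : ∀ χ χ' : ℝ → ℝ, (∀ t, HasDerivAt χ (χ' t) t) → Continuous χ' →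
      (∃ τ < T, ∀ t, τ ≤ t → χ t = 0) →
      χ 0 * V + (∫ t in Ioo 0 T, χ' t * y t) + ∫ t in Ioo 0 T, χ t * r t = 0) :
    ∀ᵐ t ∂(volume.restrict (Ioo 0 T)), y t = V + ∫ s in Ioc 0 t, r s := by
  have hrc : IntegrableOn r (Ioc 0 T) := hr.congr_set_ae Ioo_ae_eq_Ioc.symm
  have hrI : IntegrableOn r (Icc 0 T) := (integrableOn_Icc_iff_integrableOn_Ioc (by simp)).2 hrc
  have hYc : ContinuousOn (fun t => V + ∫ s in Ioc 0 t, r s) (Icc 0 T) :=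
    continuousOn_const.add (intervalIntegral.continuousOn_primitive hrI)
  have hY : IntegrableOn (fun t => V + ∫ s in Ioc 0 t, r s) (Ioo 0 T) :=
    (hYc.integrableOn_compact isCompact_Icc).mono_set Ioo_subset_Icc_self
  have key := isOpen_Ioo.ae_eq_zero_of_integral_contDiff_smul_eq_zero
    (μ := volume.restrict (Ioo 0 T)) (U := Ioo 0 T)
    (f := fun t => y t - (V + ∫ s in Ioc 0 t, r s))
    ((hy.sub hY).locallyIntegrable.locallyIntegrableOn _) fun g hg hgc hgT => ?_
  · filter_upwards [key, ae_restrict_mem measurableSet_Ioo] with t ht htT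
    exact sub_eq_zero.1 (ht htT)
  · obtain ⟨τ, hτ, hgτ⟩ := exists_lt_of_tsupport_subset hT hgc hgT
    have hcg : Continuous g := hg.continuous
    set χ : ℝ → ℝ := fun t => ∫ s in T..t, g s with hχ
    have hχd : ∀ t, HasDerivAt χ (g t) t := fun t =>
      intervalIntegral.integral_hasDerivAt_right (hcg.intervalIntegrable _ _)
        (hcg.stronglyMeasurableAtFilter _ _) hcg.continuousAt
    have hχc : Continuous χ := continuous_iff_continuousAt.2 fun t => (hχd t).continuousAt
    have hχ0 : ∀ t, τ ≤ t → χ t = 0 := by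
      intro t ht
      refine intervalIntegral.integral_zero_ae (ae_of_all _ fun s hs => hgτ s ?_)
      exact (le_min hτ.le ht).trans_lt hs.1
    have h1 := h χ g hχd hcg ⟨τ, hτ, hχ0⟩
    have hχs : ∀ t ∈ Icc 0 T, (χ t : ℂ) = (χ 0 : ℂ) + ∫ s in Ioc 0 t, (g s : ℂ) := by
      intro t ht
      rw [integral_complex_ofReal, ← intervalIntegral.integral_of_le ht.1,
        intervalIntegral.integral_eq_sub_of_hasDerivAt (fun s _ => hχd s)
          (hcg.intervalIntegrable _ _)]
      push_cast; ring
    have hcχ : Continuous fun t => (χ t : ℂ) := Complex.continuous_ofReal.comp hχc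
    have hcg' : Continuous fun t => (g t : ℂ) := Complex.continuous_ofReal.comp hcg
    have hi₁ : IntegrableOn (fun t => r t * χ t) (Ioc 0 T) :=
      (hrI.mul_continuousOn hcχ.continuousOn isCompact_Icc).mono_set Ioc_subset_Icc_self
    have hi₂ : IntegrableOn (fun t => (V + ∫ s in Ioc 0 t, r s) * g t) (Ioc 0 T) :=
      ((hYc.mul hcg'.continuousOn).integrableOn_compact isCompact_Icc).mono_set Ioc_subset_Icc_self
    have h2 := primitive_mul_primitive (v := fun t => V + ∫ s in Ioc 0 t, r s)
      (χ := fun t => (χ t : ℂ)) (η := fun t => (g t : ℂ)) hT.le hrc hcg'.integrableOn_Ioc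
      (fun t _ => rfl) hχs hi₁ hi₂
    simp only [hχ0 T hτ.le] at h2
    rw [← integral_Ioc_eq_integral_Ioo, ← integral_Ioc_eq_integral_Ioo] at h1
    have hyI : IntegrableOn y (Icc 0 T) := hy.congr_set_ae Ioo_ae_eq_Icc.symm
    have hi₃ : IntegrableOn (fun t => g t * y t) (Ioc 0 T) :=
      (hyI.continuousOn_mul hcg'.continuousOn isCompact_Icc).mono_set Ioc_subset_Icc_self
    have e1 : ∫ t in Ioc 0 T, (χ t : ℂ) * r t = ∫ t in Ioc 0 T, r t * χ t :=
      integral_congr_ae (ae_of_all _ fun t => mul_comm _ _)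
    rw [← integral_Ioc_eq_integral_Ioo]
    have e2 : ∫ t in Ioc 0 T, g t • (y t - (V + ∫ s in Ioc 0 t, r s)) =
        (∫ t in Ioc 0 T, g t * y t) - ∫ t in Ioc 0 T, (V + ∫ s in Ioc 0 t, r s) * g t := by
      rw [← integral_sub hi₃ hi₂]
      refine integral_congr_ae (ae_of_all _ fun t => ?_)
      simp only [Complex.real_smul]; ring
    rw [e2]
    rw [e1] at h1
    push_cast at h2
    linear_combination h1 + h2

/-! ### Fourier coefficients of weak solutions -/

section

variable {T : ℝ} {u : ℝ → Torus → ℝ}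

theorem ae_integrable_slice (hu : Integrable (fun p : ℝ × Torus => u p.1 p.2) (slab T)) :
    ∀ᵐ t ∂(volume.restrict (Ioo 0 T)), Integrable (u t) volume := by
  unfold slab at hu
  exact hu.prod_right_ae

theorem integrableOn_fourierHat (hu : Integrable (fun p : ℝ × Torus => u p.1 p.2) (slab T))
    (k : ℤ) : IntegrableOn (fun t => fourierHat (u t) k) (Ioo 0 T) := by
  have h1 : Integrable (fun p : ℝ × Torus => (u p.1 p.2 : ℂ) * fourier (-k) p.2) (slab T) :=
    hu.ofReal.mul_bdd (c := 1) ((fourier (-k)).continuous.comp continuous_snd).aestronglyMeasurable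
      (ae_of_all _ fun p => (norm_fourier_apply _ _).le)
  unfold slab at h1
  have h2 : IntegrableOn (fun t => (2 * Real.pi : ℂ)⁻¹ * (2 * Real.pi * fourierHat (u t) k))
      (Ioo 0 T) := by
    simp only [fourierHat_eq]
    exact h1.integral_prod_left.const_mul _
  refine h2.congr (ae_of_all _ fun t => ?_)
  have : (2 * Real.pi : ℂ) ≠ 0 := by exact_mod_cast Real.two_pi_pos.ne'
  exact inv_mul_cancel_left₀ this _

theorem integral_slab_mul_trig (hu : Integrable (fun p : ℝ × Torus => u p.1 p.2) (slab T))
    {χ : ℝ → ℝ} (hχ : Continuous χ) (z : ℂ) (k : ℤ) :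
    ∫ p, u p.1 p.2 * (χ p.1 * trig z k p.2) ∂(slab T) =
      (z * (2 * Real.pi * ∫ t in Ioo 0 T, χ t * fourierHat (u t) (-k))).re := by
  have h1 : Integrable (fun p : ℝ × Torus => u p.1 p.2 * (χ p.1 * trig z k p.2)) (slab T) :=
    Integrable.mul_continuous_slab hu
      ((hχ.comp continuous_fst).mul ((continuous_trig z k).comp continuous_snd))
  have h2 : IntegrableOn (fun t => χ t * fourierHat (u t) (-k)) (Ioo 0 T) := by
    have h3 : IntegrableOn (fun t => fourierHat (u t) (-k)) (Icc 0 T) :=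
      (integrableOn_fourierHat hu (-k)).congr_set_ae Ioo_ae_eq_Icc.symm
    exact (h3.continuousOn_mul (Complex.continuous_ofReal.comp hχ).continuousOn
      isCompact_Icc).mono_set Ioo_subset_Icc_self
  rw [← integral_const_mul, ← integral_const_mul]
  unfold slab at h1 ⊢
  rw [integral_prod _ h1]
  refine Eq.trans ?_ (Complex.reCLM.integral_comp_comm ((h2.const_mul _).const_mul z))
  refine integral_congr_ae ?_
  filter_upwards [ae_integrable_slice hu] with t ht
  have h4 : ∫ x, u t x * (χ t * trig z k x) = χ t * ∫ x, u t x * trig z k x := by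
    rw [← integral_const_mul]
    exact integral_congr_ae (ae_of_all _ fun x => mul_left_comm _ _ _)
  simp only [h4, Complex.reCLM_apply]
  rw [integral_mul_trig ht, ← Complex.re_ofReal_mul]
  congr 1; ring

/-- The weak form of the equation, tested with trigonometric functions. -/
theorem WeakEq.ae_fourierHat_eq {r : ℝ} {u₀ : Torus → ℝ} {q : ℝ → Torus → ℝ} (hT : 0 < T)
    (hu₀ : Integrable u₀ volume) (hu : Integrable (fun p : ℝ × Torus => u p.1 p.2) (slab T))
    (hq : Integrable (fun p : ℝ × Torus => q p.1 p.2) (slab T)) (h : WeakEq T r u₀ u q) (k : ℤ) :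
    ∀ᵐ t ∂(volume.restrict (Ioo 0 T)), fourierHat (u t) k = fourierHat u₀ k +
      ∫ s in Ioc 0 t, dCoeff (fourierHat fun x => (u s x + r) * q s x) k := by
  have hS : Integrable (fun p : ℝ × Torus => (u p.1 p.2 + r) * q p.1 p.2) (slab T) := by
    refine (h.1.add (hq.const_mul r)).congr (ae_of_all _ fun p => ?_)
    simp only [Pi.add_apply]; ring
  have hpi : (2 * Real.pi : ℂ) ≠ 0 := by exact_mod_cast Real.two_pi_pos.ne'
  refine ae_eq_primitive hT (integrableOn_fourierHat hu k)
    ((integrableOn_fourierHat (u := fun t x => (u t x + r) * q t x) hS k).const_mul _)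
    fun χ χ' hχ hχ' hτ => ?_
  have hχc : Continuous χ := continuous_iff_continuousAt.2 fun t => (hχ t).continuousAt
  refine mul_left_cancel₀ hpi (eq_of_forall_re_mul_eq fun z => ?_)
  set φ : ℝ → Torus → ℝ := fun t x => χ t * trig z (-k) x with hφ
  have htest : IsTest T φ := by
    refine ⟨?_, ?_⟩
    · have h1 : ContDiff ℝ 1 χ := contDiff_one_iff_deriv.2
        ⟨fun t => (hχ t).differentiableAt, by
          rw [show deriv χ = χ' from funext fun t => (hχ t).deriv]; exact hχ'⟩
      exact (h1.comp contDiff_fst).mul ((contDiff_trig z (-k)).comp contDiff_snd)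
    · obtain ⟨τ, hτT, h0⟩ := hτ
      exact ⟨τ, hτT, fun t ht x => by simp only [hφ, h0 t ht, zero_mul]⟩
  have hdt : ∀ t x, deriv (fun s => φ s x) t = χ' t * trig z (-k) x := fun t x =>
    ((hχ t).mul_const _).deriv
  have hdx : ∀ t x, dx (φ t) x = χ t * trig (z * (Complex.I * (-k : ℤ))) (-k) x := by
    intro t x
    have h1 : HasDx (φ t) fun x => χ t * trig (z * (Complex.I * (-k : ℤ))) (-k) x := fun a =>
      (hasDx_trig z (-k) a).const_mul _
    rw [h1.dx_eq]
  have key := h.2 φ htest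
  have hcx : Continuous fun p : ℝ × Torus =>
      χ p.1 * trig (z * (Complex.I * (-k : ℤ))) (-k) p.2 :=
    (hχc.comp continuous_fst).mul ((continuous_trig _ _).comp continuous_snd)
  have e1 : ∫ x, u₀ x * φ 0 x = (z * (2 * Real.pi * (χ 0 * fourierHat u₀ k))).re := by
    have h1 := integral_mul_trig hu₀ (z * χ 0) (-k)
    rw [neg_neg] at h1
    rw [show z * (2 * Real.pi * (χ 0 * fourierHat u₀ k)) =
      z * χ 0 * (2 * Real.pi * fourierHat u₀ k) by ring, ← h1]
    refine integral_congr_ae (ae_of_all _ fun x => ?_)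
    simp only [hφ, trig]
    rw [show z * (χ 0 : ℂ) * fourier (-k) x = (χ 0 : ℂ) * (z * fourier (-k) x) by ring,
      Complex.re_ofReal_mul]
  have e2 := integral_slab_mul_trig hu hχ' z (-k)
  have e3 := integral_slab_mul_trig (u := fun t x => (u t x + r) * q t x) hS hχc
    (z * (Complex.I * (-k : ℤ))) (-k)
  have e4 : ∫ p, (u p.1 p.2 + r) * q p.1 p.2 *
      (χ p.1 * trig (z * (Complex.I * (-k : ℤ))) (-k) p.2) ∂(slab T) =
      (r * ∫ p, q p.1 p.2 * (χ p.1 * trig (z * (Complex.I * (-k : ℤ))) (-k) p.2) ∂(slab T)) +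
      ∫ p, u p.1 p.2 * q p.1 p.2 *
        (χ p.1 * trig (z * (Complex.I * (-k : ℤ))) (-k) p.2) ∂(slab T) := by
    rw [← integral_const_mul, ← integral_add
      ((Integrable.mul_continuous_slab hq hcx).const_mul r)
      (Integrable.mul_continuous_slab h.1 hcx)]
    exact integral_congr_ae (ae_of_all _ fun p => by ring)
  simp only [hdt, hdx] at key
  rw [e1, e2] at key
  rw [e4] at e3
  rw [neg_neg] at e3 key
  have e5 : ∫ t in Ioo 0 T, χ t * dCoeff (fourierHat fun x => (u t x + r) * q t x) k =
      Complex.I * k * ∫ t in Ioo 0 T, χ t * fourierHat (fun x => (u t x + r) * q t x) k := by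
    rw [← integral_const_mul]
    refine integral_congr_ae (ae_of_all _ fun t => ?_)
    simp only [dCoeff]; ring
  rw [e5]
  set a := ∫ t in Ioo 0 T, (χ' t : ℂ) * fourierHat (u t) k
  set b := ∫ t in Ioo 0 T, (χ t : ℂ) * fourierHat (fun x => (u t x + r) * q t x) k
  have e6 : z * (2 * Real.pi * (χ 0 * fourierHat u₀ k + a + Complex.I * k * b)) =
      z * (2 * Real.pi * (χ 0 * fourierHat u₀ k)) + z * (2 * Real.pi * a) -
        z * (Complex.I * (-k : ℤ)) * (2 * Real.pi * b) := by
    push_cast; ring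
  rw [e6, Complex.sub_re, Complex.add_re, ← e3]
  simp only [mul_zero, Complex.zero_re]
  linarith

theorem forall_le_of_ae_le {f : Torus → ℝ} (hf : Continuous f) {A : ℝ}
    (h : ∀ᵐ x, f x ≤ A) (x : Torus) : f x ≤ A := by
  by_contra hx
  have ho : IsOpen {x | A < f x} := isOpen_lt continuous_const hf
  have h0 : volume {x | A < f x} = 0 := by simpa only [not_le] using ae_iff.1 h
  have h1 := (ho.measure_eq_zero_iff volume).1 h0
  exact (eq_empty_iff_forall_notMem.1 h1 x) (not_le.1 hx)

/-- The Fourier coefficients of a bounded function in `L^1(Ȧ²)`, redefined on a null set of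
times. -/
theorem exists_coefficients {ux : ℝ → Torus → ℝ} (hd : IsSpaceDeriv T u ux)
    (h0 : ∀ᵐ t ∂(volume.restrict (Ioo 0 T)), ∫ x, u t x = 0) (hb : IsBounded T u)
    (hN : MemBochner 1 T (wienerNorm 2) u) :
    ∃ (A : ℝ) (c : ℝ → ℤ → ℂ), (∀ k, Measurable fun t => c t k) ∧ (∀ t, c t 0 = 0) ∧
      (∀ t k, c t (-k) = (starRingEnd ℂ) (c t k)) ∧ (∀ t x, |synth (c t) x| ≤ A) ∧
      ∫⁻ t in Ioc 0 T, dNorm (c t) ≠ ∞ ∧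
      ∀ᵐ t ∂(volume.restrict (Ioo 0 T)), c t = fourierHat (u t) ∧ u t =ᵐ[volume] synth (c t) ∧
        ux t =ᵐ[volume] synth (dCoeff (c t)) := by
  set μ : Measure ℝ := volume.restrict (Ioo 0 T) with hμ
  have hm : ∀ k, AEMeasurable (fun t => fourierHat (u t) k) μ := fun k =>
    (integrableOn_fourierHat hd.1 k).aestronglyMeasurable.aemeasurable
  set g : ℤ → ℝ → ℂ := fun k => (hm k).mk _ with hg
  have hgm : ∀ k, Measurable (g k) := fun k => (hm k).measurable_mk
  have hgu : ∀ᵐ t ∂μ, ∀ k, fourierHat (u t) k = g k t := ae_all_iff.2 fun k => (hm k).ae_eq_mk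
  have hint := ae_integrable_slice hd.1
  set A := (eLpNorm (fun p : ℝ × Torus => u p.1 p.2) ∞ (slab T)).toReal with hA
  have hbd : ∀ᵐ t ∂μ, ∀ᵐ x, |u t x| ≤ A := by
    have h1 : ∀ᵐ p ∂(slab T), |u p.1 p.2| ≤ A := by
      filter_upwards [ae_le_eLpNormEssSup (f := fun p : ℝ × Torus => u p.1 p.2) (μ := slab T)]
        with p hp
      rw [← Real.norm_eq_abs, ← toReal_enorm, hA, eLpNorm_exponent_top]
      refine ENNReal.toReal_mono ?_ hp
      rw [← eLpNorm_exponent_top]; exact hb.2.ne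
    exact Measure.ae_ae_of_ae_prod h1
  have hNg : ∀ᵐ t ∂μ, wienerNorm 2 (u t) = dNorm fun k => g k t := by
    filter_upwards [hgu, hint, h0] with t h1 h2 h3
    rw [wienerNorm, iInf_pos ⟨h2, h3⟩]
    simp only [dNorm, dissip, ofReal_abs_rpow_two, h1]
  have hfin : ∫⁻ t, dNorm (fun k => g k t) ∂μ ≠ ∞ := by
    rw [← lintegral_congr_ae hNg]
    simpa using hN.2.ne
  have hdg : ∀ᵐ t ∂μ, dNorm (fun k => g k t) < ∞ :=
    ae_lt_top (measurable_dNorm (c := fun t k => g k t) hgm) hfin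
  -- All the properties hold on a set `G` of full measure, off which the coefficients are set to 0.
  obtain ⟨G, hGμ, hGm, hG⟩ :=
    (hgu.and (hint.and (h0.and (hbd.and (hdg.and hd.2.2))))).exists_measurable_mem
  set c : ℝ → ℤ → ℂ := fun t k => G.indicator (g k) t with hc
  have hc1 : ∀ t ∈ G, c t = fourierHat (u t) := by
    intro t ht
    funext k
    simp only [hc, indicator_of_mem ht, (hG t ht).1 k]
  have hc2 : ∀ t ∉ G, c t = 0 := by
    intro t ht
    funext k
    simp only [hc, indicator_of_notMem ht, Pi.zero_apply]
  have hdc : ∀ t ∈ G, dNorm (fourierHat (u t)) ≠ ∞ := by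
    intro t ht
    have h1 := (hG t ht).2.2.2.2.1
    simp only [← (hG t ht).1] at h1
    exact h1.ne
  have hz : ∀ t ∈ G, fourierHat (u t) 0 = 0 := by
    intro t ht
    rw [fourierHat_zero, (hG t ht).2.2.1]; simp
  have hus : ∀ t ∈ G, u t =ᵐ[volume] synth (c t) := by
    intro t ht
    rw [hc1 t ht]
    exact ae_eq_synth (hG t ht).2.1 (wNorm_ne_top (hz t ht) (hdc t ht))
  refine ⟨A, c, fun k => (hgm k).indicator hGm, fun t => ?_, fun t k => ?_, fun t x => ?_, ?_, ?_⟩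
  · by_cases ht : t ∈ G
    · rw [hc1 t ht, hz t ht]
    · rw [hc2 t ht]; rfl
  · by_cases ht : t ∈ G
    · rw [hc1 t ht, fourierHat_neg]
    · rw [hc2 t ht]; simp
  · by_cases ht : t ∈ G
    · have hcs : Continuous (synth (c t)) := by
        rw [hc1 t ht]; exact continuous_synth (wNorm_ne_top (hz t ht) (hdc t ht))
      refine forall_le_of_ae_le hcs.abs ?_ x
      filter_upwards [hus t ht, (hG t ht).2.2.2.1] with x h1 h2
      rw [← h1]; exact h2
    · rw [hc2 t ht]
      have : synth 0 x = 0 := by simp [synth, fourierSeries]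
      rw [this, abs_zero]; exact ENNReal.toReal_nonneg
  · rw [setLIntegral_congr (Ioo_ae_eq_Ioc (μ := volume)).symm]
    refine ne_top_of_le_ne_top hfin (lintegral_mono fun t => ?_)
    unfold dNorm dissip
    gcongr with k
    simp only [hc]
    by_cases ht : t ∈ G
    · rw [indicator_of_mem ht]
    · rw [indicator_of_notMem ht]; simp
  · filter_upwards [hGμ] with t ht
    refine ⟨hc1 t ht, hus t ht, ?_⟩
    have h1 := (hG t ht).2.2.2.2.2
    rw [hc1 t ht, ← h1.fourierHat_eq]
    refine ae_eq_synth h1.2.1 ?_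
    rw [h1.fourierHat_eq]
    exact wNorm_dCoeff_ne_top (hdc t ht)

end

theorem fourierHat_congr_ae {u v : Torus → ℝ} (h : u =ᵐ[volume] v) :
    fourierHat u = fourierHat v := by
  funext k
  refine integral_congr_ae ?_
  filter_upwards [ae_haar_iff.2 h] with x hx
  simp only [hx]

/-- The Fourier coefficients of the flux of a weak solution at a fixed time, in terms of those of
the solution. -/
theorem ae_dCoeff_fourierHat_eq {ι : Type*} [Fintype ι] [DecidableEq ι] {m : ι → ℝ≥0}
    {B : ι → ι → ℝ≥0} {c : ι → ℤ → ℂ} (hz : ∀ i, c i 0 = 0) (hd : ∀ i, dNorm (c i) ≠ ∞)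
    (hc : ∀ i k, c i (-k) = (starRingEnd ℂ) (c i k)) (i : ι) {u q : Torus → ℝ}
    (hu : u =ᵐ[volume] synth (c i))
    (hq : q =ᵐ[volume] fun x => ∑ j, (B i j : ℝ) * synth (dCoeff (c j)) x) :
    dCoeff (fourierHat fun x => (u x + m i) * q x) = timeDeriv m B c i := by
  have hw := fun i => wNorm_ne_top (hz i) (hd i)
  have hw' := fun i => wNorm_dCoeff_ne_top (hd i)
  have h1 : (fun x => (u x + m i) * q x) =ᵐ[volume] synth (totalFlux m B c i) := by
    filter_upwards [hu, hq] with x h1 h2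
    rw [synth_totalFlux hw hw' hc, h1, h2]
  rw [fourierHat_congr_ae h1, ← dCoeff_totalFlux]
  congr 1
  funext k
  rw [fourierHat_synth (wNorm_totalFlux_ne_top hw hw' i), symmCoeff_of_conj (totalFlux_conj hc i)]

/-- A bounded weak solution in `L^1(Ȧ²)` solves the system on the Fourier side. -/
theorem IsWeakSolution.exists_boundedSolution {P : Fluids} {f₀ g₀ : Torus → ℝ} {T : ℝ} (hT : 0 < T)
    (hf : 0 ≤ mean f₀) (hg : 0 ≤ mean g₀) (hf₀ : Integrable (fluct f₀) volume)
    (hg₀ : Integrable (fluct g₀) volume) {f g : ℝ → Torus → ℝ} (h : IsWeakSolution P f₀ g₀ T f g)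
    (hbf : IsBounded T f) (hbg : IsBounded T g) (hNf : MemBochner 1 T (wienerNorm 2) f)
    (hNg : MemBochner 1 T (wienerNorm 2) g) :
    ∃ (A : ℝ) (c : Fin 2 → ℝ → ℤ → ℂ),
      BoundedSolution (means f₀ g₀) (diffusion P) T (initialModes f₀ g₀) A c ∧
      ∀ᵐ t ∂(volume.restrict (Ioo 0 T)), f t =ᵐ[volume] synth (c 0 t) ∧
        g t =ᵐ[volume] synth (c 1 t) := by
  obtain ⟨-, -, hf0, hg0, fx, gx, hfx, hgx, hef, heg⟩ := h
  obtain ⟨A, c, hcm, hcz, hcc, hcA, hci, hcf⟩ := exists_coefficients hfx hf0 hbf hNf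
  obtain ⟨A', d, hdm, hdz, hdc, hdA, hdi, hdg⟩ := exists_coefficients hgx hg0 hbg hNg
  have hcn : ∀ᵐ t ∂(volume.restrict (Ioo 0 T)), dNorm (c t) < ∞ :=
    ae_lt_top (measurable_dNorm hcm) (lintegral_Ioo_ne_top hci)
  have hdn : ∀ᵐ t ∂(volume.restrict (Ioo 0 T)), dNorm (d t) < ∞ :=
    ae_lt_top (measurable_dNorm hdm) (lintegral_Ioo_ne_top hdi)
  have hoc : (volume.restrict (Ioc (0 : ℝ) T)) = volume.restrict (Ioo 0 T) :=
    Measure.restrict_congr_set Ioo_ae_eq_Ioc.symm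
  have hqf := (hfx.2.1.const_mul P.bρ).add (hgx.2.1.const_mul P.b)
  have hqg := (hfx.2.1.const_mul P.bμ).add (hgx.2.1.const_mul P.bμ)
  have key : ∀ᵐ t ∂(volume.restrict (Ioo 0 T)),
      dCoeff (fourierHat fun x => (f t x + mean f₀) * (P.bρ * fx t x + P.b * gx t x)) =
        timeDeriv (means f₀ g₀) (diffusion P) (![c t, d t]) 0 ∧
      dCoeff (fourierHat fun x => (g t x + mean g₀) * (P.bμ * fx t x + P.bμ * gx t x)) =
        timeDeriv (means f₀ g₀) (diffusion P) (![c t, d t]) 1 := by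
    filter_upwards [hcf, hdg, hcn, hdn] with t h1 h2 h3 h4
    have hz : ∀ i, (![c t, d t] : Fin 2 → ℤ → ℂ) i 0 = 0 := by
      intro i; fin_cases i
      · exact hcz t
      · exact hdz t
    have hd : ∀ i, dNorm ((![c t, d t] : Fin 2 → ℤ → ℂ) i) ≠ ∞ := by
      intro i; fin_cases i
      · exact h3.ne
      · exact h4.ne
    have hc : ∀ i k, (![c t, d t] : Fin 2 → ℤ → ℂ) i (-k) =
        (starRingEnd ℂ) ((![c t, d t] : Fin 2 → ℤ → ℂ) i k) := by
      intro i k; fin_cases i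
      · exact hcc t k
      · exact hdc t k
    constructor
    · rw [← ae_dCoeff_fourierHat_eq hz hd hc 0 (u := f t)
        (q := fun x => P.bρ * fx t x + P.b * gx t x) h1.2.1 ?_]
      · simp [means, hf]
      · filter_upwards [h1.2.2, h2.2.2] with x e1 e2
        simp [diffusion, e1, e2, P.bρ_pos.le, P.b_pos.le]
    · rw [← ae_dCoeff_fourierHat_eq hz hd hc 1 (u := g t)
        (q := fun x => P.bμ * fx t x + P.bμ * gx t x) h2.2.1 ?_]
      · simp [means, hg]
      · filter_upwards [h1.2.2, h2.2.2] with x e1 e2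
        simp [diffusion, e1, e2, P.bμ_pos.le]
  have hcd : ∀ t, (fun j => (![c, d] : Fin 2 → ℝ → ℤ → ℂ) j t) = ![c t, d t] := by
    intro t; funext j; fin_cases j <;> rfl
  refine ⟨max A A', ![c, d], ⟨fun i k => ?_, fun i t => ?_, fun i t k => ?_, fun i t x => ?_,
    fun i => ?_, fun i k => ?_⟩, ?_⟩
  · fin_cases i
    · exact hcm k
    · exact hdm k
  · fin_cases i
    · exact hcz t
    · exact hdz t
  · fin_cases i
    · exact hcc t k
    · exact hdc t k
  · fin_cases i
    · exact (hcA t x).trans (le_max_left _ _)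
    · exact (hdA t x).trans (le_max_right _ _)
  · fin_cases i
    · exact hci
    · exact hdi
  · simp only [hcd, hoc]
    fin_cases i
    · filter_upwards [hef.ae_fourierHat_eq hT hf₀ hfx.1 hqf k, hcf,
        ae_restrict_mem measurableSet_Ioo] with t h1 h2 htT
      change c t k = fourierHat (fluct f₀) k + _
      rw [h2.1, h1]
      congr 1
      refine integral_congr_ae ?_
      filter_upwards [ae_restrict_of_ae_restrict_of_subset
        (fun s hs => ⟨hs.1, hs.2.trans_lt htT.2⟩ : Ioc 0 t ⊆ Ioo 0 T) key] with s hs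
      exact congrFun hs.1 k
    · filter_upwards [heg.ae_fourierHat_eq hT hg₀ hgx.1 hqg k, hdg,
        ae_restrict_mem measurableSet_Ioo] with t h1 h2 htT
      change d t k = fourierHat (fluct g₀) k + _
      rw [h2.1, h1]
      congr 1
      refine integral_congr_ae ?_
      filter_upwards [ae_restrict_of_ae_restrict_of_subset
        (fun s hs => ⟨hs.1, hs.2.trans_lt htT.2⟩ : Ioc 0 t ⊆ Ioo 0 T) key] with s hs
      exact congrFun hs.2 k
  · filter_upwards [hcf, hdg] with t h1 h2
    exact ⟨h1.2.1, h2.2.1⟩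

end ThinFilm

end

/-! ### Global existence, decay and uniqueness -/

theorem theorem2 (P : ThinFilm.Fluids) (f₀ g₀ : ThinFilm.Torus → ℝ)
    (hf₀ : ThinFilm.wienerNorm 0 (ThinFilm.fluct f₀) < ∞)
    (hg₀ : ThinFilm.wienerNorm 0 (ThinFilm.fluct g₀) < ∞)
    (hsize : ThinFilm.initialSize f₀ g₀ < min (ThinFilm.mean f₀) (ThinFilm.mean g₀))
    (hσ : 0 < min (ThinFilm.σ₁ P f₀ g₀) (ThinFilm.σ₂ P f₀ g₀)) :
    (∃ f g : ℝ → ThinFilm.Torus → ℝ,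
      (∀ T : ℝ, 0 < T → ThinFilm.IsWeakSolution P f₀ g₀ T f g ∧
        ThinFilm.IsRegular T f ∧ ThinFilm.IsRegular T g) ∧
      0 < ThinFilm.decayRate P f₀ g₀ ∧
      ∀ T : ℝ, 0 < T →
        eLpNorm (f T) ∞ volume + eLpNorm (g T) ∞ volume ≤
          ENNReal.ofReal (ThinFilm.initialSize f₀ g₀ *
            Real.exp (-(ThinFilm.decayRate P f₀ g₀ * T)))) ∧
    (∀ T : ℝ, 0 < T → ∀ f₁ g₁ f₂ g₂ : ℝ → ThinFilm.Torus → ℝ,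
      ThinFilm.IsWeakSolution P f₀ g₀ T f₁ g₁ → ThinFilm.IsWeakSolution P f₀ g₀ T f₂ g₂ →
      ThinFilm.IsBounded T f₁ → ThinFilm.IsBounded T g₁ →
      ThinFilm.IsBounded T f₂ → ThinFilm.IsBounded T g₂ →
      ThinFilm.MemBochner 1 T (ThinFilm.wienerNorm 2) f₁ →
      ThinFilm.MemBochner 1 T (ThinFilm.wienerNorm 2) g₁ →
      ThinFilm.MemBochner 1 T (ThinFilm.wienerNorm 2) f₂ →
      ThinFilm.MemBochner 1 T (ThinFilm.wienerNorm 2) g₂ →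
      ∀ᵐ t ∂(volume.restrict (Ioo 0 T)), f₁ t =ᵐ[volume] f₂ t ∧ g₁ t =ᵐ[volume] g₂ t) := by
  have hm := lt_min_iff.1 hsize
  have hE : 0 ≤ ThinFilm.initialSize f₀ g₀ := ThinFilm.initialSize_nonneg
  have hf : 0 ≤ ThinFilm.mean f₀ := hE.trans hm.1.le
  have hg : 0 ≤ ThinFilm.mean g₀ := hE.trans hm.2.le
  have hfi := (ThinFilm.of_wienerNorm_lt_top hf₀).1
  have hgi := (ThinFilm.of_wienerNorm_lt_top hg₀).1
  obtain ⟨c, hc, hc0, hdecay⟩ := ThinFilm.exists_modeSolution P hf₀ hg₀ hsize hσ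
  have hfc : ThinFilm.fluct f₀ =ᵐ[volume] ThinFilm.synth (c 0 0) := by
    rw [hc0]
    exact ThinFilm.ae_eq_synth hfi (by rw [← ThinFilm.wienerNorm_zero_eq hf₀]; exact hf₀.ne)
  have hgc : ThinFilm.fluct g₀ =ᵐ[volume] ThinFilm.synth (c 1 0) := by
    rw [hc0]
    exact ThinFilm.ae_eq_synth hgi (by rw [← ThinFilm.wienerNorm_zero_eq hg₀]; exact hg₀.ne)
  refine ⟨⟨fun t => ThinFilm.synth (c 0 t), fun t => ThinFilm.synth (c 1 t), fun T hT =>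
    ⟨hc.isWeakSolution P hf hg hfc hgc hT, (hc.path 0).isRegular T, (hc.path 1).isRegular T⟩, hσ,
    fun T hT => (add_le_add (ThinFilm.eLpNorm_synth_top_le _)
      (ThinFilm.eLpNorm_synth_top_le _)).trans (hdecay T hT.le)⟩, ?_⟩
  intro T hT f₁ g₁ f₂ g₂ h₁ h₂ hf₁ hg₁ hf₂ hg₂ nf₁ ng₁ nf₂ ng₂
  -- Any bounded weak solution coincides with the one constructed above.
  have huniq : ∀ f g : ℝ → ThinFilm.Torus → ℝ, ThinFilm.IsWeakSolution P f₀ g₀ T f g →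
      ThinFilm.IsBounded T f → ThinFilm.IsBounded T g →
      ThinFilm.MemBochner 1 T (ThinFilm.wienerNorm 2) f →
      ThinFilm.MemBochner 1 T (ThinFilm.wienerNorm 2) g →
      ∀ᵐ t ∂(volume.restrict (Ioo 0 T)), f t =ᵐ[volume] ThinFilm.synth (c 0 t) ∧
        g t =ᵐ[volume] ThinFilm.synth (c 1 t) := by
    intro f g h hbf hbg nf ng
    obtain ⟨A, d, hd, hfg⟩ := h.exists_boundedSolution hT hf hg hfi hgi hbf hbg nf ng
    have hcb := hc.boundedSolution T
    have hV : (fun i k => c i 0 k) = ThinFilm.initialModes f₀ g₀ := funext hc0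
    rw [hV, Real.coe_toNNReal _ hE] at hcb
    have heq := hd.ae_eq (ThinFilm.isParabolic P hsize hσ) hcb
    filter_upwards [hfg, ae_restrict_of_ae_restrict_of_subset Ioo_subset_Ioc_self heq]
      with t h1 h2
    rw [← h2 0, ← h2 1]
    exact h1
  filter_upwards [huniq f₁ g₁ h₁ hf₁ hg₁ nf₁ ng₁, huniq f₂ g₂ h₂ hf₂ hg₂ nf₂ ng₂] with t e₁ e₂
  exact ⟨e₁.1.trans e₂.1.symm, e₁.2.trans e₂.2.symm⟩
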